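/- **Setting.** For every $n\in\mathbb N$ let $T=T_n\ge 1$, $W=W_n\in\mathbb R^{n\times n}$, $m=m_n\in\mathbb R^n$ and a real sequence $u=u_n=(u_t)_{t\in\mathbb Z}$ be given, and let $\eta>0$ be fixed. Put $A=MU\in\mathbb R^{n\times T}$, where $M$ is the $n\times T$ matrix with columns $m,Wm,\dots,W^{T-1}m$ and $U=T^{-1/2}\{u_{j-i}\}_{i,j=1}^T$. Assume, with $\|\cdot\|$ the spectral norm, that $\sup_n\|W_n\|<1$, that $\sup_n\|A_nA_n^{\sf T}\|<\infty$, and that $n/T\to c\in[0,1)\cup(1,\infty)$ as $n\to\infty$. Write $x^+=\max(x,0)$, and for $q\in\mathbb Z$ let $$S_q=\sum_{k\ge0}W^{k+(-q)^+}\big(W^{k+q^+}\big)^{\sf T}\in\mathbb R^{n\times n},\qquad [J^q]_{ij}=\boldsymbol\delta_{i+q,j}\ (1\le i,j\le T).$$ For $\gamma>0$ let $(R_\gamma,\tilde R_\gamma)$, $R_\gamma\in\mathbb R^{T\times T}$, $\tilde R_\gamma\in\mathbb R^{n\times n}$, be a pair of positive semidefinite solutions of $$R_\gamma=\Big\{\tfrac1T\operatorname{tr}(S_{i-j}\bar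 Q_\gamma)\Big\}_{i,j=1}^T,\qquad \tilde R_\gamma=\sum_{q=-\infty}^{\infty}\tfrac1T\operatorname{tr}\big(J^q\bar{\tilde Q}_\gamma\big)S_q,$$ $$\bar Q_\gamma=\tfrac1\gamma\Big(I_n+\eta^2\tilde R_\gamma+\tfrac1\gamma A(I_T+\eta^2R_\gamma)^{-1}A^{\sf T}\Big)^{-1},\qquad \bar{\tilde Q}_\gamma=\tfrac1\gamma\Big(I_T+\eta^2R_\gamma+\tfrac1\gamma A^{\sf T}(I_n+\eta^2\tilde R_\gamma)^{-1}A\Big)^{-1}.$$ For all large $n$ let $(\mathcal R,\tilde{\mathcal R})$ be a pair of positive semidefinite solutions, with $\boldsymbol\delta_{c<1}I_T+\mathcal R$ and $\boldsymbol\delta_{c>1}I_n+\tilde{\mathcal R}$ invertible, of the $\gamma$-free system $$\mathcal R=c\Big\{\tfrac1n\operatorname{tr}\big(S_{i-j}(\boldsymbol\delta_{c>1}I_n+\tilde{\mathcal R})^{-1}\big)\Big\}_{i,j=1}^T,\qquad \tilde{\mathcal R}=\sum_{q=-\infty}^{\infty}\tfrac1T\operatorname{tr}\big(J^q(\boldsymbol\delta_{c<1}I_T+\mathcal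 R)^{-1}\big)S_q,$$ and put $$\tilde{\mathcal Q}=\Big(\boldsymbol\delta_{c<1}I_T+\mathcal R+\tfrac1{\eta^2}A^{\sf T}(\boldsymbol\delta_{c>1}I_n+\tilde{\mathcal R})^{-1}A\Big)^{-1},\qquad \mathcal Q=\Big(\boldsymbol\delta_{c>1}I_n+\tilde{\mathcal R}+\tfrac1{\eta^2}A(\boldsymbol\delta_{c<1}I_T+\mathcal R)^{-1}A^{\sf T}\Big)^{-1}.$$ **Claim.** Such pairs exist: $(R_\gamma,\tilde R_\gamma)$ for all $n$ and all $\gamma>0$, and $(\mathcal R,\tilde{\mathcal R})$ for all large $n$. Whichever such pairs are chosen, the following holds, where for matrices $F_{n,\gamma}$ and $L_n$ of the same size "$F_{n,\gamma}\to L_n$" means that for all large $n$ the limit $\lim_{\gamma\downarrow0}F_{n,\gamma}$ exists, and that for every $\varepsilon>0$ there are $N$ and $\gamma_0>0$ such that $\|F_{n,\gamma}-L_n\|<\varepsilon$ for all $n\ge N$ and $0<\gamma<\gamma_0$ (so that also $\|\lim_{\gamma\downarrow0}F_{n,\gamma}-L_n\|\to0$ as $n\to\infty$). 1. If $c<1$,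 then $\eta^2R_\gamma\to\mathcal R$, $\gamma\tilde R_\gamma\to\tilde{\mathcal R}$, $\eta^2\bar Q_\gamma\to\mathcal Q$ and $\gamma\bar{\tilde Q}_\gamma\to\tilde{\mathcal Q}$. 2. If $c>1$, then $\gamma R_\gamma\to\mathcal R$, $\eta^2\tilde R_\gamma\to\tilde{\mathcal R}$, $\gamma\bar Q_\gamma\to\mathcal Q$ and $\eta^2\bar{\tilde Q}_\gamma\to\tilde{\mathcal Q}$. -/

import Mathlib

open Filter Topology
open scoped Matrix Matrix.Norms.L2Operator

namespace ESN

noncomputable section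

/-- The `n × T` matrix whose `j`-th column is `W ^ j m`, for `j = 0, …, T - 1`. -/
def inputMemory {n : ℕ} (T : ℕ) (W : Matrix (Fin n) (Fin n) ℝ) (m : Fin n → ℝ) :
    Matrix (Fin n) (Fin T) ℝ :=
  Matrix.of fun i j => (W ^ (j : ℕ) *ᵥ m) i

/-- The `T × T` Toeplitz matrix of the input, with entries `u (j - i) / √T`. -/
def inputToeplitz (T : ℕ) (u : ℤ → ℝ) : Matrix (Fin T) (Fin T) ℝ :=
  Matrix.of fun i j => (1 / Real.sqrt T) * u ((j : ℤ) - (i : ℤ))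

/-- The deterministic data matrix `A = M U`. -/
def dataMatrix {n : ℕ} (T : ℕ) (W : Matrix (Fin n) (Fin n) ℝ) (m : Fin n → ℝ) (u : ℤ → ℝ) :
    Matrix (Fin n) (Fin T) ℝ :=
  inputMemory T W m * inputToeplitz T u

/-- `S_q = ∑_{k ≥ 0} W ^ (k + (-q)⁺) (W ^ (k + q⁺))ᵀ` for `q ∈ ℤ`. -/
def lagCov {n : ℕ} (W : Matrix (Fin n) (Fin n) ℝ) (q : ℤ) : Matrix (Fin n) (Fin n) ℝ :=
  ∑' k : ℕ, W ^ (k + (-q).toNat) * (W ^ (k + q.toNat))ᵀ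

/-- The shift `J ^ q`, with `(i, j)` entry `1` if `i + q = j` and `0` otherwise. -/
def shift (T : ℕ) (q : ℤ) : Matrix (Fin T) (Fin T) ℝ :=
  Matrix.of fun i j => if (i : ℤ) + q = (j : ℤ) then 1 else 0

/-- The `T × T` matrix with `(i, j)` entry `tr (S_{i-j} B)`. -/
def traceToeplitz {n : ℕ} (T : ℕ) (W : Matrix (Fin n) (Fin n) ℝ)
    (B : Matrix (Fin n) (Fin n) ℝ) : Matrix (Fin T) (Fin T) ℝ :=
  Matrix.of fun i j => (lagCov W ((i : ℤ) - (j : ℤ)) * B).trace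

/-- The `n × n` matrix `∑_{q ∈ ℤ} (1/T) tr (J ^ q B) S_q`; its terms vanish for `|q| ≥ T`. -/
def shiftTraceSum {n T : ℕ} (W : Matrix (Fin n) (Fin n) ℝ) (B : Matrix (Fin T) (Fin T) ℝ) :
    Matrix (Fin n) (Fin n) ℝ :=
  ∑' q : ℤ, ((1 / (T : ℝ)) * (shift T q * B).trace) • lagCov W q

/-- `Q̄_γ = (1/γ) (I + η² R̃ + (1/γ) A (I + η² R)⁻¹ Aᵀ)⁻¹`. -/
def Qbar {n T : ℕ} (A : Matrix (Fin n) (Fin T) ℝ) (η γ : ℝ)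
    (R : Matrix (Fin T) (Fin T) ℝ) (R' : Matrix (Fin n) (Fin n) ℝ) : Matrix (Fin n) (Fin n) ℝ :=
  (1 / γ) • (1 + η ^ 2 • R' + (1 / γ) • (A * (1 + η ^ 2 • R)⁻¹ * Aᵀ))⁻¹

/-- The `T × T` counterpart `(1/γ) (I + η² R + (1/γ) Aᵀ (I + η² R̃)⁻¹ A)⁻¹` of `Q̄_γ`. -/
def Qbar' {n T : ℕ} (A : Matrix (Fin n) (Fin T) ℝ) (η γ : ℝ)
    (R : Matrix (Fin T) (Fin T) ℝ) (R' : Matrix (Fin n) (Fin n) ℝ) : Matrix (Fin T) (Fin T) ℝ :=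
  (1 / γ) • (1 + η ^ 2 • R + (1 / γ) • (Aᵀ * (1 + η ^ 2 • R')⁻¹ * A))⁻¹

/-- `(R, R') = (R_γ, R̃_γ)` is a (positive semidefinite) solution of the system defining the
deterministic equivalents at `γ`. -/
structure IsDetEquiv {n T : ℕ} (W : Matrix (Fin n) (Fin n) ℝ) (A : Matrix (Fin n) (Fin T) ℝ)
    (η γ : ℝ) (R : Matrix (Fin T) (Fin T) ℝ) (R' : Matrix (Fin n) (Fin n) ℝ) : Prop where
  posSemidef : R.PosSemidef
  posSemidef' : R'.PosSemidef
  eq : R = (1 / (T : ℝ)) • traceToeplitz T W (Qbar A η γ R R')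
  eq' : R' = shiftTraceSum W (Qbar' A η γ R R')

/-- `δ_{c<1}`. -/
def δlt (c : ℝ) : ℝ := if c < 1 then 1 else 0

/-- `δ_{c>1}`. -/
def δgt (c : ℝ) : ℝ := if 1 < c then 1 else 0

/-- `(R, R') = (𝓡, 𝓡̃)` is a (positive semidefinite) solution of the `γ`-free system, for which
the two matrices that the system inverts are nonsingular (hence positive definite). -/
structure IsLimitEquiv {n T : ℕ} (c : ℝ) (W : Matrix (Fin n) (Fin n) ℝ)
    (R : Matrix (Fin T) (Fin T) ℝ) (R' : Matrix (Fin n) (Fin n) ℝ) : Prop where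
  posSemidef : R.PosSemidef
  posSemidef' : R'.PosSemidef
  posDef : (δlt c • (1 : Matrix (Fin T) (Fin T) ℝ) + R).PosDef
  posDef' : (δgt c • (1 : Matrix (Fin n) (Fin n) ℝ) + R').PosDef
  eq : R = c • ((1 / (n : ℝ)) • traceToeplitz T W (δgt c • 1 + R')⁻¹)
  eq' : R' = shiftTraceSum W (δlt c • 1 + R)⁻¹

/-- `𝒬 = (δ_{c>1} I + 𝓡̃ + η⁻² A (δ_{c<1} I + 𝓡)⁻¹ Aᵀ)⁻¹`. -/
def Qlim {n T : ℕ} (c : ℝ) (A : Matrix (Fin n) (Fin T) ℝ) (η : ℝ)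
    (R : Matrix (Fin T) (Fin T) ℝ) (R' : Matrix (Fin n) (Fin n) ℝ) : Matrix (Fin n) (Fin n) ℝ :=
  (δgt c • 1 + R' + (1 / η ^ 2) • (A * (δlt c • 1 + R)⁻¹ * Aᵀ))⁻¹

/-- `𝒬̃ = (δ_{c<1} I + 𝓡 + η⁻² Aᵀ (δ_{c>1} I + 𝓡̃)⁻¹ A)⁻¹`. -/
def Qlim' {n T : ℕ} (c : ℝ) (A : Matrix (Fin n) (Fin T) ℝ) (η : ℝ)
    (R : Matrix (Fin T) (Fin T) ℝ) (R' : Matrix (Fin n) (Fin n) ℝ) : Matrix (Fin T) (Fin T) ℝ :=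
  (δlt c • 1 + R + (1 / η ^ 2) • (Aᵀ * (δgt c • 1 + R')⁻¹ * A))⁻¹

/-- `F n γ` (a square matrix of size `d n`, `γ > 0`) has, for all large `n`, a limit as `γ ↓ 0`, and
it converges to `L n` in spectral norm as `n → ∞` and `γ ↓ 0`: for every `ε > 0` there are `N` and
`γ₀ > 0` with `‖F n γ - L n‖ < ε` whenever `n ≥ N` and `0 < γ < γ₀`. -/
def SmallGammaLimit {d : ℕ → ℕ} (F : (n : ℕ) → ℝ → Matrix (Fin (d n)) (Fin (d n)) ℝ)
    (L : (n : ℕ) → Matrix (Fin (d n)) (Fin (d n)) ℝ) : Prop :=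
  (∀ᶠ n in atTop, ∃ l : Matrix (Fin (d n)) (Fin (d n)) ℝ, Tendsto (F n) (𝓝[>] 0) (𝓝 l)) ∧
  ∀ ε > 0, ∃ N : ℕ, ∃ γ₀ > 0, ∀ n ≥ N, ∀ γ : ℝ, 0 < γ → γ < γ₀ → ‖F n γ - L n‖ < ε

end

end ESN

open scoped MatrixOrder

set_option linter.unusedSectionVars false

/-! Why the theorem holds. For `c < 1` put `X = 1 + η² R`, `Y = γ/η² + γ R̃` and absorb `1/η` into
`A`. The system at `γ` becomes `X = 1 + s Φ(Q)`, `Y = b + s Φ'(Q')` with `Q = (Y + A X⁻¹ Aᵀ)⁻¹`, `Q'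
= (X + Aᵀ Y⁻¹ A)⁻¹`, `s = 1/T`, `b = γ/η²`. Here `Q` and `Q'` are `η²` times the first resolvent and
`γ` times the second. The `γ`-free system is the same one with `b = 0`, `A = 0` and the
normalization `1/T` in front of `Φ` replaced by `c/n`. For `c > 1` the two sides exchange roles.

The maps `Φ`, `Φ'` are adjoint, positive and comparable with `B ↦ tr B • 1`, uniformly in `n`
(`transferPair`): their quadratic forms are those of a stable autoregression, whose filter and
inverse filter are bounded. Adjointness and the push-through identity bound `tr Q'` below by a
multiple of `T - n` when the normalizations agree (`ExactSol.card_sub_le_trace`, with a correction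
factor otherwise). This is where `c ≠ 1` enters; it keeps `Y` away from `0` uniformly in `γ` and `n`
(`ExactSol.bounds`).

Stability is measured in the order, by the least `c` with `X₁ ≤ c X₂ ≤ c² X₁` and likewise for `Y`.
The right-hand sides do not increase this constant, being monotone and homogeneous up to the
constant terms. The unit term in the equation of `X` makes the constant of `X` drop strictly; the
dependence of `Q'` on `X` passes part of the gain to `Y`. Hence approximate solutions with error `δ`
satisfy `c - 1 ≤ C δ` with `C` independent of the dimension (`exists_mutualLE`). Treating `b` as an
error gives the limit in `γ` at fixed `n`, and solvability at `b = 0`; for `b > 0` a monotone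
iteration solves the system.

Finally `A` disappears from the equations because `A - W A J` has rank at most `3`. Iterating, `A`
is a matrix of rank `O(L)` plus one of norm at most `‖W‖^L ‖A‖`, so `tr(A Z) = o(n) ‖Z‖`. The
solution at `γ` is thus an approximate solution of the `γ`-free system (`ExactSol.approxSol_zero`),
and stability with `A = 0` concludes. The resolvents keep `A` and inherit the same order constant.
-/

namespace ESN

/-! ### Loewner order, inverses and the spectral norm. -/

section Loewner

variable {m k : Type*} [Fintype m] [DecidableEq m] [Fintype k] [DecidableEq k]

lemma quad_le_of_le {A B : Matrix m m ℝ} (h : A ≤ B) (v : m → ℝ) :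
    v ⬝ᵥ A *ᵥ v ≤ v ⬝ᵥ B *ᵥ v := by
  have := (Matrix.le_iff.1 h).dotProduct_mulVec_nonneg v
  simpa [Matrix.sub_mulVec, dotProduct_sub] using this

lemma le_of_quad_le {A B : Matrix m m ℝ} (hA : A.IsHermitian) (hB : B.IsHermitian)
    (h : ∀ v : m → ℝ, v ⬝ᵥ A *ᵥ v ≤ v ⬝ᵥ B *ᵥ v) : A ≤ B := by
  refine Matrix.le_iff.2 (.of_dotProduct_mulVec_nonneg (hB.sub hA) fun v => ?_)
  simpa [Matrix.sub_mulVec, dotProduct_sub] using h v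

lemma isHermitian_of_nonneg {A : Matrix m m ℝ} (h : 0 ≤ A) : A.IsHermitian :=
  (Matrix.nonneg_iff_posSemidef.1 h).isHermitian

lemma transpose_eq_of_isHermitian {A : Matrix m m ℝ} (h : A.IsHermitian) : Aᵀ = A := by
  rw [← Matrix.conjTranspose_eq_transpose_of_trivial, h.eq]

lemma transpose_eq_of_nonneg {A : Matrix m m ℝ} (h : 0 ≤ A) : Aᵀ = A :=
  transpose_eq_of_isHermitian (isHermitian_of_nonneg h)

lemma posDef_of_smul_one_le {A : Matrix m m ℝ} {c : ℝ} (hc : 0 < c)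
    (h : c • (1 : Matrix m m ℝ) ≤ A) : A.PosDef := by
  have h1 : (c • (1 : Matrix m m ℝ)).PosDef := Matrix.PosDef.one.smul hc
  simpa using h1.add_posSemidef (Matrix.le_iff.1 h)

lemma posDef_of_le {A B : Matrix m m ℝ} (hA : A.PosDef) (h : A ≤ B) : B.PosDef := by
  simpa using hA.add_posSemidef (Matrix.le_iff.1 h)

lemma isUnit_det_of_posDef {A : Matrix m m ℝ} (hA : A.PosDef) : IsUnit A.det :=
  (Matrix.isUnit_iff_isUnit_det _).1 hA.isUnit

lemma conj_le_conj {A B : Matrix m m ℝ} (h : A ≤ B) (C : Matrix k m ℝ) :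
    C * A * Cᵀ ≤ C * B * Cᵀ := by
  rw [Matrix.le_iff] at h ⊢
  have := h.mul_mul_conjTranspose_same C
  simpa [Matrix.mul_sub, Matrix.sub_mul] using this

lemma conj_nonneg {A : Matrix m m ℝ} (h : 0 ≤ A) (C : Matrix k m ℝ) : 0 ≤ C * A * Cᵀ := by
  simpa using conj_le_conj h C

/-- The form of `A⁻¹` at `v` is the maximum over `y` of `2 v·y - y·A y`. Evaluating at `y = B⁻¹ v`,
where `y·A y ≤ y·B y = v·y`, gives the bound. -/
lemma inv_le_inv_of_le {A B : Matrix m m ℝ} (hA : A.PosDef) (h : A ≤ B) : B⁻¹ ≤ A⁻¹ := by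
  have hB := posDef_of_le hA h
  refine le_of_quad_le hB.inv.isHermitian hA.inv.isHermitian fun v => ?_
  set y := B⁻¹ *ᵥ v with hy
  set z := A⁻¹ *ᵥ v with hz
  have hBy : B *ᵥ y = v := by
    rw [hy, Matrix.mulVec_mulVec, Matrix.mul_nonsing_inv _ (isUnit_det_of_posDef hB),
      Matrix.one_mulVec]
  have hAz : A *ᵥ z = v := by
    rw [hz, Matrix.mulVec_mulVec, Matrix.mul_nonsing_inv _ (isUnit_det_of_posDef hA),
      Matrix.one_mulVec]
  have h1 := quad_le_of_le h y
  rw [hBy] at h1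
  have h2 := hA.posSemidef.dotProduct_mulVec_nonneg (y - z)
  have hAt : Aᵀ = A := transpose_eq_of_isHermitian hA.isHermitian
  have h3 : z ⬝ᵥ A *ᵥ y = v ⬝ᵥ y := by
    rw [Matrix.dotProduct_mulVec, ← Matrix.mulVec_transpose, hAt, hAz]
  simp only [star_trivial, Matrix.mulVec_sub, hAz, dotProduct_sub, sub_dotProduct, h3] at h2
  rw [dotProduct_comm v y, dotProduct_comm v z] at *
  linarith

lemma inv_smul_eq {A : Matrix m m ℝ} {c : ℝ} (hc : c ≠ 0) : (c • A)⁻¹ = c⁻¹ • A⁻¹ := by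
  by_cases h : IsUnit A.det
  · exact Matrix.inv_smul' A (Units.mk0 c hc) h
  · rw [Matrix.nonsing_inv_apply_not_isUnit A h, Matrix.nonsing_inv_apply_not_isUnit, smul_zero]
    rw [Matrix.det_smul]
    simpa [isUnit_iff_ne_zero, hc] using h

lemma inv_le_smul_one {A : Matrix m m ℝ} {c : ℝ} (hc : 0 < c)
    (h : c • (1 : Matrix m m ℝ) ≤ A) : A⁻¹ ≤ c⁻¹ • (1 : Matrix m m ℝ) := by
  have := inv_le_inv_of_le (Matrix.PosDef.one.smul hc) h
  rwa [inv_smul_eq hc.ne', inv_one] at this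

lemma smul_one_le_smul_one {a b : ℝ} (h : a ≤ b) :
    a • (1 : Matrix m m ℝ) ≤ b • (1 : Matrix m m ℝ) := by
  rw [Matrix.le_iff, ← sub_smul]
  exact Matrix.PosSemidef.one.smul (sub_nonneg.2 h)

lemma trace_le_trace {A B : Matrix m m ℝ} (h : A ≤ B) : A.trace ≤ B.trace := by
  have := (Matrix.le_iff.1 h).trace_nonneg
  simpa [Matrix.trace_sub] using this

lemma trace_mul_nonneg {A B : Matrix m m ℝ} (hA : 0 ≤ A) (hB : 0 ≤ B) : 0 ≤ (A * B).trace := by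
  obtain ⟨C, rfl⟩ := CStarAlgebra.nonneg_iff_eq_star_mul_self.1 hB
  rw [Matrix.star_eq_conjTranspose, ← mul_assoc, Matrix.trace_mul_comm, ← mul_assoc]
  have := conj_nonneg hA C
  simpa using (Matrix.nonneg_iff_posSemidef.1 this).trace_nonneg

lemma smul_le_smul_of_nonneg {A B : Matrix m m ℝ} {c : ℝ} (hc : 0 ≤ c) (h : A ≤ B) :
    c • A ≤ c • B := smul_le_smul_of_nonneg_left h hc

lemma smul_le_smul_of_le {A : Matrix m m ℝ} {a b : ℝ} (hab : a ≤ b) (hA : 0 ≤ A) :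
    a • A ≤ b • A := smul_le_smul_of_nonneg_right hab hA

lemma smul_one_nonneg {c : ℝ} (hc : 0 ≤ c) : 0 ≤ c • (1 : Matrix m m ℝ) := by
  simpa using smul_one_le_smul_one (m := m) hc

lemma norm_le_of_mulVec {A : Matrix m k ℝ} {c : ℝ} (hc : 0 ≤ c)
    (h : ∀ v : k → ℝ, (A *ᵥ v) ⬝ᵥ (A *ᵥ v) ≤ c ^ 2 * (v ⬝ᵥ v)) : ‖A‖ ≤ c := by
  rw [Matrix.l2_opNorm_def]
  refine ContinuousLinearMap.opNorm_le_bound _ hc fun x => ?_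
  refine abs_le_of_sq_le_sq' ?_ (by positivity) |>.2
  rw [mul_pow, EuclideanSpace.real_norm_sq_eq, EuclideanSpace.real_norm_sq_eq]
  have := h x.ofLp
  simpa [dotProduct, pow_two] using this

lemma mulVec_dotProduct_self_le (A : Matrix m k ℝ) (v : k → ℝ) :
    (A *ᵥ v) ⬝ᵥ (A *ᵥ v) ≤ ‖A‖ ^ 2 * (v ⬝ᵥ v) := by
  have := Matrix.l2_opNorm_mulVec A (WithLp.toLp 2 v)
  have h2 := pow_le_pow_left₀ (norm_nonneg _) this 2
  rw [mul_pow, EuclideanSpace.real_norm_sq_eq, EuclideanSpace.real_norm_sq_eq] at h2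
  simpa [dotProduct, pow_two] using h2

lemma norm_transpose_eq (A : Matrix m k ℝ) : ‖Aᵀ‖ = ‖A‖ := by
  simpa using Matrix.l2_opNorm_conjTranspose A

lemma dotProduct_mulVec_le_norm (A : Matrix m m ℝ) (v : m → ℝ) :
    v ⬝ᵥ A *ᵥ v ≤ ‖A‖ * (v ⬝ᵥ v) := by
  have h := mulVec_dotProduct_self_le A v
  have hcs : (v ⬝ᵥ A *ᵥ v) ^ 2 ≤ (v ⬝ᵥ v) * ((A *ᵥ v) ⬝ᵥ (A *ᵥ v)) := by
    have := Finset.sum_mul_sq_le_sq_mul_sq Finset.univ v (A *ᵥ v)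
    simpa [dotProduct, pow_two] using this
  have hv : 0 ≤ v ⬝ᵥ v := by simpa using dotProduct_star_self_nonneg v
  refine (abs_le_of_sq_le_sq' ?_ (by positivity)).2
  nlinarith

lemma norm_le_of_le {A : Matrix m m ℝ} {c : ℝ} (hc : 0 ≤ c)
    (h1 : A ≤ c • (1 : Matrix m m ℝ)) (h2 : -A ≤ c • (1 : Matrix m m ℝ)) : ‖A‖ ≤ c := by
  have hA : A.IsHermitian := by
    have h3 := (Matrix.le_iff.1 h1).isHermitian
    have h4 : (c • (1 : Matrix m m ℝ)).IsHermitian := by simp [Matrix.IsHermitian]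
    simpa using h4.sub h3
  have hAt : Aᵀ = A := transpose_eq_of_isHermitian hA
  have hP := Matrix.nonneg_iff_posSemidef.1 (sub_nonneg.2 h1)
  have hN := Matrix.nonneg_iff_posSemidef.1 (sub_nonneg.2 h2)
  refine norm_le_of_mulVec hc fun v => ?_
  rcases hc.eq_or_lt with rfl | hc
  · have h0 : A = 0 := le_antisymm (by simpa using h1) (by simpa using h2)
    simp [h0]
  -- `(c - A)(c + A)(c - A) + (c + A)(c - A)(c + A) = 2c (c² - A²)`
  have e1 := quad_le_of_le (conj_nonneg hN.nonneg (c • 1 - A)) v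
  have e2 := quad_le_of_le (conj_nonneg hP.nonneg (c • 1 + A)) v
  have key : (c • 1 - A) * (c • 1 - -A) * (c • 1 - A)ᵀ + (c • 1 + A) * (c • 1 - A) * (c • 1 + A)ᵀ
      = (2 * c) • (c ^ 2 • (1 : Matrix m m ℝ) - A * A) := by
    simp only [Matrix.transpose_sub, Matrix.transpose_add, hAt, Matrix.transpose_smul,
      Matrix.transpose_one, mul_sub, sub_mul, mul_add, add_mul, smul_mul_assoc, one_mul,
      mul_smul_comm, mul_one, sub_neg_eq_add, smul_sub, smul_smul]
    module
  have e3 := add_le_add e1 e2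
  rw [← dotProduct_add, ← Matrix.add_mulVec, ← dotProduct_add, ← Matrix.add_mulVec, key] at e3
  have e4 : v ⬝ᵥ (A * A) *ᵥ v = (A *ᵥ v) ⬝ᵥ (A *ᵥ v) := by
    rw [← Matrix.mulVec_mulVec, Matrix.dotProduct_mulVec, ← Matrix.mulVec_transpose, hAt]
  simp only [Matrix.smul_mulVec, Matrix.sub_mulVec, dotProduct_smul, dotProduct_sub, e4,
    Matrix.one_mulVec, smul_eq_mul, Matrix.zero_mulVec, dotProduct_zero, add_zero] at e3
  have := nonneg_of_mul_nonneg_right e3 (by positivity : 0 < 2 * c)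
  linarith

lemma norm_le_of_nonneg_of_le {A : Matrix m m ℝ} {c : ℝ} (hc : 0 ≤ c) (h0 : 0 ≤ A)
    (h1 : A ≤ c • (1 : Matrix m m ℝ)) : ‖A‖ ≤ c :=
  norm_le_of_le hc h1 ((neg_nonpos.2 h0).trans (smul_one_nonneg hc))

lemma transpose_mul_self_le (A : Matrix m k ℝ) : Aᵀ * A ≤ ‖A‖ ^ 2 • (1 : Matrix k k ℝ) := by
  refine le_of_quad_le ?_ (by simp [Matrix.IsHermitian]) fun v => ?_
  · simp [Matrix.IsHermitian]
  · have := mulVec_dotProduct_self_le A v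
    rw [← Matrix.mulVec_mulVec, Matrix.dotProduct_mulVec, Matrix.vecMul_transpose]
    simpa [Matrix.smul_mulVec] using this

end Loewner

/-! ### The coupled system, and comparison in the order. -/

section System

variable {m k : Type*} [Fintype m] [DecidableEq m] [Fintype k] [DecidableEq k]

/-- The matrix `(Y + A X⁻¹ Aᵀ)⁻¹`. -/
noncomputable def schurInv (A : Matrix m k ℝ) (Y : Matrix m m ℝ) (X : Matrix k k ℝ) :
    Matrix m m ℝ :=
  (Y + A * X⁻¹ * Aᵀ)⁻¹

lemma schurInv_zero (Y : Matrix m m ℝ) (X : Matrix k k ℝ) :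
    schurInv (0 : Matrix m k ℝ) Y X = Y⁻¹ := by
  simp [schurInv]

lemma gram_nonneg (A : Matrix m k ℝ) {X : Matrix k k ℝ} (hX : X.PosDef) : 0 ≤ A * X⁻¹ * Aᵀ :=
  conj_nonneg hX.inv.posSemidef.nonneg A

lemma le_add_gram (A : Matrix m k ℝ) (Y : Matrix m m ℝ) {X : Matrix k k ℝ} (hX : X.PosDef) :
    Y ≤ Y + A * X⁻¹ * Aᵀ :=
  le_add_of_nonneg_right (gram_nonneg A hX)

lemma posDef_add_gram (A : Matrix m k ℝ) {Y : Matrix m m ℝ} {X : Matrix k k ℝ} (hY : Y.PosDef)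
    (hX : X.PosDef) : (Y + A * X⁻¹ * Aᵀ).PosDef :=
  posDef_of_le hY (le_add_gram A Y hX)

lemma schurInv_posDef (A : Matrix m k ℝ) {Y : Matrix m m ℝ} {X : Matrix k k ℝ} (hY : Y.PosDef)
    (hX : X.PosDef) : (schurInv A Y X).PosDef :=
  (posDef_add_gram A hY hX).inv

lemma schurInv_nonneg (A : Matrix m k ℝ) {Y : Matrix m m ℝ} {X : Matrix k k ℝ} (hY : Y.PosDef)
    (hX : X.PosDef) : 0 ≤ schurInv A Y X :=
  (schurInv_posDef A hY hX).posSemidef.nonneg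

lemma schurInv_le_inv (A : Matrix m k ℝ) {Y : Matrix m m ℝ} {X : Matrix k k ℝ} (hY : Y.PosDef)
    (hX : X.PosDef) : schurInv A Y X ≤ Y⁻¹ :=
  inv_le_inv_of_le hY (le_add_gram A Y hX)

lemma inv_le_smul_inv {X₁ X₂ : Matrix k k ℝ} {c : ℝ} (hc : 0 < c) (h₁ : X₁.PosDef)
    (h : X₁ ≤ c • X₂) : X₂⁻¹ ≤ c • X₁⁻¹ := by
  have h1 := inv_le_inv_of_le h₁ h
  rw [inv_smul_eq hc.ne'] at h1
  simpa [smul_smul, hc.ne'] using smul_le_smul_of_nonneg hc.le h1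

lemma gram_le_smul_gram (A : Matrix m k ℝ) {X₁ X₂ : Matrix k k ℝ} {c : ℝ} (hc : 0 < c)
    (h₁ : X₁.PosDef) (h : X₁ ≤ c • X₂) : A * X₂⁻¹ * Aᵀ ≤ c • (A * X₁⁻¹ * Aᵀ) := by
  simpa using conj_le_conj (inv_le_smul_inv hc h₁ h) A

/-- `schurInv` is monotone in its second variable and antitone in its first, and homogeneous. -/
lemma schurInv_le_smul (A : Matrix m k ℝ) {Y₁ Y₂ : Matrix m m ℝ} {X₁ X₂ : Matrix k k ℝ} {c : ℝ}
    (hc : 0 < c) (hY₂ : Y₂.PosDef) (hX₁ : X₁.PosDef) (hX₂ : X₂.PosDef)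
    (hY : Y₂ ≤ c • Y₁) (hX : X₁ ≤ c • X₂) :
    schurInv A Y₁ X₁ ≤ c • schurInv A Y₂ X₂ := by
  refine inv_le_smul_inv hc (posDef_add_gram A hY₂ hX₂) ?_
  rw [smul_add]
  exact add_le_add hY (gram_le_smul_gram A hc hX₁ hX)

/-- A refinement of `schurInv_le_smul` for the case where the first variable is compared with a
better constant `a ≤ c`. If the Gram term is dominated by `K` times the first variable, the gain
survives the inversion: the new constant is the mean of `a` and `c` with weights `1` and `K`. -/
lemma schurInv_le_smul_of_gram_le (A : Matrix m k ℝ) {Y₁ Y₂ : Matrix m m ℝ}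
    {X₁ X₂ : Matrix k k ℝ} {a c K : ℝ} (ha : 0 < a) (hac : a ≤ c) (hK : 0 ≤ K)
    (hY₂ : Y₂.PosDef) (hX₁ : X₁.PosDef) (hX₂ : X₂.PosDef)
    (hY : Y₂ ≤ a • Y₁) (hX : X₁ ≤ c • X₂) (hA : A * X₂⁻¹ * Aᵀ ≤ K • Y₂) :
    schurInv A Y₁ X₁ ≤ ((a + K * c) / (1 + K)) • schurInv A Y₂ X₂ := by
  have hc : 0 < c := ha.trans_le hac
  set ν := (a + K * c) / (1 + K) with hν
  have hν0 : 0 < ν := by positivity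
  refine inv_le_smul_inv hν0 (posDef_add_gram A hY₂ hX₂) ?_
  rw [smul_add]
  have h1 : (ν / a) • Y₂ ≤ ν • Y₁ := by
    have := smul_le_smul_of_nonneg (by positivity : 0 ≤ ν / a) hY
    rwa [smul_smul, div_mul_cancel₀ _ ha.ne'] at this
  have h2 : (ν / c) • (A * X₂⁻¹ * Aᵀ) ≤ ν • (A * X₁⁻¹ * Aᵀ) := by
    have := smul_le_smul_of_nonneg (by positivity : 0 ≤ ν / c) (gram_le_smul_gram A hc hX₁ hX)
    rwa [smul_smul, div_mul_cancel₀ _ hc.ne'] at this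
  refine le_trans ?_ (add_le_add h1 h2)
  have hνc : ν ≤ c := by
    rw [hν, div_le_iff₀ (by positivity)]; nlinarith
  have h3 : (1 - ν / c) • (A * X₂⁻¹ * Aᵀ) ≤ ((1 - ν / c) * K) • Y₂ := by
    have : 0 ≤ 1 - ν / c := by rw [sub_nonneg, div_le_one hc]; exact hνc
    have := smul_le_smul_of_nonneg this hA
    rwa [smul_smul] at this
  have h4 : ((1 - ν / c) * K) • Y₂ ≤ (ν / a - 1) • Y₂ := by
    refine smul_le_smul_of_le ?_ hY₂.posSemidef.nonneg
    -- The arithmetic mean `ν` dominates the harmonic mean: `ν (1/a + K/c) ≥ 1 + K`.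
    have : ν / a - 1 - (1 - ν / c) * K = K * (c - a) ^ 2 / ((1 + K) * (a * c)) := by
      rw [hν]; field_simp; ring
    have : 0 ≤ ν / a - 1 - (1 - ν / c) * K := by rw [this]; positivity
    linarith
  have h5 := h3.trans h4
  rw [sub_smul, sub_smul, one_smul, one_smul, sub_le_sub_iff] at h5
  simpa [add_comm] using h5

/-- A pair of mutually adjoint positive linear maps between spaces of matrices, comparable with
`B ↦ tr B • 1` on positive semidefinite matrices. -/
structure TransferPair (Φ : Matrix m m ℝ →ₗ[ℝ] Matrix k k ℝ)
    (Φ' : Matrix k k ℝ →ₗ[ℝ] Matrix m m ℝ) (κ₁ κ₂ : ℝ) : Prop where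
  pos₁ : 0 < κ₁
  pos₂ : 0 < κ₂
  lower : ∀ B, 0 ≤ B → (κ₁ * B.trace) • (1 : Matrix k k ℝ) ≤ Φ B
  upper : ∀ B, 0 ≤ B → Φ B ≤ (κ₂ * B.trace) • (1 : Matrix k k ℝ)
  lower' : ∀ C, 0 ≤ C → (κ₁ * C.trace) • (1 : Matrix m m ℝ) ≤ Φ' C
  upper' : ∀ C, 0 ≤ C → Φ' C ≤ (κ₂ * C.trace) • (1 : Matrix m m ℝ)
  adjoint : ∀ B C, 0 ≤ B → 0 ≤ C → (Φ B * C).trace = (Φ' C * B).trace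

namespace TransferPair

variable {Φ : Matrix m m ℝ →ₗ[ℝ] Matrix k k ℝ} {Φ' : Matrix k k ℝ →ₗ[ℝ] Matrix m m ℝ} {κ₁ κ₂ : ℝ}

lemma symm (h : TransferPair Φ Φ' κ₁ κ₂) : TransferPair Φ' Φ κ₁ κ₂ :=
  ⟨h.pos₁, h.pos₂, h.lower', h.upper', h.lower, h.upper,
    fun B C hB hC => (h.adjoint C B hC hB).symm⟩

lemma nonneg (h : TransferPair Φ Φ' κ₁ κ₂) {B : Matrix m m ℝ} (hB : 0 ≤ B) : 0 ≤ Φ B :=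
  (smul_one_nonneg (mul_nonneg h.pos₁.le
    (Matrix.nonneg_iff_posSemidef.1 hB).trace_nonneg)).trans (h.lower B hB)

lemma mono (h : TransferPair Φ Φ' κ₁ κ₂) {B₁ B₂ : Matrix m m ℝ} (hB : B₁ ≤ B₂) : Φ B₁ ≤ Φ B₂ := by
  have := h.nonneg (sub_nonneg.2 hB)
  rwa [map_sub, sub_nonneg] at this

end TransferPair

/-- `(X, Y)` solves `X = 1 + s₁ Φ Q`, `Y = s₂ Φ' Q'` up to errors between `-δ` and `δ`, where
`Q = (Y + A X⁻¹ Aᵀ)⁻¹` and `Q' = (X + Aᵀ Y⁻¹ A)⁻¹`. -/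
structure ApproxSol (Φ : Matrix m m ℝ →ₗ[ℝ] Matrix k k ℝ) (Φ' : Matrix k k ℝ →ₗ[ℝ] Matrix m m ℝ)
    (s₁ s₂ : ℝ) (A : Matrix m k ℝ) (δ : ℝ) (X : Matrix k k ℝ) (Y : Matrix m m ℝ) : Prop where
  le_left : X ≤ (1 + δ) • (1 : Matrix k k ℝ) + s₁ • Φ (schurInv A Y X)
  ge_left : (1 - δ) • (1 : Matrix k k ℝ) + s₁ • Φ (schurInv A Y X) ≤ X
  le_right : Y ≤ δ • (1 : Matrix m m ℝ) + s₂ • Φ' (schurInv Aᵀ X Y)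
  ge_right : s₂ • Φ' (schurInv Aᵀ X Y) ≤ Y + δ • (1 : Matrix m m ℝ)

/-- `X₁ ≤ c X₂` and `X₂ ≤ c X₁`. -/
def MutualLE (c : ℝ) (X₁ X₂ : Matrix k k ℝ) : Prop := X₁ ≤ c • X₂ ∧ X₂ ≤ c • X₁

lemma MutualLE.mono {c d : ℝ} {X₁ X₂ : Matrix k k ℝ} (h : MutualLE c X₁ X₂) (hcd : c ≤ d)
    (h₁ : 0 ≤ X₁) (h₂ : 0 ≤ X₂) : MutualLE d X₁ X₂ :=
  ⟨h.1.trans (smul_le_smul_of_le hcd h₂), h.2.trans (smul_le_smul_of_le hcd h₁)⟩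

lemma MutualLE.norm_sub_le {c M : ℝ} {X₁ X₂ : Matrix k k ℝ} (h : MutualLE c X₁ X₂) (hc : 1 ≤ c)
    (hM : 0 ≤ M) (h₁ : X₁ ≤ M • (1 : Matrix k k ℝ)) (h₂ : X₂ ≤ M • (1 : Matrix k k ℝ)) :
    ‖X₁ - X₂‖ ≤ (c - 1) * M := by
  have hc0 : 0 ≤ c - 1 := by linarith
  refine norm_le_of_le (by positivity) ?_ ?_
  · have := smul_le_smul_of_nonneg hc0 h₂
    rw [smul_smul] at this
    refine le_trans ?_ this
    rw [sub_smul, one_smul]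
    exact sub_le_sub_right h.1 _
  · have := smul_le_smul_of_nonneg hc0 h₁
    rw [smul_smul] at this
    refine le_trans ?_ this
    rw [sub_smul, one_smul, neg_sub]
    exact sub_le_sub_right h.2 _

lemma MutualLE.schurInv (A : Matrix m k ℝ) {Y₁ Y₂ : Matrix m m ℝ} {X₁ X₂ : Matrix k k ℝ} {c : ℝ}
    (hc : 0 < c) (hY₁ : Y₁.PosDef) (hY₂ : Y₂.PosDef) (hX₁ : X₁.PosDef) (hX₂ : X₂.PosDef)
    (hY : MutualLE c Y₁ Y₂) (hX : MutualLE c X₁ X₂) :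
    MutualLE c (schurInv A Y₁ X₁) (ESN.schurInv A Y₂ X₂) :=
  ⟨schurInv_le_smul A hc hY₂ hX₁ hX₂ hY.2 hX.1, schurInv_le_smul A hc hY₁ hX₂ hX₁ hY.1 hX.2⟩

lemma mutualLE_of_bounds {a M : ℝ} {X₁ X₂ : Matrix k k ℝ} (ha : 0 < a) (hM : 0 ≤ M)
    (h₁ : a • (1 : Matrix k k ℝ) ≤ X₁) (h₂ : a • (1 : Matrix k k ℝ) ≤ X₂)
    (h₁' : X₁ ≤ M • (1 : Matrix k k ℝ)) (h₂' : X₂ ≤ M • (1 : Matrix k k ℝ)) :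
    MutualLE (M / a) X₁ X₂ := by
  have key : ∀ Z : Matrix k k ℝ, a • (1 : Matrix k k ℝ) ≤ Z →
      M • (1 : Matrix k k ℝ) ≤ (M / a) • Z := fun Z hZ => by
    have := smul_le_smul_of_nonneg (by positivity : 0 ≤ M / a) hZ
    rwa [smul_smul, div_mul_cancel₀ _ ha.ne'] at this
  exact ⟨h₁'.trans (key _ h₂), h₂'.trans (key _ h₁)⟩

/-- The two-sided bounds on `(X, Y)` under which approximate solutions are stable. -/
structure Bounds (y M : ℝ) (X : Matrix k k ℝ) (Y : Matrix m m ℝ) : Prop where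
  one_le : 1 ≤ X
  le_left : X ≤ M • (1 : Matrix k k ℝ)
  le_right : Y ≤ M • (1 : Matrix m m ℝ)
  smul_le : y • (1 : Matrix m m ℝ) ≤ Y

lemma Bounds.posDef_left {y M : ℝ} {X : Matrix k k ℝ} {Y : Matrix m m ℝ} (h : Bounds y M X Y) :
    X.PosDef := posDef_of_le Matrix.PosDef.one h.one_le

lemma Bounds.posDef_right {y M : ℝ} {X : Matrix k k ℝ} {Y : Matrix m m ℝ} (h : Bounds y M X Y)
    (hy : 0 < y) : Y.PosDef := posDef_of_smul_one_le hy h.smul_le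

/-! ### Stability of approximate solutions. -/

section Stability

variable {Φ : Matrix m m ℝ →ₗ[ℝ] Matrix k k ℝ} {Φ' : Matrix k k ℝ →ₗ[ℝ] Matrix m m ℝ}
  {κ₁ κ₂ s₁ s₂ δ y M L : ℝ} {A : Matrix m k ℝ} {X₁ X₂ : Matrix k k ℝ} {Y₁ Y₂ : Matrix m m ℝ}

/-- By homogeneity `Φ Q₁ ≤ c Φ Q₂`, whereas the constant terms of `c X₂` and `X₁` differ by at least
`c - 1 - (c + 1) δ`. As `X₂ ≤ M`, this surplus multiple of the identity pays for a multiple of `X₂`,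
so the constant strictly decreases. -/
lemma left_contraction (hΦ : TransferPair Φ Φ' κ₁ κ₂) (hs₁ : 0 ≤ s₁) (hy : 0 < y) (hM : 0 < M)
    (hδ : 0 ≤ δ)
    (hB₁ : Bounds y M X₁ Y₁) (hB₂ : Bounds y M X₂ Y₂)
    (h₁ : ApproxSol Φ Φ' s₁ s₂ A δ X₁ Y₁) (h₂ : ApproxSol Φ Φ' s₁ s₂ A δ X₂ Y₂)
    {c : ℝ} (hc : 1 ≤ c) (hcL : c ≤ L) (hX : X₁ ≤ c • X₂) (hY : Y₂ ≤ c • Y₁)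
    (hg : 0 ≤ (c - 1) - (L + 1) * δ) :
    X₁ ≤ (c - ((c - 1) - (L + 1) * δ) / M) • X₂ := by
  have hc0 : 0 < c := by linarith
  have hQ := schurInv_le_smul A hc0 (hB₂.posDef_right hy) hB₁.posDef_left hB₂.posDef_left hY hX
  have h3 := smul_le_smul_of_nonneg hs₁ (hΦ.mono hQ)
  rw [map_smul, smul_comm] at h3
  have h4 := smul_le_smul_of_nonneg hc0.le h₂.ge_left
  set g := ((c - 1) - (L + 1) * δ) / M with hgdef
  have hg0 : 0 ≤ g := by positivity
  have h5 := smul_le_smul_of_nonneg hg0 hB₂.le_left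
  have h6 : (g * M) • (1 : Matrix k k ℝ) ≤ ((c - 1) - (c + 1) * δ) • 1 := by
    refine smul_one_le_smul_one ?_
    rw [hgdef, div_mul_cancel₀ _ hM.ne']
    nlinarith
  rw [smul_smul] at h5
  rw [sub_smul, le_sub_iff_add_le]
  calc X₁ + g • X₂ ≤ ((1 + δ) • 1 + c • (s₁ • Φ (schurInv A Y₂ X₂)))
        + ((c - 1) - (c + 1) * δ) • 1 :=
        add_le_add (h₁.le_left.trans (add_le_add_right h3 _)) (h5.trans h6)
    _ = c • ((1 - δ) • (1 : Matrix k k ℝ) + s₁ • Φ (schurInv A Y₂ X₂)) := by module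
    _ ≤ c • X₂ := h4

/-- The equation of `Y` has no unit term, so there is no direct gain. The constant `a` already
improved on the `X` side enters through `Q' = (X + Aᵀ Y⁻¹ A)⁻¹`, and `schurInv_le_smul_of_gram_le`
retains a fraction of it. -/
lemma right_contraction (hΦ : TransferPair Φ Φ' κ₁ κ₂) (hs₂ : 0 ≤ s₂) (hy : 0 < y)
    (hδ : 0 ≤ δ)
    (hB₁ : Bounds y M X₁ Y₁) (hB₂ : Bounds y M X₂ Y₂)
    (h₁ : ApproxSol Φ Φ' s₁ s₂ A δ X₁ Y₁) (h₂ : ApproxSol Φ Φ' s₁ s₂ A δ X₂ Y₂)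
    {a c K : ℝ} (ha : 1 ≤ a) (hac : a ≤ c) (hcL : c ≤ L) (hA : ‖A‖ ^ 2 ≤ K)
    (hX : X₂ ≤ a • X₁) (hY : Y₁ ≤ c • Y₂) :
    Y₁ ≤ ((a + K / y * c) / (1 + K / y) + (L + 1) * δ / y) • Y₂ := by
  have hK : 0 ≤ K := (sq_nonneg _).trans hA
  have hX₂ := hB₂.posDef_left
  have hY₂ := hB₂.posDef_right hy
  -- From `Y₂⁻¹ ≤ 1/y`, `‖A‖² ≤ K` and `1 ≤ X₂`.
  have hgram : Aᵀ * Y₂⁻¹ * Aᵀᵀ ≤ (K / y) • X₂ := by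
    have e1 := conj_le_conj (inv_le_smul_one hy hB₂.smul_le) Aᵀ
    have e2 := smul_le_smul_of_nonneg (inv_nonneg.2 hy.le) (transpose_mul_self_le A)
    rw [smul_smul] at e2
    have e3 := smul_one_le_smul_one (m := k)
      (mul_le_mul_of_nonneg_left hA (inv_nonneg.2 hy.le))
    have e4 := smul_le_smul_of_nonneg (by positivity : 0 ≤ K / y) hB₂.one_le
    refine e1.trans (le_trans ?_ ((e2.trans e3).trans (le_trans (le_of_eq ?_) e4)))
    · simp
    · rw [div_eq_inv_mul]
  have hQ := schurInv_le_smul_of_gram_le Aᵀ (by linarith) hac (by positivity) hX₂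
    (hB₁.posDef_right hy) hY₂ hX hY hgram
  set ν := (a + K / y * c) / (1 + K / y) with hν
  have hc0 : 0 ≤ c := by linarith
  have ha0 : 0 ≤ a := by linarith
  have hν0 : 0 ≤ ν := by positivity
  have hνL : ν ≤ L := by
    rw [hν, div_le_iff₀ (by positivity)]
    have : K / y * c ≤ K / y * L := by gcongr
    linarith
  have h3 := smul_le_smul_of_nonneg hs₂ (hΦ.symm.mono hQ)
  rw [map_smul, smul_comm] at h3
  have h4 := smul_le_smul_of_nonneg hν0 h₂.ge_right
  have hL : 0 ≤ L := by linarith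
  have h5 := smul_le_smul_of_nonneg (by positivity : 0 ≤ (L + 1) * δ / y) hB₂.smul_le
  rw [smul_smul, div_mul_cancel₀ _ hy.ne'] at h5
  have h6 : (δ + ν * δ) • (1 : Matrix m m ℝ) ≤ ((L + 1) * δ) • 1 :=
    smul_one_le_smul_one (by nlinarith)
  calc Y₁ ≤ δ • 1 + ν • (Y₂ + δ • 1) :=
        h₁.le_right.trans (add_le_add_right (h3.trans h4) _)
    _ = ν • Y₂ + (δ + ν * δ) • 1 := by module
    _ ≤ ν • Y₂ + ((L + 1) * δ / y) • Y₂ := add_le_add_right (h6.trans h5) _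
    _ = _ := by module

/-- The constant of the stability estimate. -/
noncomputable def stabConst (y M K : ℝ) : ℝ :=
  (M / y + 1) * (1 + M * (1 + K / y) * (1 / y + 1))

lemma stabConst_pos {y M K : ℝ} (hy : 0 < y) (hM : 1 ≤ M) (hK : 0 ≤ K) : 0 < stabConst y M K := by
  unfold stabConst; positivity

/-- Two approximate solutions are close in the order sense. -/
theorem exists_mutualLE (hΦ : TransferPair Φ Φ' κ₁ κ₂) (hs₁ : 0 ≤ s₁) (hs₂ : 0 ≤ s₂)
    (hy : 0 < y) (hy1 : y ≤ 1) (hM : 1 ≤ M) (hδ : 0 < δ) {K : ℝ} (hA : ‖A‖ ^ 2 ≤ K)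
    (hB₁ : Bounds y M X₁ Y₁) (hB₂ : Bounds y M X₂ Y₂)
    (h₁ : ApproxSol Φ Φ' s₁ s₂ A δ X₁ Y₁) (h₂ : ApproxSol Φ Φ' s₁ s₂ A δ X₂ Y₂) :
    ∃ c : ℝ, 1 ≤ c ∧ c - 1 ≤ stabConst y M K * δ ∧ MutualLE c X₁ X₂ ∧ MutualLE c Y₁ Y₂ := by
  have hK : 0 ≤ K := (sq_nonneg _).trans hA
  set L := M / y with hL
  have hL1 : 1 ≤ L := by rw [hL, le_div_iff₀ hy]; linarith
  have hX₁ := hB₁.posDef_left.posSemidef.nonneg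
  have hX₂ := hB₂.posDef_left.posSemidef.nonneg
  have hY₁ := (hB₁.posDef_right hy).posSemidef.nonneg
  have hY₂ := (hB₂.posDef_right hy).posSemidef.nonneg
  let S : Set ℝ := {c | 1 ≤ c ∧ MutualLE c X₁ X₂ ∧ MutualLE c Y₁ Y₂}
  have hML : M ≤ L := by rw [hL, le_div_iff₀ hy]; nlinarith
  have hLS : L ∈ S := by
    refine ⟨hL1, ?_, mutualLE_of_bounds hy (by linarith) hB₁.smul_le hB₂.smul_le hB₁.le_right
      hB₂.le_right⟩
    have h := mutualLE_of_bounds (a := 1) one_pos (by linarith : 0 ≤ M)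
      (by simpa using hB₁.one_le) (by simpa using hB₂.one_le) hB₁.le_left hB₂.le_left
    exact h.mono (by simpa using hML) hX₁ hX₂
  have hbdd : BddBelow S := ⟨1, fun c hc => hc.1⟩
  have hpos : 0 < (L + 1) * δ := by positivity
  -- A near-minimizer within `(L + 1) δ` of the infimum is enough, so attainment is not needed.
  -- Truncating at the a priori constant `L` keeps the error terms bounded.
  obtain ⟨c, hcS, hcL, hcinf⟩ : ∃ c ∈ S, c ≤ L ∧ c < sInf S + (L + 1) * δ := by
    obtain ⟨c, hc, hlt⟩ := exists_lt_of_csInf_lt ⟨L, hLS⟩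
      (lt_add_of_pos_right (sInf S) hpos)
    rcases le_total c L with h | h
    · exact ⟨c, hc, h, hlt⟩
    · exact ⟨L, hLS, le_rfl, h.trans_lt hlt⟩
  obtain ⟨hc1, hcX, hcY⟩ := hcS
  refine ⟨c, hc1, ?_, hcX, hcY⟩
  have hunfold : stabConst y M K * δ =
      (L + 1) * δ + M * ((1 + K / y) * ((L + 1) * δ * (1 / y + 1))) := by
    rw [stabConst]; ring
  rw [hunfold]
  have hrest : 0 ≤ M * ((1 + K / y) * ((L + 1) * δ * (1 / y + 1))) := by positivity
  rcases le_total ((c - 1) - (L + 1) * δ) 0 with hg | hg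
  · linarith
  have hM0 : 0 < M := by linarith
  -- The amount by which the constant of `X` improves; if the numerator is negative, the claim
  -- already holds.
  set g := ((c - 1) - (L + 1) * δ) / M with hgdef
  have hg0 : 0 ≤ g := by positivity
  have hg1 : g ≤ c - 1 := by
    rw [hgdef, div_le_iff₀ hM0]; nlinarith
  have hXn : MutualLE (c - g) X₁ X₂ :=
    ⟨left_contraction hΦ hs₁ hy hM0 hδ.le hB₁ hB₂ h₁ h₂ hc1 hcL hcX.1 hcY.2 hg,
      left_contraction hΦ hs₁ hy hM0 hδ.le hB₂ hB₁ h₂ h₁ hc1 hcL hcX.2 hcY.1 hg⟩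
  set d := ((c - g) + K / y * c) / (1 + K / y) + (L + 1) * δ / y with hd
  have hYn : MutualLE d Y₁ Y₂ :=
    ⟨right_contraction hΦ hs₂ hy hδ.le hB₁ hB₂ h₁ h₂ (by linarith) (by linarith) hcL hA hXn.2 hcY.1,
      right_contraction hΦ hs₂ hy hδ.le hB₂ hB₁ h₂ h₁ (by linarith) (by linarith) hcL hA hXn.1
        hcY.2⟩
  have hd' : d = c - g / (1 + K / y) + (L + 1) * δ / y := by
    rw [hd]
    have : (1 + K / y) ≠ 0 := by positivity
    field_simp
    ring
  have hle : c - g ≤ d := by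
    have h1 : g / (1 + K / y) ≤ g := div_le_self hg0 (by have : 0 ≤ K / y := by positivity
                                                         linarith)
    have h2 : 0 ≤ (L + 1) * δ / y := by positivity
    linarith
  have hdS : d ∈ S := ⟨by linarith, hXn.mono hle hX₁ hX₂, hYn⟩
  -- The improved constant `d` is admissible, so it cannot lie far below the near-minimizer `c`.
  -- This bounds `g`, hence `c - 1`.
  have h1 := csInf_le hbdd hdS
  have h2 : g / (1 + K / y) ≤ (L + 1) * δ * (1 / y + 1) := by
    have : (L + 1) * δ * (1 / y + 1) = (L + 1) * δ / y + (L + 1) * δ := by ring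
    linarith
  rw [div_le_iff₀ (by positivity), mul_comm] at h2
  have h3 : (c - 1) - (L + 1) * δ = M * g := by rw [hgdef]; field_simp
  have h4 := mul_le_mul_of_nonneg_left h2 hM0.le
  linarith

end Stability

end System

/-! ### Exact solutions: trace identity, a priori bounds, removal of the data matrix. -/

section Exact

variable {m k : Type*} [Fintype m] [DecidableEq m] [Fintype k] [DecidableEq k]

/-- Positive definite solutions of the system `X = 1 + s₁ Φ Q`, `Y = b + s₂ Φ' Q'`, where
`Q = (Y + A X⁻¹ Aᵀ)⁻¹` and `Q' = (X + Aᵀ Y⁻¹ A)⁻¹`. -/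
structure ExactSol (Φ : Matrix m m ℝ →ₗ[ℝ] Matrix k k ℝ) (Φ' : Matrix k k ℝ →ₗ[ℝ] Matrix m m ℝ)
    (s₁ s₂ : ℝ) (A : Matrix m k ℝ) (b : ℝ) (X : Matrix k k ℝ) (Y : Matrix m m ℝ) : Prop where
  posDef_left : X.PosDef
  posDef_right : Y.PosDef
  eq_left : X = 1 + s₁ • Φ (schurInv A Y X)
  eq_right : Y = b • (1 : Matrix m m ℝ) + s₂ • Φ' (schurInv Aᵀ X Y)

lemma schurInv_mul_add (A : Matrix m k ℝ) {Y : Matrix m m ℝ} {X : Matrix k k ℝ} (hY : Y.PosDef)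
    (hX : X.PosDef) : schurInv A Y X * (Y + A * X⁻¹ * Aᵀ) = 1 :=
  Matrix.nonsing_inv_mul _ (isUnit_det_of_posDef (posDef_add_gram A hY hX))

lemma add_mul_schurInv (A : Matrix m k ℝ) {Y : Matrix m m ℝ} {X : Matrix k k ℝ} (hY : Y.PosDef)
    (hX : X.PosDef) : (Y + A * X⁻¹ * Aᵀ) * schurInv A Y X = 1 :=
  Matrix.mul_nonsing_inv _ (isUnit_det_of_posDef (posDef_add_gram A hY hX))

lemma schurInv_push_through (A : Matrix m k ℝ) {Y : Matrix m m ℝ} {X : Matrix k k ℝ}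
    (hY : Y.PosDef) (hX : X.PosDef) :
    schurInv A Y X * A * X⁻¹ = Y⁻¹ * A * schurInv Aᵀ X Y := by
  have hXu := Matrix.nonsing_inv_mul X (isUnit_det_of_posDef hX)
  have hYu := Matrix.mul_nonsing_inv Y (isUnit_det_of_posDef hY)
  have key : A * X⁻¹ * (X + Aᵀ * Y⁻¹ * Aᵀᵀ) = (Y + A * X⁻¹ * Aᵀ) * (Y⁻¹ * A) := by
    rw [Matrix.mul_add, Matrix.add_mul, Matrix.mul_assoc A, hXu, ← Matrix.mul_assoc Y, hYu]
    simp [Matrix.mul_assoc]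
  calc schurInv A Y X * A * X⁻¹
      = schurInv A Y X * (A * X⁻¹ * (X + Aᵀ * Y⁻¹ * Aᵀᵀ)) * schurInv Aᵀ X Y := by
        rw [Matrix.mul_assoc _ _ (schurInv Aᵀ X Y), Matrix.mul_assoc (A * X⁻¹),
          add_mul_schurInv Aᵀ hX hY]
        simp [Matrix.mul_assoc]
    _ = _ := by
        rw [key, ← Matrix.mul_assoc (schurInv A Y X), schurInv_mul_add A hY hX, Matrix.one_mul]

/-- Push-through together with cyclicity of the trace. It lets the data term cancel when the two
resolvent identities are compared. -/
lemma trace_gram_mul_schurInv (A : Matrix m k ℝ) {Y : Matrix m m ℝ} {X : Matrix k k ℝ}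
    (hY : Y.PosDef) (hX : X.PosDef) :
    (A * X⁻¹ * Aᵀ * schurInv A Y X).trace = (Aᵀ * Y⁻¹ * A * schurInv Aᵀ X Y).trace := by
  rw [Matrix.trace_mul_comm, Matrix.mul_assoc (Aᵀ * Y⁻¹), Matrix.mul_assoc Aᵀ,
    ← Matrix.mul_assoc Y⁻¹, ← schurInv_push_through A hY hX, Matrix.trace_mul_comm Aᵀ]
  simp [Matrix.mul_assoc]

variable {Φ : Matrix m m ℝ →ₗ[ℝ] Matrix k k ℝ} {Φ' : Matrix k k ℝ →ₗ[ℝ] Matrix m m ℝ}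
  {κ₁ κ₂ s₁ s₂ b : ℝ} {A : Matrix m k ℝ} {X : Matrix k k ℝ} {Y : Matrix m m ℝ}

namespace ExactSol

/-- Taking traces in the two resolvent identities gives `tr Q' + s₁ t + τ = |k|` and `b tr Q + s₂ t
+ τ = |m|`, with the same `t = tr(Φ Q · Q')` by adjointness and the same data term `τ ≥ 0`.
Subtracting `ρ` times the second from the first removes the unknowns with a favourable sign. The
factor `ρ` allows for unequal normalizations. -/
lemma card_sub_le_trace (hΦ : TransferPair Φ Φ' κ₁ κ₂) {ρ : ℝ} (hρ : 1 ≤ ρ) (hsρ : s₁ ≤ ρ * s₂)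
    (hb : 0 ≤ b) (h : ExactSol Φ Φ' s₁ s₂ A b X Y) :
    (Fintype.card k : ℝ) - ρ * Fintype.card m ≤ (schurInv Aᵀ X Y).trace := by
  have hX := h.posDef_left
  have hY := h.posDef_right
  have hQ := schurInv_nonneg A hY hX
  have hQ' := schurInv_nonneg Aᵀ hX hY
  have e1 := congrArg Matrix.trace (add_mul_schurInv Aᵀ hX hY)
  have e2 := congrArg Matrix.trace (add_mul_schurInv A hY hX)
  rw [Matrix.add_mul, Matrix.trace_add, Matrix.trace_one, Matrix.transpose_transpose] at e1
  rw [Matrix.add_mul, Matrix.trace_add, Matrix.trace_one, trace_gram_mul_schurInv A hY hX] at e2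
  have hτ : 0 ≤ (Aᵀ * Y⁻¹ * A * schurInv Aᵀ X Y).trace := by
    have := gram_nonneg Aᵀ hY
    rw [Matrix.transpose_transpose] at this
    exact trace_mul_nonneg this hQ'
  set Q := schurInv A Y X with hQdef
  set Q' := schurInv Aᵀ X Y with hQ'def
  have e3 : (X * Q').trace = Q'.trace + s₁ * (Φ Q * Q').trace := by
    conv_lhs => rw [h.eq_left]
    simp [Matrix.add_mul, Matrix.trace_add, Matrix.trace_smul, hQdef]
  have e4 : (Y * Q).trace = b * Q.trace + s₂ * (Φ' Q' * Q).trace := by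
    conv_lhs => rw [h.eq_right]
    simp [Matrix.add_mul, Matrix.trace_add, Matrix.trace_smul, hQ'def]
  have hadj := hΦ.adjoint Q Q' hQ hQ'
  have ht : 0 ≤ (Φ Q * Q').trace := trace_mul_nonneg (hΦ.nonneg hQ) hQ'
  have hbt : 0 ≤ b * Q.trace :=
    mul_nonneg hb (Matrix.nonneg_iff_posSemidef.1 hQ).trace_nonneg
  rw [e3] at e1
  rw [e4, ← hadj] at e2
  have h1 : s₁ * (Φ Q * Q').trace ≤ ρ * s₂ * (Φ Q * Q').trace :=
    mul_le_mul_of_nonneg_right hsρ ht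
  rw [← e1, ← e2]
  nlinarith

lemma one_le (hΦ : TransferPair Φ Φ' κ₁ κ₂) (hs₁ : 0 ≤ s₁) (h : ExactSol Φ Φ' s₁ s₂ A b X Y) :
    1 ≤ X := by
  rw [h.eq_left]
  refine le_add_of_nonneg_right ?_
  simpa using smul_le_smul_of_nonneg hs₁
    (hΦ.nonneg (schurInv_nonneg A h.posDef_right h.posDef_left))

/-- A priori bounds for the solutions of the system. -/
lemma bounds (hΦ : TransferPair Φ Φ' κ₁ κ₂) {ρ σ S : ℝ} (hρ : 1 ≤ ρ) (hsρ : s₁ ≤ ρ * s₂)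
    (hs₁ : 0 ≤ s₁) (hs₂ : 0 ≤ s₂) (hb : 0 ≤ b) (hb1 : b ≤ 1) (hσ : 0 < σ)
    (hσs : σ ≤ s₂ * (Fintype.card k - ρ * Fintype.card m))
    (hS₁ : s₁ * Fintype.card m ≤ S) (hS₂ : s₂ * Fintype.card k ≤ S)
    (h : ExactSol Φ Φ' s₁ s₂ A b X Y) :
    Bounds (min 1 (κ₁ * σ)) (1 + κ₂ * S / min 1 (κ₁ * σ)) X Y := by
  have hX := h.posDef_left
  have hY := h.posDef_right
  have hQ := schurInv_nonneg A hY hX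
  have hQ' := schurInv_nonneg Aᵀ hX hY
  have hκ₁ := hΦ.pos₁
  have hκ₂ := hΦ.pos₂
  have hS0 : 0 ≤ S := le_trans (by positivity) hS₁
  set y := min 1 (κ₁ * σ) with hy
  have hy0 : 0 < y := lt_min one_pos (by positivity)
  have hy1 : y ≤ 1 := min_le_left _ _
  have hX1 := h.one_le hΦ hs₁
  have htr := h.card_sub_le_trace hΦ hρ hsρ hb
  -- The lower bound on `Y` comes from `s₂ Φ' Q' ≥ κ₁ s₂ tr Q'` alone, so it does not degenerate as
  -- `b` tends to `0`.
  have hYy : y • (1 : Matrix m m ℝ) ≤ Y := by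
    rw [h.eq_right]
    have h1 := smul_le_smul_of_nonneg hs₂ (hΦ.lower' _ hQ')
    rw [smul_smul] at h1
    refine le_trans ?_ (add_le_add (smul_one_nonneg hb) h1)
    rw [zero_add]
    refine smul_one_le_smul_one ((min_le_right _ _).trans ?_)
    calc κ₁ * σ ≤ κ₁ * (s₂ * (schurInv Aᵀ X Y).trace) := by
          refine mul_le_mul_of_nonneg_left (hσs.trans ?_) hκ₁.le
          exact mul_le_mul_of_nonneg_left htr hs₂
      _ = _ := by ring
  refine ⟨hX1, ?_, ?_, hYy⟩
  · have h1 := trace_le_trace ((schurInv_le_inv A hY hX).trans (inv_le_smul_one hy0 hYy))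
    rw [Matrix.trace_smul, Matrix.trace_one, smul_eq_mul] at h1
    have h2 := smul_le_smul_of_nonneg hs₁ (hΦ.upper _ hQ)
    rw [smul_smul] at h2
    have h3 : s₁ * (κ₂ * (schurInv A Y X).trace) ≤ κ₂ * S / y := by
      calc s₁ * (κ₂ * (schurInv A Y X).trace) ≤ s₁ * (κ₂ * (y⁻¹ * Fintype.card m)) := by gcongr
        _ = κ₂ * (s₁ * Fintype.card m) / y := by ring
        _ ≤ κ₂ * S / y := by gcongr
    conv_lhs => rw [h.eq_left]
    rw [add_smul, one_smul]
    exact add_le_add_right (h2.trans (smul_one_le_smul_one h3)) _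
  · have h1 := trace_le_trace ((schurInv_le_inv Aᵀ hX hY).trans
      (inv_le_inv_of_le Matrix.PosDef.one hX1))
    rw [inv_one, Matrix.trace_one] at h1
    have h2 := smul_le_smul_of_nonneg hs₂ (hΦ.upper' _ hQ')
    rw [smul_smul] at h2
    have h3 : s₂ * (κ₂ * (schurInv Aᵀ X Y).trace) ≤ κ₂ * S / y := by
      calc s₂ * (κ₂ * (schurInv Aᵀ X Y).trace) ≤ s₂ * (κ₂ * Fintype.card k) := by gcongr
        _ = κ₂ * (s₂ * Fintype.card k) := by ring
        _ ≤ κ₂ * S := by gcongr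
        _ ≤ κ₂ * S / y := le_div_self (by positivity) hy0 hy1
    conv_lhs => rw [h.eq_right]
    rw [add_smul 1]
    exact add_le_add (smul_one_le_smul_one hb1) (h2.trans (smul_one_le_smul_one h3))

/-- Moving `b` into the error makes solutions for different `b` approximate solutions of one and the
same system. -/
lemma approxSol (h : ExactSol Φ Φ' s₁ s₂ A b X Y) {δ : ℝ} (hb : 0 ≤ b) (hδ : b ≤ δ) :
    ApproxSol Φ Φ' s₁ s₂ A δ X Y := by
  have hδ0 : 0 ≤ δ := hb.trans hδ
  refine ⟨?_, ?_, ?_, ?_⟩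
  · conv_lhs => rw [h.eq_left]
    refine add_le_add_left ?_ _
    simpa using smul_one_le_smul_one (m := k) (by linarith : 1 ≤ 1 + δ)
  · conv_rhs => rw [h.eq_left]
    refine add_le_add_left ?_ _
    simpa using smul_one_le_smul_one (m := k) (by linarith : 1 - δ ≤ 1)
  · conv_lhs => rw [h.eq_right]
    exact add_le_add_left (smul_one_le_smul_one hδ) _
  · conv_rhs => rw [h.eq_right]
    rw [add_right_comm]
    refine le_add_of_nonneg_left ?_
    rw [← add_smul]
    exact smul_one_nonneg (by positivity)

end ExactSol

lemma inv_sub_schurInv (A : Matrix m k ℝ) {Y : Matrix m m ℝ} {X : Matrix k k ℝ} (hY : Y.PosDef)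
    (hX : X.PosDef) : Y⁻¹ - schurInv A Y X = Y⁻¹ * (A * X⁻¹ * Aᵀ) * schurInv A Y X := by
  have h1 := add_mul_schurInv A hY hX
  rw [Matrix.add_mul] at h1
  rw [Matrix.mul_assoc, eq_sub_of_add_eq' h1, Matrix.mul_sub, Matrix.mul_one, ← Matrix.mul_assoc,
    Matrix.nonsing_inv_mul _ (isUnit_det_of_posDef hY), Matrix.one_mul]

/-- `A` pairs with any matrix `Z` to a trace of size at most `t ‖Z‖`. -/
def TraceBound (A : Matrix m k ℝ) (t : ℝ) : Prop :=
  ∀ Z : Matrix k m ℝ, |(A * Z).trace| ≤ t * ‖Z‖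

lemma norm_inv_le {y : ℝ} (hy : 0 < y) (hY : y • (1 : Matrix m m ℝ) ≤ Y) : ‖Y⁻¹‖ ≤ y⁻¹ :=
  norm_le_of_nonneg_of_le (by positivity)
    (posDef_of_smul_one_le hy hY).inv.posSemidef.nonneg (inv_le_smul_one hy hY)

lemma norm_schurInv_le {y : ℝ} (hy : 0 < y) (hY : y • (1 : Matrix m m ℝ) ≤ Y) (hX : X.PosDef) :
    ‖schurInv A Y X‖ ≤ y⁻¹ := by
  have hYp := posDef_of_smul_one_le hy hY
  exact norm_le_of_nonneg_of_le (by positivity) (schurInv_nonneg A hYp hX)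
    ((schurInv_le_inv A hYp hX).trans (inv_le_smul_one hy hY))

lemma norm_mul_mul_mul_le (P : Matrix k k ℝ) (B : Matrix k m ℝ) (Q R : Matrix m m ℝ) :
    ‖P * B * Q * R‖ ≤ ‖P‖ * ‖B‖ * ‖Q‖ * ‖R‖ := by
  refine (Matrix.l2_opNorm_mul _ _).trans ?_
  gcongr
  refine (Matrix.l2_opNorm_mul _ _).trans ?_
  gcongr
  exact Matrix.l2_opNorm_mul _ _

/-- Resolvent identity, then a cyclic permutation bringing `A` to the front: the trace is that of `A
Z` with `Z = X⁻¹ Aᵀ Q Y⁻¹`, to which `TraceBound` applies. -/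
lemma trace_inv_sub_schurInv_le {t y z : ℝ} (hy : 0 < y) (hz : 0 < z) (ht : 0 ≤ t)
    (hA : TraceBound A t) (hY : y • (1 : Matrix m m ℝ) ≤ Y) (hX : z • (1 : Matrix k k ℝ) ≤ X) :
    (Y⁻¹ - schurInv A Y X).trace ≤ t * (z⁻¹ * ‖A‖ * y⁻¹ * y⁻¹) := by
  have hYp := posDef_of_smul_one_le hy hY
  have hXp := posDef_of_smul_one_le hz hX
  rw [inv_sub_schurInv A hYp hXp]
  have : (Y⁻¹ * (A * X⁻¹ * Aᵀ) * schurInv A Y X).trace =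
      (A * (X⁻¹ * Aᵀ * schurInv A Y X * Y⁻¹)).trace := by
    rw [Matrix.mul_assoc Y⁻¹, Matrix.trace_mul_comm]
    simp [Matrix.mul_assoc]
  rw [this]
  refine (le_abs_self _).trans ((hA _).trans ?_)
  gcongr
  refine (norm_mul_mul_mul_le _ _ _ _).trans ?_
  rw [norm_transpose_eq]
  gcongr
  · exact norm_inv_le hz hX
  · exact norm_schurInv_le hy hY hXp
  · exact norm_inv_le hy hY

lemma TraceBound.transpose {t : ℝ} (hA : TraceBound A t) : TraceBound Aᵀ t := fun Z => by
  have := hA Zᵀ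
  rwa [norm_transpose_eq, ← Matrix.trace_transpose, Matrix.transpose_mul,
    Matrix.transpose_transpose, Matrix.trace_mul_comm] at this

lemma TransferPair.smul_map_le (hΦ : TransferPair Φ Φ' κ₁ κ₂) {B : Matrix m m ℝ} {s s' : ℝ}
    (hB : 0 ≤ B) :
    s • Φ B ≤ s' • Φ B + (|s - s'| * (κ₂ * B.trace)) • (1 : Matrix k k ℝ) := by
  have h1 := smul_le_smul_of_le (le_abs_self (s - s')) (hΦ.nonneg hB)
  have h2 := smul_le_smul_of_nonneg (abs_nonneg (s - s')) (hΦ.upper _ hB)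
  rw [smul_smul] at h2
  calc s • Φ B = s' • Φ B + (s - s') • Φ B := by module
    _ ≤ _ := add_le_add_right (h1.trans h2) _

/-- The data matrix may be removed from the system, and the normalizations changed, up to a small
error. -/
lemma ExactSol.approxSol_zero (hΦ : TransferPair Φ Φ' κ₁ κ₂) {s y M t δ : ℝ} (hs : 0 ≤ s)
    (hb : 0 ≤ b) (hy : 0 < y) (hy1 : y ≤ 1) (ht : 0 ≤ t) (hA : TraceBound A t)
    (hB : Bounds y M X Y) (h : ExactSol Φ Φ' s s A b X Y)
    (hδ : b + κ₂ * (|s - s₁| * Fintype.card m / y + |s - s₂| * Fintype.card k / y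
      + s * (t * ‖A‖ / y ^ 2)) ≤ δ) :
    ApproxSol Φ Φ' s₁ s₂ (0 : Matrix m k ℝ) δ X Y := by
  have hX := h.posDef_left
  have hY := h.posDef_right
  have hQ := schurInv_nonneg A hY hX
  have hQ' := schurInv_nonneg Aᵀ hX hY
  have hκ := hΦ.pos₂
  set τ := t * ‖A‖ / y ^ 2 with hτ
  have hτ0 : 0 ≤ τ := by positivity
  have hX1 : (1 : ℝ) • (1 : Matrix k k ℝ) ≤ X := by simpa using hB.one_le
  have d1 : (Y⁻¹ - schurInv A Y X).trace ≤ τ := by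
    refine (trace_inv_sub_schurInv_le hy one_pos ht hA hB.smul_le hX1).trans (le_of_eq ?_)
    rw [hτ]; field_simp
  have d2 : (X⁻¹ - schurInv Aᵀ X Y).trace ≤ τ := by
    refine (trace_inv_sub_schurInv_le one_pos hy ht hA.transpose hX1 hB.smul_le).trans ?_
    rw [norm_transpose_eq, hτ, mul_div_assoc]
    gcongr
    rw [div_eq_mul_inv, inv_one, mul_one, mul_one, mul_comm]
    gcongr
    nlinarith
  have i1 : 0 ≤ Y⁻¹ - schurInv A Y X := sub_nonneg.2 (schurInv_le_inv A hY hX)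
  have i2 : 0 ≤ X⁻¹ - schurInv Aᵀ X Y := sub_nonneg.2 (schurInv_le_inv Aᵀ hX hY)
  have t1 : Y⁻¹.trace ≤ Fintype.card m / y := by
    have := trace_le_trace (inv_le_smul_one hy hB.smul_le)
    rw [Matrix.trace_smul, Matrix.trace_one, smul_eq_mul] at this
    rwa [div_eq_inv_mul]
  have t2 : X⁻¹.trace ≤ Fintype.card k / y := by
    have := trace_le_trace (inv_le_smul_one one_pos hX1)
    rw [Matrix.trace_smul, Matrix.trace_one, smul_eq_mul, inv_one, one_mul] at this
    exact this.trans (le_div_self (by positivity) hy hy1)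
  set e₁ := |s - s₁| * (κ₂ * Y⁻¹.trace) with he₁
  set e₂ := |s - s₂| * (κ₂ * X⁻¹.trace) with he₂
  have he₁' : e₁ ≤ κ₂ * (|s - s₁| * Fintype.card m / y) := by
    calc e₁ ≤ |s - s₁| * (κ₂ * (Fintype.card m / y)) := by rw [he₁]; gcongr
      _ = _ := by ring
  have he₂' : e₂ ≤ κ₂ * (|s - s₂| * Fintype.card k / y) := by
    calc e₂ ≤ |s - s₂| * (κ₂ * (Fintype.card k / y)) := by rw [he₂]; gcongr
      _ = _ := by ring
  have q1 : 0 ≤ κ₂ * (|s - s₁| * Fintype.card m / y) := by positivity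
  have q2 : 0 ≤ κ₂ * (|s - s₂| * Fintype.card k / y) := by positivity
  have q3 : 0 ≤ κ₂ * (s * τ) := by positivity
  have hδ' : b + κ₂ * (|s - s₁| * Fintype.card m / y) + κ₂ * (|s - s₂| * Fintype.card k / y)
      + κ₂ * (s * τ) ≤ δ := by linarith
  have hYi := hY.inv.posSemidef.nonneg
  have hXi := hX.inv.posSemidef.nonneg
  -- Deleting `A` only enlarges the resolvents, so one direction is free. The other costs the trace
  -- of the difference, which `Φ` and `Φ'` turn into a multiple of the identity.
  have m1 : s • Φ (schurInv A Y X) ≤ s • Φ Y⁻¹ :=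
    smul_le_smul_of_nonneg hs (hΦ.mono (schurInv_le_inv A hY hX))
  have m2 : s • Φ' (schurInv Aᵀ X Y) ≤ s • Φ' X⁻¹ :=
    smul_le_smul_of_nonneg hs (hΦ.symm.mono (schurInv_le_inv Aᵀ hX hY))
  have r1 : s • Φ Y⁻¹ ≤ s • Φ (schurInv A Y X) + (κ₂ * (s * τ)) • (1 : Matrix k k ℝ) := by
    have u1 := smul_le_smul_of_nonneg hs (hΦ.upper _ i1)
    have u2 : s * (κ₂ * (Y⁻¹ - schurInv A Y X).trace) ≤ κ₂ * (s * τ) := by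
      calc s * (κ₂ * (Y⁻¹ - schurInv A Y X).trace) ≤ s * (κ₂ * τ) := by gcongr
        _ = _ := by ring
    rw [smul_smul, map_sub, smul_sub, sub_le_iff_le_add'] at u1
    exact u1.trans (add_le_add_right (smul_one_le_smul_one u2) _)
  have r2 : s • Φ' X⁻¹ ≤ s • Φ' (schurInv Aᵀ X Y) + (κ₂ * (s * τ)) • (1 : Matrix m m ℝ) := by
    have u1 := smul_le_smul_of_nonneg hs (hΦ.upper' _ i2)
    have u2 : s * (κ₂ * (X⁻¹ - schurInv Aᵀ X Y).trace) ≤ κ₂ * (s * τ) := by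
      calc s * (κ₂ * (X⁻¹ - schurInv Aᵀ X Y).trace) ≤ s * (κ₂ * τ) := by gcongr
        _ = _ := by ring
    rw [smul_smul, map_sub, smul_sub, sub_le_iff_le_add'] at u1
    exact u1.trans (add_le_add_right (smul_one_le_smul_one u2) _)
  have c1 := hΦ.smul_map_le (s := s) (s' := s₁) hYi
  have c1' := hΦ.smul_map_le (s := s₁) (s' := s) hYi
  have c2 := hΦ.symm.smul_map_le (s := s) (s' := s₂) hXi
  have c2' := hΦ.symm.smul_map_le (s := s₂) (s' := s) hXi
  rw [abs_sub_comm s₁ s] at c1'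
  rw [abs_sub_comm s₂ s] at c2'
  have hz : (0 : Matrix m k ℝ)ᵀ = 0 := Matrix.transpose_zero
  refine ⟨?_, ?_, ?_, ?_⟩
  · rw [schurInv_zero]
    calc X = 1 + s • Φ (schurInv A Y X) := h.eq_left
      _ ≤ 1 + (s₁ • Φ Y⁻¹ + e₁ • 1) := add_le_add_right (m1.trans c1) _
      _ = (1 + e₁) • 1 + s₁ • Φ Y⁻¹ := by module
      _ ≤ _ := add_le_add_left (smul_one_le_smul_one (by linarith)) _
  · rw [schurInv_zero]
    calc (1 - δ) • 1 + s₁ • Φ Y⁻¹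
        ≤ (1 - δ) • 1 + (s • Φ (schurInv A Y X) + (κ₂ * (s * τ)) • 1 + e₁ • 1) :=
          add_le_add_right (c1'.trans (add_le_add_left r1 _)) _
      _ = (1 - δ + κ₂ * (s * τ) + e₁) • 1 + s • Φ (schurInv A Y X) := by module
      _ ≤ (1 : ℝ) • 1 + s • Φ (schurInv A Y X) :=
          add_le_add_left (smul_one_le_smul_one (by linarith)) _
      _ = X := by rw [one_smul]; exact h.eq_left.symm
  · rw [hz, schurInv_zero]
    calc Y = b • 1 + s • Φ' (schurInv Aᵀ X Y) := h.eq_right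
      _ ≤ b • 1 + (s₂ • Φ' X⁻¹ + e₂ • 1) := add_le_add_right (m2.trans c2) _
      _ = (b + e₂) • 1 + s₂ • Φ' X⁻¹ := by module
      _ ≤ _ := add_le_add_left (smul_one_le_smul_one (by linarith)) _
  · rw [hz, schurInv_zero]
    calc s₂ • Φ' X⁻¹
        ≤ s • Φ' (schurInv Aᵀ X Y) + (κ₂ * (s * τ)) • 1 + e₂ • 1 :=
          c2'.trans (add_le_add_left r2 _)
      _ = (κ₂ * (s * τ) + e₂ - b) • 1 + (b • 1 + s • Φ' (schurInv Aᵀ X Y)) := by module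
      _ = (κ₂ * (s * τ) + e₂ - b) • 1 + Y := by rw [← h.eq_right]
      _ ≤ δ • 1 + Y := add_le_add_left (smul_one_le_smul_one (by linarith)) _
      _ = _ := add_comm _ _

end Exact

/-! ### Monotone limits and solvability of the system. -/

section Limits

variable {m k : Type*} [Fintype m] [DecidableEq m] [Fintype k] [DecidableEq k]

lemma isClosed_setOf_nonneg : IsClosed {A : Matrix m m ℝ | 0 ≤ A} := by
  have : {A : Matrix m m ℝ | 0 ≤ A} =
      {A : Matrix m m ℝ | Aᵀ = A} ∩ ⋂ v : m → ℝ, {A : Matrix m m ℝ | 0 ≤ v ⬝ᵥ A *ᵥ v} := by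
    ext A
    simp only [Set.mem_ofPred_eq, Set.mem_inter_iff, Set.mem_iInter]
    refine ⟨fun h => ⟨transpose_eq_of_nonneg h, fun v => by simpa using quad_le_of_le h v⟩,
      fun h => le_of_quad_le Matrix.isHermitian_zero ?_ fun v => by simpa using h.2 v⟩
    rw [Matrix.IsHermitian, Matrix.conjTranspose_eq_transpose_of_trivial, h.1]
  rw [this]
  refine (isClosed_eq continuous_id.matrix_transpose continuous_id).inter
    (isClosed_iInter fun v => isClosed_le continuous_const ?_)
  exact continuous_const.dotProduct (continuous_id.matrix_mulVec continuous_const)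

lemma le_of_tendsto_matrix {ι : Type*} {l : Filter ι} [l.NeBot] {A B : ι → Matrix m m ℝ}
    {A₀ B₀ : Matrix m m ℝ} (hA : Tendsto A l (𝓝 A₀)) (hB : Tendsto B l (𝓝 B₀))
    (h : ∀ᶠ i in l, A i ≤ B i) : A₀ ≤ B₀ :=
  sub_nonneg.1 (isClosed_setOf_nonneg.mem_of_tendsto (hB.sub hA)
    (h.mono fun _ hi => sub_nonneg.2 hi))

lemma apply_eq_polarization {A : Matrix m m ℝ} (hA : Aᵀ = A) (i j : m) :
    A i j = ((Pi.single i 1 + Pi.single j 1) ⬝ᵥ A *ᵥ (Pi.single i 1 + Pi.single j 1)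
      - Pi.single i 1 ⬝ᵥ A *ᵥ Pi.single i 1 - Pi.single j 1 ⬝ᵥ A *ᵥ Pi.single j 1) / 2 := by
  have : A j i = A i j := congrFun (congrFun hA i) j
  simp [Matrix.mulVec_add, dotProduct_add, add_dotProduct, this]
  ring

/-- Each quadratic form is monotone and bounded, hence converges; polarization recovers the entries.
-/
lemma exists_tendsto_of_monotone {X : ℕ → Matrix m m ℝ} {B : Matrix m m ℝ}
    (h0 : 0 ≤ X 0) (hX : ∀ n, X n ≤ X (n + 1)) (hB : ∀ n, X n ≤ B) :
    ∃ L, Tendsto X atTop (𝓝 L) := by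
  have hmono : Monotone X := monotone_nat_of_le_succ hX
  have hq : ∀ v : m → ℝ, ∃ l : ℝ, Tendsto (fun n => v ⬝ᵥ X n *ᵥ v) atTop (𝓝 l) := fun v =>
    ⟨_, tendsto_atTop_ciSup (fun a b hab => quad_le_of_le (hmono hab) v)
      ⟨v ⬝ᵥ B *ᵥ v, by rintro _ ⟨n, rfl⟩; exact quad_le_of_le (hB n) v⟩⟩
  choose q hq using hq
  refine ⟨Matrix.of fun i j => (q (Pi.single i 1 + Pi.single j 1) - q (Pi.single i 1)
    - q (Pi.single j 1)) / 2, ?_⟩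
  refine tendsto_pi_nhds.2 fun i => tendsto_pi_nhds.2 fun j => ?_
  have h2 := (((hq (Pi.single i 1 + Pi.single j 1)).sub (hq (Pi.single i 1))).sub
    (hq (Pi.single j 1))).div_const 2
  refine h2.congr fun n => ?_
  exact (apply_eq_polarization (transpose_eq_of_nonneg (h0.trans (hmono (Nat.zero_le n)))) i j).symm

lemma exists_tendsto_of_antitone {X : ℕ → Matrix m m ℝ} (hX : ∀ n, X (n + 1) ≤ X n)
    (hB : ∀ n, 0 ≤ X n) : ∃ L, Tendsto X atTop (𝓝 L) := by
  obtain ⟨L, hL⟩ := exists_tendsto_of_monotone (X := fun n => X 0 - X n) (B := X 0) (by simp)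
    (fun n => sub_le_sub_left (hX n) _) (fun n => sub_le_self _ (hB n))
  exact ⟨X 0 - L, by simpa using (tendsto_const_nhds (x := X 0)).sub hL⟩

lemma tendsto_inv_matrix {ι : Type*} {l : Filter ι} {A : ι → Matrix m m ℝ} {A₀ : Matrix m m ℝ}
    (hA : Tendsto A l (𝓝 A₀)) (h0 : A₀.PosDef) : Tendsto (fun i => (A i)⁻¹) l (𝓝 A₀⁻¹) := by
  have hdet := (isUnit_det_of_posDef h0)
  have : ContinuousAt Inv.inv A₀ := by
    refine continuousAt_matrix_inv A₀ ?_
    have := NormedRing.inverse_continuousAt hdet.unit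
    simpa using this
  exact this.tendsto.comp hA

lemma tendsto_schurInv {ι : Type*} {l : Filter ι} (A : Matrix m k ℝ) {Y : ι → Matrix m m ℝ}
    {X : ι → Matrix k k ℝ} {Y₀ : Matrix m m ℝ} {X₀ : Matrix k k ℝ}
    (hY : Tendsto Y l (𝓝 Y₀)) (hX : Tendsto X l (𝓝 X₀)) (hY₀ : Y₀.PosDef) (hX₀ : X₀.PosDef) :
    Tendsto (fun i => schurInv A (Y i) (X i)) l (𝓝 (schurInv A Y₀ X₀)) := by
  refine tendsto_inv_matrix (hY.add ?_) (posDef_add_gram A hY₀ hX₀)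
  have hc : Continuous fun Z : Matrix k k ℝ => A * Z * Aᵀ :=
    (continuous_const.matrix_mul continuous_id).matrix_mul continuous_const
  exact hc.continuousAt.tendsto.comp (tendsto_inv_matrix hX hX₀)

lemma tendsto_linearMap {ι : Type*} {l : Filter ι} (Φ : Matrix m m ℝ →ₗ[ℝ] Matrix k k ℝ)
    {B : ι → Matrix m m ℝ} {B₀ : Matrix m m ℝ} (hB : Tendsto B l (𝓝 B₀)) :
    Tendsto (fun i => Φ (B i)) l (𝓝 (Φ B₀)) :=
  (LinearMap.continuous_of_finiteDimensional Φ).continuousAt.tendsto.comp hB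

variable {Φ : Matrix m m ℝ →ₗ[ℝ] Matrix k k ℝ} {Φ' : Matrix k k ℝ →ₗ[ℝ] Matrix m m ℝ}
  {κ₁ κ₂ s₁ s₂ : ℝ}

/-- The system is solvable when `b > 0`. -/
theorem exists_exactSol (hΦ : TransferPair Φ Φ' κ₁ κ₂) (hs₁ : 0 ≤ s₁) (hs₂ : 0 ≤ s₂)
    (A : Matrix m k ℝ) {b : ℝ} (hb : 0 < b) : ∃ X Y, ExactSol Φ Φ' s₁ s₂ A b X Y := by
  have hκ₂ := hΦ.pos₂
  let F : Matrix k k ℝ × Matrix m m ℝ → Matrix k k ℝ × Matrix m m ℝ := fun p =>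
    (1 + s₁ • Φ (schurInv A p.2 p.1), b • (1 : Matrix m m ℝ) + s₂ • Φ' (schurInv Aᵀ p.1 p.2))
  have pd₁ : ∀ {X : Matrix k k ℝ}, 1 ≤ X → X.PosDef := fun h => posDef_of_le Matrix.PosDef.one h
  have pd₂ : ∀ {Y : Matrix m m ℝ}, b • (1 : Matrix m m ℝ) ≤ Y → Y.PosDef :=
    fun h => posDef_of_smul_one_le hb h
  let D : Set (Matrix k k ℝ × Matrix m m ℝ) := {p | 1 ≤ p.1 ∧ b • (1 : Matrix m m ℝ) ≤ p.2}
  have hFD : ∀ p ∈ D, F p ∈ D := fun p hp => by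
    refine ⟨le_add_of_nonneg_right ?_, le_add_of_nonneg_right ?_⟩
    · simpa using smul_le_smul_of_nonneg hs₁
        (hΦ.nonneg (schurInv_nonneg A (pd₂ hp.2) (pd₁ hp.1)))
    · simpa using smul_le_smul_of_nonneg hs₂
        (hΦ.symm.nonneg (schurInv_nonneg Aᵀ (pd₁ hp.1) (pd₂ hp.2)))
  -- `F` is monotone for the order that is reversed in the second variable.
  have hFmono : ∀ p ∈ D, ∀ q ∈ D, p.1 ≤ q.1 → q.2 ≤ p.2 →
      (F p).1 ≤ (F q).1 ∧ (F q).2 ≤ (F p).2 := fun p hp q hq h1 h2 => by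
    refine ⟨add_le_add_right (smul_le_smul_of_nonneg hs₁ (hΦ.mono ?_)) _,
      add_le_add_right (smul_le_smul_of_nonneg hs₂ (hΦ.symm.mono ?_)) _⟩
    · simpa using schurInv_le_smul A one_pos (pd₂ hq.2) (pd₁ hp.1) (pd₁ hq.1)
        (by simpa using h2) (by simpa using h1)
    · simpa using schurInv_le_smul Aᵀ one_pos (pd₁ hp.1) (pd₂ hq.2) (pd₂ hp.2)
        (by simpa using h1) (by simpa using h2)
  have hF₁ : ∀ p ∈ D, (F p).1 ≤ 1 + (s₁ * (κ₂ * (b⁻¹ * Fintype.card m))) • 1 := fun p hp => by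
    have hQ := schurInv_nonneg A (pd₂ hp.2) (pd₁ hp.1)
    have h1 := trace_le_trace ((schurInv_le_inv A (pd₂ hp.2) (pd₁ hp.1)).trans
      (inv_le_smul_one hb hp.2))
    rw [Matrix.trace_smul, Matrix.trace_one, smul_eq_mul] at h1
    have h2 := smul_le_smul_of_nonneg hs₁ (hΦ.upper _ hQ)
    rw [smul_smul] at h2
    exact add_le_add_right (h2.trans (smul_one_le_smul_one (by gcongr))) _
  have hF₂ : ∀ p ∈ D, (F p).2 ≤ b • 1 + (s₂ * (κ₂ * Fintype.card k)) • 1 := fun p hp => by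
    have hQ := schurInv_nonneg Aᵀ (pd₁ hp.1) (pd₂ hp.2)
    have h1 := trace_le_trace ((schurInv_le_inv Aᵀ (pd₁ hp.1) (pd₂ hp.2)).trans
      (inv_le_inv_of_le Matrix.PosDef.one hp.1))
    rw [inv_one, Matrix.trace_one] at h1
    have h2 := smul_le_smul_of_nonneg hs₂ (hΦ.upper' _ hQ)
    rw [smul_smul] at h2
    exact add_le_add_right (h2.trans (smul_one_le_smul_one (by gcongr))) _
  -- The iteration starts at the least `X` of the domain and at the upper bound `hF₂` for the second
  -- component of `F`. The first step therefore goes in the right direction, and `X` increases while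
  -- `Y` decreases.
  let p : ℕ → Matrix k k ℝ × Matrix m m ℝ := fun n =>
    F^[n] (1, b • 1 + (s₂ * (κ₂ * Fintype.card k)) • 1)
  have hp : ∀ n, p (n + 1) = F (p n) := fun n => Function.iterate_succ_apply' F n _
  have hpD : ∀ n, p n ∈ D := fun n => by
    induction n with
    | zero => exact ⟨le_rfl, le_add_of_nonneg_right (smul_one_nonneg (by positivity))⟩
    | succ n ih => rw [hp]; exact hFD _ ih
  have hstep : ∀ n, (p n).1 ≤ (p (n + 1)).1 ∧ (p (n + 1)).2 ≤ (p n).2 := fun n => by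
    induction n with
    | zero =>
      refine ⟨(hpD 1).1, ?_⟩
      rw [hp]
      exact hF₂ _ (hpD 0)
    | succ n ih =>
      have := hFmono _ (hpD n) _ (hpD (n + 1)) ih.1 ih.2
      rwa [← hp, ← hp] at this
  obtain ⟨X, hX⟩ := exists_tendsto_of_monotone (X := fun n => (p n).1)
    (B := 1 + (s₁ * (κ₂ * (b⁻¹ * Fintype.card m))) • 1)
    (Matrix.PosSemidef.one.nonneg.trans (hpD 0).1) (fun n => (hstep n).1)
    (fun n => (hstep n).1.trans (by rw [hp]; exact hF₁ _ (hpD n)))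
  obtain ⟨Y, hY⟩ := exists_tendsto_of_antitone (X := fun n => (p n).2) (fun n => (hstep n).2)
    (fun n => (smul_one_nonneg hb.le).trans (hpD n).2)
  have hX1 : 1 ≤ X := le_of_tendsto_matrix tendsto_const_nhds hX
    (Eventually.of_forall fun n => (hpD n).1)
  have hYb : b • (1 : Matrix m m ℝ) ≤ Y := le_of_tendsto_matrix tendsto_const_nhds hY
    (Eventually.of_forall fun n => (hpD n).2)
  refine ⟨X, Y, pd₁ hX1, pd₂ hYb, ?_, ?_⟩
  · refine tendsto_nhds_unique (hX.comp (tendsto_add_atTop_nat 1)) ?_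
    have h1 := tendsto_linearMap Φ (tendsto_schurInv A hY hX (pd₂ hYb) (pd₁ hX1))
    refine ((h1.const_smul s₁).const_add 1).congr fun n => ?_
    simp only [Function.comp, hp, F]
  · refine tendsto_nhds_unique (hY.comp (tendsto_add_atTop_nat 1)) ?_
    have h1 := tendsto_linearMap Φ' (tendsto_schurInv Aᵀ hX hY (pd₁ hX1) (pd₂ hYb))
    refine ((h1.const_smul s₂).const_add (b • (1 : Matrix m m ℝ))).congr fun n => ?_
    simp only [Function.comp, hp, F]

/-- Solutions with small parameters are close to each other in the order sense. -/
lemma ExactSol.exists_mutualLE (hΦ : TransferPair Φ Φ' κ₁ κ₂) (hs₁ : 0 ≤ s₁) (hs₂ : 0 ≤ s₂)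
    {A : Matrix m k ℝ} {K y M δ b₁ b₂ : ℝ} {X₁ X₂ : Matrix k k ℝ} {Y₁ Y₂ : Matrix m m ℝ}
    (hy : 0 < y) (hy1 : y ≤ 1) (hM : 1 ≤ M) (hA : ‖A‖ ^ 2 ≤ K)
    (hb₁ : 0 ≤ b₁) (hb₂ : 0 ≤ b₂) (hδ : 0 < δ) (hδ₁ : b₁ ≤ δ) (hδ₂ : b₂ ≤ δ)
    (hB₁ : Bounds y M X₁ Y₁) (hB₂ : Bounds y M X₂ Y₂)
    (h₁ : ExactSol Φ Φ' s₁ s₂ A b₁ X₁ Y₁) (h₂ : ExactSol Φ Φ' s₁ s₂ A b₂ X₂ Y₂) :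
    ∃ c : ℝ, 1 ≤ c ∧ c - 1 ≤ stabConst y M K * δ ∧ MutualLE c X₁ X₂ ∧ MutualLE c Y₁ Y₂ :=
  ESN.exists_mutualLE hΦ hs₁ hs₂ hy hy1 hM hδ hA hB₁ hB₂ (h₁.approxSol hb₁ hδ₁)
    (h₂.approxSol hb₂ hδ₂)

/-- The system without data matrix is solvable for `b = 0`. -/
theorem exists_exactSol_zero (hΦ : TransferPair Φ Φ' κ₁ κ₂) {ρ σ S : ℝ} (hρ : 1 ≤ ρ)
    (hsρ : s₁ ≤ ρ * s₂) (hs₁ : 0 ≤ s₁) (hs₂ : 0 ≤ s₂) (hσ : 0 < σ)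
    (hσs : σ ≤ s₂ * (Fintype.card k - ρ * Fintype.card m))
    (hS₁ : s₁ * Fintype.card m ≤ S) (hS₂ : s₂ * Fintype.card k ≤ S) :
    ∃ X Y, ExactSol Φ Φ' s₁ s₂ (0 : Matrix m k ℝ) 0 X Y := by
  have hb : ∀ n : ℕ, 0 < 1 / ((n : ℝ) + 1) := fun n => Nat.one_div_pos_of_nat
  have hb1 : ∀ n : ℕ, 1 / ((n : ℝ) + 1) ≤ 1 := fun n => by
    rw [div_le_one (by positivity)]; linarith [(Nat.cast_nonneg n : (0 : ℝ) ≤ n)]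
  choose X Y h using fun n : ℕ => exists_exactSol hΦ hs₁ hs₂ (0 : Matrix m k ℝ) (hb n)
  set y := min 1 (κ₁ * σ) with hy
  set M := 1 + κ₂ * S / y with hM
  have hB : ∀ n, Bounds y M (X n) (Y n) := fun n =>
    (h n).bounds hΦ hρ hsρ hs₁ hs₂ (hb n).le (hb1 n) hσ hσs hS₁ hS₂
  have hκ₁ := hΦ.pos₁
  have hκ₂ := hΦ.pos₂
  have hy0 : 0 < y := lt_min one_pos (by positivity)
  have hS0 : 0 ≤ S := le_trans (by positivity) hS₁
  have hM1 : 1 ≤ M := by rw [hM]; have : 0 ≤ κ₂ * S / y := by positivity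
                         linarith
  have hM0 : 0 ≤ M := by linarith
  have hlim : Tendsto (fun n : ℕ => stabConst y M 0 * (1 / ((n : ℝ) + 1)) * M) atTop (𝓝 0) := by
    have := (tendsto_one_div_add_atTop_nhds_zero_nat (𝕜 := ℝ)).const_mul (stabConst y M 0)
    simpa using this.mul_const M
  -- Solutions for `b = 1/(n + 1)` form a Cauchy sequence by stability, since the bounds `y` and `M`
  -- do not depend on `b`.
  have hclose : ∀ n i j : ℕ, n ≤ i → n ≤ j →
      ‖X i - X j‖ ≤ stabConst y M 0 * (1 / ((n : ℝ) + 1)) * M ∧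
      ‖Y i - Y j‖ ≤ stabConst y M 0 * (1 / ((n : ℝ) + 1)) * M := fun n i j hi hj => by
    obtain ⟨c, hc1, hc, hcX, hcY⟩ := (h i).exists_mutualLE hΦ hs₁ hs₂ hy0 (min_le_left _ _) hM1
      (K := 0) (by simp) (hb i).le (hb j).le (hb n) (by gcongr) (by gcongr) (hB i) (hB j) (h j)
    exact ⟨(hcX.norm_sub_le hc1 hM0 (hB i).le_left (hB j).le_left).trans (by gcongr),
      (hcY.norm_sub_le hc1 hM0 (hB i).le_right (hB j).le_right).trans (by gcongr)⟩
  have hXc : CauchySeq X := cauchySeq_of_le_tendsto_0' _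
    (fun n i hi => by rw [dist_eq_norm]; exact (hclose n n i le_rfl hi).1) hlim
  obtain ⟨X₀, hX₀⟩ := cauchySeq_tendsto_of_complete hXc
  have hYc : CauchySeq Y := cauchySeq_of_le_tendsto_0' _
    (fun n i hi => by rw [dist_eq_norm]; exact (hclose n n i le_rfl hi).2) hlim
  obtain ⟨Y₀, hY₀⟩ := cauchySeq_tendsto_of_complete hYc
  have hX1 : X₀.PosDef := posDef_of_le Matrix.PosDef.one (le_of_tendsto_matrix tendsto_const_nhds
    hX₀ (Eventually.of_forall fun n => (hB n).one_le))
  have hY1 : Y₀.PosDef := posDef_of_smul_one_le hy0 (le_of_tendsto_matrix tendsto_const_nhds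
    hY₀ (Eventually.of_forall fun n => (hB n).smul_le))
  refine ⟨X₀, Y₀, hX1, hY1, tendsto_nhds_unique hX₀ ?_, tendsto_nhds_unique hY₀ ?_⟩
  · have h1 := tendsto_linearMap Φ (tendsto_schurInv 0 hY₀ hX₀ hY1 hX1)
    exact ((h1.const_smul s₁).const_add 1).congr fun n => (h n).eq_left.symm
  · have h1 := tendsto_linearMap Φ' (tendsto_schurInv 0ᵀ hX₀ hY₀ hX1 hY1)
    have h2 := (tendsto_one_div_add_atTop_nhds_zero_nat (𝕜 := ℝ)).smul_const (1 : Matrix m m ℝ)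
    exact (h2.add (h1.const_smul s₂)).congr fun n => (h n).eq_right.symm

end Limits

/-! ### Traces of matrices with low displacement rank. -/

section Rank

variable {m k : Type*} [Fintype m] [DecidableEq m] [Fintype k] [DecidableEq k]

lemma matrix_rank_add_le (A B : Matrix m k ℝ) : (A + B).rank ≤ A.rank + B.rank := by
  have hle : LinearMap.range (A + B).mulVecLin ≤
      LinearMap.range A.mulVecLin ⊔ LinearMap.range B.mulVecLin := by
    rw [Matrix.mulVecLin_add]
    exact LinearMap.range_add_le _ _
  exact (Submodule.finrank_mono hle).trans (Submodule.finrank_add_le_finrank_add_finrank _ _)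

lemma matrix_rank_sum_le {ι : Type*} (s : Finset ι) (A : ι → Matrix m k ℝ) :
    (∑ i ∈ s, A i).rank ≤ ∑ i ∈ s, (A i).rank := by
  classical
  induction s using Finset.induction_on with
  | empty => simp
  | insert i s hi ih =>
    rw [Finset.sum_insert hi, Finset.sum_insert hi]
    exact (matrix_rank_add_le _ _).trans (by gcongr)

lemma abs_dotProduct_mulVec_le_norm (A : Matrix m m ℝ) (v : m → ℝ) :
    |v ⬝ᵥ A *ᵥ v| ≤ ‖A‖ * (v ⬝ᵥ v) := by
  refine abs_le'.2 ⟨dotProduct_mulVec_le_norm A v, ?_⟩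
  simpa [Matrix.neg_mulVec] using dotProduct_mulVec_le_norm (-A) v

/-- The trace is at most the rank times the spectral norm. -/
lemma abs_trace_le_rank_mul_norm (B : Matrix m m ℝ) : |B.trace| ≤ B.rank * ‖B‖ := by
  -- The trace is computed in an eigenbasis of `B Bᵀ`. Eigenvectors for the eigenvalue `0` are
  -- killed by `Bᵀ` and contribute nothing; the remaining ones are as many as the rank, and each
  -- contributes at most `‖B‖`.
  have hH : (B * Bᵀ).IsHermitian := by simp [Matrix.IsHermitian]
  let v : m → m → ℝ := fun i => hH.eigenvectorBasis i
  have hv : ∀ i, v i ⬝ᵥ v i = 1 := fun i => by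
    have := hH.eigenvectorBasis.orthonormal.1 i
    have h2 := EuclideanSpace.real_norm_sq_eq (hH.eigenvectorBasis i)
    rw [this] at h2
    simpa [dotProduct, pow_two, v] using h2.symm
  let U : Matrix m m ℝ := hH.eigenvectorUnitary
  have hU : U * Uᵀ = 1 := by
    have := Matrix.mem_unitaryGroup_iff.1 hH.eigenvectorUnitary.2
    simpa [Matrix.star_eq_conjTranspose] using this
  have htr : B.trace = ∑ i, v i ⬝ᵥ B *ᵥ v i := by
    have h1 : B.trace = (Uᵀ * B * U).trace := by
      rw [Matrix.trace_mul_comm, ← Matrix.mul_assoc, hU, Matrix.one_mul]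
    rw [h1, Matrix.trace]
    refine Finset.sum_congr rfl fun i _ => ?_
    rw [Matrix.diag_apply, Matrix.mul_assoc, Matrix.mul_apply]
    rfl
  have hzero : ∀ i, hH.eigenvalues i = 0 → v i ⬝ᵥ B *ᵥ v i = 0 := fun i hi => by
    have h1 := hH.mulVec_eigenvectorBasis i
    rw [hi, zero_smul] at h1
    have h2 : (Bᵀ *ᵥ v i) ⬝ᵥ (Bᵀ *ᵥ v i) = 0 := by
      rw [Matrix.dotProduct_mulVec, Matrix.vecMul_transpose, Matrix.mulVec_mulVec,
        show (B * Bᵀ) *ᵥ v i = 0 from h1, zero_dotProduct]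
    rw [Matrix.dotProduct_mulVec, ← Matrix.mulVec_transpose, dotProduct_self_eq_zero.1 h2,
      zero_dotProduct]
  have hrank : (B.rank : ℝ) = (Finset.univ.filter fun i => hH.eigenvalues i ≠ 0).card := by
    have := hH.rank_eq_card_non_zero_eigs
    rw [Matrix.rank_self_mul_transpose] at this
    rw [this, Fintype.card_subtype]
  rw [htr, hrank, ← nsmul_eq_mul, ← Finset.sum_const]
  refine (Finset.abs_sum_le_sum_abs _ _).trans ?_
  rw [Finset.sum_filter]
  refine Finset.sum_le_sum fun i _ => ?_
  split_ifs with h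
  · simpa [hv] using abs_dotProduct_mulVec_le_norm B (v i)
  · rw [hzero i (not_not.1 h), abs_zero]

lemma abs_trace_mul_le_of_rank_le {r : ℕ} {D : Matrix m k ℝ} (hD : D.rank ≤ r)
    (Z : Matrix k m ℝ) : |(D * Z).trace| ≤ r * ‖D‖ * ‖Z‖ := by
  have h1 := abs_trace_le_rank_mul_norm (D * Z)
  have h2 : ((D * Z).rank : ℝ) ≤ r := by exact_mod_cast (Matrix.rank_mul_le_left D Z).trans hD
  calc |(D * Z).trace| ≤ r * (‖D‖ * ‖Z‖) := h1.trans (by gcongr; exact Matrix.l2_opNorm_mul D Z)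
    _ = _ := by ring

/-- A matrix with a displacement of low rank pairs to small traces. -/
lemma traceBound_of_displacement {r L : ℕ} {w : ℝ} {A : Matrix m k ℝ} {W : Matrix m m ℝ}
    {J : Matrix k k ℝ} (hW : ‖W‖ ≤ w) (hw1 : w ≤ 1) (hJ : ‖J‖ ≤ 1)
    (hr : (A - W * A * J).rank ≤ r) :
    TraceBound A ((2 * (r * L) + Fintype.card m * w ^ L) * ‖A‖) := by
  have hw0 : 0 ≤ w := (norm_nonneg _).trans hW
  have hnorm : ∀ l : ℕ, ‖W ^ l * A * J ^ l‖ ≤ w ^ l * ‖A‖ := fun l => by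
    induction l with
    | zero => simp
    | succ l ih =>
      have : W ^ (l + 1) * A * J ^ (l + 1) = W * (W ^ l * A * J ^ l) * J := by
        rw [pow_succ' W, pow_succ J]; simp [Matrix.mul_assoc]
      rw [this]
      calc ‖W * (W ^ l * A * J ^ l) * J‖ ≤ ‖W * (W ^ l * A * J ^ l)‖ * ‖J‖ :=
            Matrix.l2_opNorm_mul _ _
        _ ≤ ‖W‖ * ‖W ^ l * A * J ^ l‖ * ‖J‖ := by gcongr; exact Matrix.l2_opNorm_mul _ _
        _ ≤ w * (w ^ l * ‖A‖) * 1 := by gcongr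
        _ = _ := by ring
  -- Telescoping writes `A` as `L` terms of rank at most `r` each, plus a remainder of norm at most
  -- `w ^ L ‖A‖`. The first part pays through its rank, the second through its norm.
  have hsum : A - W ^ L * A * J ^ L = ∑ l ∈ Finset.range L, W ^ l * (A - W * A * J) * J ^ l := by
    have := Finset.sum_range_sub' (fun l => W ^ l * A * J ^ l) L
    simp only [pow_zero, Matrix.one_mul, Matrix.mul_one] at this
    rw [← this]
    refine Finset.sum_congr rfl fun l _ => ?_
    rw [Matrix.mul_sub, Matrix.sub_mul, pow_succ W, pow_succ' J]
    simp [Matrix.mul_assoc]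
  have hrank : (A - W ^ L * A * J ^ L).rank ≤ r * L := by
    rw [hsum]
    refine (matrix_rank_sum_le _ _).trans ?_
    refine (Finset.sum_le_card_nsmul _ _ r fun l _ => ?_).trans_eq (by simp [mul_comm])
    exact ((Matrix.rank_mul_le_left _ _).trans (Matrix.rank_mul_le_right _ _)).trans hr
  have hwL : w ^ L ≤ 1 := pow_le_one₀ hw0 hw1
  have hD : ‖A - W ^ L * A * J ^ L‖ ≤ 2 * ‖A‖ := by
    have h1 := norm_sub_le A (W ^ L * A * J ^ L)
    have h2 : w ^ L * ‖A‖ ≤ 1 * ‖A‖ := by gcongr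
    linarith [hnorm L]
  intro Z
  have h1 := abs_trace_mul_le_of_rank_le hrank Z
  have h2 := abs_trace_mul_le_of_rank_le (Matrix.rank_le_card_height (W ^ L * A * J ^ L)) Z
  have h3 : (A * Z).trace = ((A - W ^ L * A * J ^ L) * Z).trace
      + (W ^ L * A * J ^ L * Z).trace := by
    rw [← Matrix.trace_add, ← Matrix.add_mul, sub_add_cancel]
  rw [h3]
  refine (abs_add_le _ _).trans ((add_le_add h1 h2).trans ?_)
  push_cast
  calc (r * L : ℝ) * ‖A - W ^ L * A * J ^ L‖ * ‖Z‖
        + Fintype.card m * ‖W ^ L * A * J ^ L‖ * ‖Z‖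
      ≤ (r * L : ℝ) * (2 * ‖A‖) * ‖Z‖ + Fintype.card m * (w ^ L * ‖A‖) * ‖Z‖ := by
        gcongr; exact hnorm L
    _ = _ := by ring

end Rank

/-! ### The displacement structure of the data matrix. -/

section Displacement

lemma shift_mulVec_sq_le (T : ℕ) (q : ℤ) (v : Fin T → ℝ) :
    (shift T q *ᵥ v) ⬝ᵥ (shift T q *ᵥ v) ≤ 1 ^ 2 * (v ⬝ᵥ v) := by
  have h1 : ∀ i : Fin T, (shift T q *ᵥ v) i * (shift T q *ᵥ v) i
      = ∑ j : Fin T, if (i : ℤ) + q = j then v j * v j else 0 := fun i => by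
    simp only [Matrix.mulVec, dotProduct, shift, Matrix.of_apply, ite_mul, one_mul, zero_mul]
    by_cases h : ∃ j : Fin T, (i : ℤ) + q = j
    · obtain ⟨j, hj⟩ := h
      have he : ∀ l : Fin T, (i : ℤ) + q = l ↔ j = l := fun l => by
        rw [hj, Nat.cast_inj, Fin.val_inj]
      simp [he]
    · have he : ∀ l : Fin T, ¬ (i : ℤ) + q = l := fun l hl => h ⟨l, hl⟩
      simp [he]
  rw [dotProduct, Finset.sum_congr rfl fun i _ => h1 i, Finset.sum_comm, one_pow, one_mul]
  refine Finset.sum_le_sum fun j _ => ?_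
  rw [← Finset.sum_filter, Finset.sum_const]
  have hcard : (Finset.univ.filter fun i : Fin T => (i : ℤ) + q = j).card ≤ 1 := by
    refine Finset.card_le_one.2 fun a ha b hb => ?_
    simp only [Finset.mem_filter, Finset.mem_univ, true_and] at ha hb
    exact Fin.ext (by omega)
  rw [nsmul_eq_mul]
  exact mul_le_of_le_one_left (mul_self_nonneg _) (by exact_mod_cast hcard)

lemma norm_shift_le (T : ℕ) (q : ℤ) : ‖shift T q‖ ≤ 1 :=
  norm_le_of_mulVec zero_le_one (shift_mulVec_sq_le T q)

lemma dataMatrix_apply {n : ℕ} (T : ℕ) (W : Matrix (Fin n) (Fin n) ℝ) (m : Fin n → ℝ)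
    (u : ℤ → ℝ) (i : Fin n) (j : Fin T) :
    dataMatrix T W m u i j =
      ∑ l ∈ Finset.range T, (W ^ l *ᵥ m) i * ((1 / Real.sqrt T) * u ((j : ℤ) - (l : ℤ))) := by
  rw [Finset.sum_range]
  rfl

lemma mul_shift_one_apply {n T : ℕ} (B : Matrix (Fin n) (Fin T) ℝ) (i : Fin n) (j : Fin T) :
    (B * shift T 1) i j = if h : 0 < (j : ℕ) then B i ⟨j - 1, by omega⟩ else 0 := by
  simp only [Matrix.mul_apply, shift, Matrix.of_apply, mul_ite, mul_one, mul_zero]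
  split_ifs with h
  · have he : ∀ l : Fin T, (l : ℤ) + 1 = j ↔ (⟨j - 1, by omega⟩ : Fin T) = l := fun l => by
      rw [Fin.ext_iff]; simp only; omega
    simp [he]
  · refine Finset.sum_eq_zero fun l _ => if_neg (by omega)

/-- The data matrix has a displacement of rank at most `3`. -/
lemma rank_displacement_dataMatrix_le {n : ℕ} (T : ℕ) (W : Matrix (Fin n) (Fin n) ℝ)
    (m : Fin n → ℝ) (u : ℤ → ℝ) :
    (dataMatrix T W m u - W * dataMatrix T W m u * shift T 1).rank ≤ 3 := by
  set A := dataMatrix T W m u with hA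
  set E := A - W * A * shift T 1 with hE
  let s : ℝ := 1 / Real.sqrt T
  -- With rows of the Toeplitz factor indexed by `l`, the shift carries row `l` to row `l + 1`
  -- except in column `0`. The displacement thus telescopes to `m r₁ - (W ^ T m) r₂`, where `r₁` is
  -- row `0` and `r₂` would be row `T`. The correction `G` lives in column `0`, which gives the
  -- third unit of rank.
  let r₁ : Fin T → ℝ := fun j => s * u j
  let r₂ : Fin T → ℝ := fun j => s * u ((j : ℤ) - T)
  let G := E - (Matrix.vecMulVec m r₁ + Matrix.vecMulVec (-(W ^ T *ᵥ m)) r₂)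
  have hWA : ∀ i j, (W * A) i j =
      ∑ l ∈ Finset.range T, (W ^ (l + 1) *ᵥ m) i * (s * u ((j : ℤ) - (l : ℤ))) := fun i j => by
    rw [Matrix.mul_apply]
    simp only [hA, dataMatrix_apply, Finset.mul_sum]
    rw [Finset.sum_comm]
    refine Finset.sum_congr rfl fun l _ => ?_
    rw [pow_succ', ← Matrix.mulVec_mulVec, Matrix.mulVec, dotProduct, Finset.sum_mul]
    exact Finset.sum_congr rfl fun x _ => by simp only [s]; ring
  have hG : ∀ (i : Fin n) (j : Fin T), (j : ℕ) ≠ 0 → G i j = 0 := fun i j hj => by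
    have hj' : 0 < (j : ℕ) := Nat.pos_of_ne_zero hj
    simp only [G, hE, Matrix.sub_apply, Matrix.add_apply, Matrix.vecMulVec_apply,
      mul_shift_one_apply, dif_pos hj', hWA]
    rw [hA, dataMatrix_apply]
    have hcast : (((⟨(j : ℕ) - 1, by omega⟩ : Fin T) : ℕ) : ℤ) = (j : ℤ) - 1 := by
      push_cast [Nat.cast_sub (show 1 ≤ (j : ℕ) from hj')]; ring
    rw [hcast]
    have h1 := Finset.sum_range_sub'
      (fun l : ℕ => (W ^ l *ᵥ m) i * (s * u ((j : ℤ) - (l : ℤ)))) T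
    rw [Finset.sum_sub_distrib] at h1
    have h2 : ∀ l : ℕ, (j : ℤ) - 1 - (l : ℤ) = (j : ℤ) - ((l + 1 : ℕ) : ℤ) := fun l => by
      push_cast; ring
    simp only [h2]
    rw [h1]
    simp [r₁, r₂]
    ring
  have hEG : E = Matrix.vecMulVec m r₁ + Matrix.vecMulVec (-(W ^ T *ᵥ m)) r₂ + G := by
    simp only [G]; abel
  have hGr : G.rank ≤ 1 := by
    have : G = Matrix.vecMulVec (fun i => if h : 0 < T then G i ⟨0, h⟩ else 0)
        (fun j : Fin T => if (j : ℕ) = 0 then 1 else 0) := by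
      ext i j
      rw [Matrix.vecMulVec_apply]
      have hT : 0 < T := j.pos
      by_cases hj : (j : ℕ) = 0
      · have : j = ⟨0, hT⟩ := Fin.ext hj
        rw [if_pos hj, mul_one, dif_pos hT, this]
      · rw [if_neg hj, mul_zero, hG i j hj]
    rw [this]
    exact Matrix.rank_vecMulVec_le _ _
  rw [hEG]
  refine (matrix_rank_add_le _ _).trans ?_
  have h1 := matrix_rank_add_le (Matrix.vecMulVec m r₁) (Matrix.vecMulVec (-(W ^ T *ᵥ m)) r₂)
  have h2 := Matrix.rank_vecMulVec_le m r₁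
  have h3 := Matrix.rank_vecMulVec_le (-(W ^ T *ᵥ m)) r₂
  omega

lemma traceBound_dataMatrix {n T : ℕ} {W : Matrix (Fin n) (Fin n) ℝ} {w : ℝ} (hW : ‖W‖ ≤ w)
    (hw : w ≤ 1) (m : Fin n → ℝ) (u : ℤ → ℝ) (L : ℕ) :
    TraceBound (dataMatrix T W m u) ((6 * L + n * w ^ L) * ‖dataMatrix T W m u‖) := by
  have := traceBound_of_displacement (L := L) hW hw (norm_shift_le T 1)
    (rank_displacement_dataMatrix_le T W m u)
  convert this using 2
  push_cast
  rw [Fintype.card_fin]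
  ring

end Displacement

/-! ### The quadratic form of the lag covariances. -/

section LagCov

variable {n : ℕ} {W : Matrix (Fin n) (Fin n) ℝ} {w : ℝ}

lemma norm_one_le : ‖(1 : Matrix (Fin n) (Fin n) ℝ)‖ ≤ 1 :=
  norm_le_of_mulVec zero_le_one fun v => by simp

lemma norm_pow_le_pow (hW : ‖W‖ ≤ w) (k : ℕ) : ‖W ^ k‖ ≤ w ^ k := by
  have hw : 0 ≤ w := (norm_nonneg _).trans hW
  induction k with
  | zero => simpa using norm_one_le
  | succ k ih =>
    rw [pow_succ, pow_succ]
    exact (norm_mul_le _ _).trans (by gcongr)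

lemma summable_pow_mul_transpose (hW : ‖W‖ ≤ w) (hw1 : w < 1) :
    Summable fun k : ℕ => W ^ k * (W ^ k)ᵀ := by
  have hw : 0 ≤ w := (norm_nonneg _).trans hW
  refine Summable.of_norm_bounded (g := fun k => (w ^ 2) ^ k)
    (summable_geometric_of_lt_one (by positivity) (by nlinarith)) fun k => ?_
  refine (norm_mul_le _ _).trans ?_
  rw [norm_transpose_eq, ← pow_mul, mul_comm 2 k, pow_mul, pow_two]
  have := norm_pow_le_pow hW k
  gcongr

lemma lagCov_zero_def (W : Matrix (Fin n) (Fin n) ℝ) :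
    lagCov W 0 = ∑' k : ℕ, W ^ k * (W ^ k)ᵀ := by
  simp [lagCov]

lemma lagCov_natCast (hW : ‖W‖ ≤ w) (hw1 : w < 1) (q : ℕ) :
    lagCov W q = lagCov W 0 * (W ^ q)ᵀ := by
  rw [lagCov_zero_def, ← (summable_pow_mul_transpose hW hw1).tsum_mul_right, lagCov]
  refine tsum_congr fun k => ?_
  have : (-(q : ℤ)).toNat = 0 := by omega
  rw [this, Int.toNat_natCast, add_zero, add_comm k q, pow_add W q, Matrix.transpose_mul,
    Matrix.mul_assoc]

lemma lagCov_neg_natCast (hW : ‖W‖ ≤ w) (hw1 : w < 1) (q : ℕ) :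
    lagCov W (-q) = W ^ q * lagCov W 0 := by
  rw [lagCov_zero_def, ← (summable_pow_mul_transpose hW hw1).tsum_mul_left, lagCov]
  refine tsum_congr fun k => ?_
  have : (-(q : ℤ)).toNat = 0 := by omega
  rw [this, neg_neg, Int.toNat_natCast, add_zero, add_comm k q, pow_add W q, Matrix.mul_assoc]

lemma lagCov_zero_eq (hW : ‖W‖ ≤ w) (hw1 : w < 1) :
    lagCov W 0 = 1 + W * lagCov W 0 * Wᵀ := by
  have hs := summable_pow_mul_transpose hW hw1
  conv_lhs => rw [lagCov_zero_def, hs.tsum_eq_zero_add]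
  rw [lagCov_zero_def, ← hs.tsum_mul_left, ← (hs.mul_left W).tsum_mul_right]
  congr 1
  · simp
  · refine tsum_congr fun k => ?_
    rw [pow_succ' W, Matrix.transpose_mul]
    simp [Matrix.mul_assoc]

lemma lagCov_zero_nonneg (hW : ‖W‖ ≤ w) (hw1 : w < 1) : 0 ≤ lagCov W 0 := by
  rw [lagCov_zero_def]
  refine le_of_tendsto_matrix tendsto_const_nhds
    (summable_pow_mul_transpose hW hw1).hasSum.tendsto_sum_nat (Eventually.of_forall fun N => ?_)
  refine Finset.sum_nonneg fun k _ => ?_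
  simpa using conj_nonneg (Matrix.PosSemidef.one.nonneg) (W ^ k)

lemma lagCov_transpose (hW : ‖W‖ ≤ w) (hw1 : w < 1) (q : ℤ) : (lagCov W q)ᵀ = lagCov W (-q) := by
  have h0 := transpose_eq_of_nonneg (lagCov_zero_nonneg hW hw1)
  obtain ⟨k, rfl | rfl⟩ := q.eq_nat_or_neg
  · rw [lagCov_natCast hW hw1, lagCov_neg_natCast hW hw1, Matrix.transpose_mul, h0,
      Matrix.transpose_transpose]
  · rw [neg_neg, lagCov_natCast hW hw1, lagCov_neg_natCast hW hw1, Matrix.transpose_mul, h0]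

lemma norm_lagCov_zero_le (hW : ‖W‖ ≤ w) (hw1 : w < 1) : ‖lagCov W 0‖ ≤ 1 / (1 - w) := by
  have hw : 0 ≤ w := (norm_nonneg _).trans hW
  have h1 : ‖lagCov W 0‖ ≤ 1 + w * ‖lagCov W 0‖ * w := by
    conv_lhs => rw [lagCov_zero_eq hW hw1]
    refine (norm_add_le _ _).trans (add_le_add norm_one_le ?_)
    refine (norm_mul_le _ _).trans ?_
    rw [norm_transpose_eq]
    gcongr
    exact (norm_mul_le _ _).trans (by gcongr)
  rw [le_div_iff₀ (by linarith)]
  nlinarith [norm_nonneg (lagCov W 0)]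

/-- The quadratic form of the lag covariances. -/
noncomputable def lagForm (W : Matrix (Fin n) (Fin n) ℝ) {T : ℕ} (v : Fin T → ℝ) (b : Fin n → ℝ) :
    ℝ :=
  ∑ i, ∑ j, v i * v j * (b ⬝ᵥ lagCov W ((i : ℤ) - (j : ℤ)) *ᵥ b)

/-- The combination `∑ i, v i (Wᵀ) ^ i b`. -/
noncomputable def lagComb (W : Matrix (Fin n) (Fin n) ℝ) {T : ℕ} (v : Fin T → ℝ) (b : Fin n → ℝ) :
    Fin n → ℝ :=
  ∑ i : Fin T, v i • ((W ^ (i : ℕ))ᵀ *ᵥ b)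

lemma lagComb_succ {T : ℕ} (v : Fin (T + 1) → ℝ) (b : Fin n → ℝ) :
    lagComb W v b = v 0 • b + Wᵀ *ᵥ lagComb W (fun i => v i.succ) b := by
  rw [lagComb, Fin.sum_univ_succ, lagComb]
  congr 1
  · simp
  · rw [← Matrix.mulVecLin_apply, map_sum]
    refine Finset.sum_congr rfl fun i _ => ?_
    rw [map_smul, Matrix.mulVecLin_apply, Matrix.mulVec_mulVec, Fin.val_succ, pow_succ,
      Matrix.transpose_mul]

lemma dotProduct_mulVec_symm {S : Matrix (Fin n) (Fin n) ℝ} (hS : Sᵀ = S) (x y : Fin n → ℝ) :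
    x ⬝ᵥ S *ᵥ y = y ⬝ᵥ S *ᵥ x := by
  rw [Matrix.dotProduct_mulVec, ← Matrix.mulVec_transpose, hS, dotProduct_comm]

/-- The first row and the first column of the double sum give the same cross term, because `S_{-q}`
is the transpose of `S_q`; the rest is Toeplitz and reproduces the form on the tail. -/
lemma lagForm_succ (hW : ‖W‖ ≤ w) (hw1 : w < 1) {T : ℕ} (v : Fin (T + 1) → ℝ) (b : Fin n → ℝ) :
    lagForm W v b = v 0 * v 0 * (b ⬝ᵥ lagCov W 0 *ᵥ b)
      + 2 * v 0 * (b ⬝ᵥ lagCov W 0 *ᵥ (Wᵀ *ᵥ lagComb W (fun i => v i.succ) b))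
      + lagForm W (fun i => v i.succ) b := by
  have h0 := transpose_eq_of_nonneg (lagCov_zero_nonneg hW hw1)
  have hcol : ∀ i : Fin T, b ⬝ᵥ lagCov W (((i.succ : Fin (T + 1)) : ℤ) - ((0 : Fin (T + 1)) : ℤ)) *ᵥ b
      = b ⬝ᵥ lagCov W 0 *ᵥ (Wᵀ *ᵥ ((W ^ (i : ℕ))ᵀ *ᵥ b)) := fun i => by
    have : (((i.succ : Fin (T + 1)) : ℤ) - ((0 : Fin (T + 1)) : ℤ)) = ((i + 1 : ℕ) : ℤ) := by simp
    rw [this, lagCov_natCast hW hw1, ← Matrix.mulVec_mulVec, pow_succ, Matrix.transpose_mul,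
      ← Matrix.mulVec_mulVec]
  have hrow : ∀ i : Fin T, b ⬝ᵥ lagCov W (((0 : Fin (T + 1)) : ℤ) - ((i.succ : Fin (T + 1)) : ℤ)) *ᵥ b
      = b ⬝ᵥ lagCov W 0 *ᵥ (Wᵀ *ᵥ ((W ^ (i : ℕ))ᵀ *ᵥ b)) := fun i => by
    rw [← hcol, ← neg_sub, ← lagCov_transpose hW hw1, Matrix.mulVec_transpose, dotProduct_comm,
      ← Matrix.dotProduct_mulVec]
  have hsum : b ⬝ᵥ lagCov W 0 *ᵥ (Wᵀ *ᵥ lagComb W (fun i => v i.succ) b)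
      = ∑ i : Fin T, v i.succ * (b ⬝ᵥ lagCov W 0 *ᵥ (Wᵀ *ᵥ ((W ^ (i : ℕ))ᵀ *ᵥ b))) := by
    rw [lagComb, Matrix.mulVec_mulVec, ← Matrix.mulVecLin_apply, map_sum, dotProduct_sum]
    refine Finset.sum_congr rfl fun i _ => ?_
    rw [map_smul, dotProduct_smul, Matrix.mulVecLin_apply, ← Matrix.mulVec_mulVec, smul_eq_mul]
  rw [lagForm, Fin.sum_univ_succ, Fin.sum_univ_succ]
  simp_rw [Fin.sum_univ_succ (n := T), Finset.sum_add_distrib, hcol, hrow]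
  rw [hsum, lagForm, Finset.mul_sum]
  have hshift : ∀ i j : Fin T, (((i.succ : Fin (T + 1)) : ℤ) - ((j.succ : Fin (T + 1)) : ℤ))
      = (i : ℤ) - (j : ℤ) := fun i j => by simp
  simp_rw [hshift]
  have e1 : ∑ i : Fin T, v i.succ * v 0 * (b ⬝ᵥ lagCov W 0 *ᵥ (Wᵀ *ᵥ ((W ^ (i : ℕ))ᵀ *ᵥ b)))
      = ∑ i : Fin T, v 0 * v i.succ * (b ⬝ᵥ lagCov W 0 *ᵥ (Wᵀ *ᵥ ((W ^ (i : ℕ))ᵀ *ᵥ b))) :=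
    Finset.sum_congr rfl fun i _ => by ring
  have e2 : ∑ i : Fin T, 2 * v 0 * (v i.succ *
        (b ⬝ᵥ lagCov W 0 *ᵥ (Wᵀ *ᵥ ((W ^ (i : ℕ))ᵀ *ᵥ b))))
      = 2 * ∑ i : Fin T, v 0 * v i.succ *
        (b ⬝ᵥ lagCov W 0 *ᵥ (Wᵀ *ᵥ ((W ^ (i : ℕ))ᵀ *ᵥ b))) := by
    rw [Finset.mul_sum]
    exact Finset.sum_congr rfl fun i _ => by ring
  rw [e1, e2]
  simp only [sub_self]
  ring

/-- The part of `lagForm` that does not see the infinite past. -/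
noncomputable def lagFormFinite (W : Matrix (Fin n) (Fin n) ℝ) {T : ℕ} (v : Fin T → ℝ)
    (b : Fin n → ℝ) : ℝ :=
  lagForm W v b - lagComb W v b ⬝ᵥ lagCov W 0 *ᵥ lagComb W v b + lagComb W v b ⬝ᵥ lagComb W v b

/-- The identity `S₀ = 1 + W S₀ Wᵀ` absorbs the change of the infinite-past term. Iterated, it shows
that `lagFormFinite` is the sum over `j` of `‖z_j‖²` with `z_j = v_j b + Wᵀ z_{j+1}`, a stable
recursion run backwards. -/
lemma lagFormFinite_succ (hW : ‖W‖ ≤ w) (hw1 : w < 1) {T : ℕ} (v : Fin (T + 1) → ℝ)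
    (b : Fin n → ℝ) :
    lagFormFinite W v b = lagComb W v b ⬝ᵥ lagComb W v b
      + lagFormFinite W (fun i => v i.succ) b := by
  have h0 := transpose_eq_of_nonneg (lagCov_zero_nonneg hW hw1)
  rw [lagFormFinite, lagFormFinite, lagForm_succ hW hw1]
  set p := lagComb W (fun i => v i.succ) b with hp
  set q := Wᵀ *ᵥ p with hq
  have h1 : q ⬝ᵥ lagCov W 0 *ᵥ q = p ⬝ᵥ lagCov W 0 *ᵥ p - p ⬝ᵥ p := by
    have : p ⬝ᵥ (W * lagCov W 0 * Wᵀ) *ᵥ p = q ⬝ᵥ lagCov W 0 *ᵥ q := by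
      rw [← Matrix.mulVec_mulVec, ← Matrix.mulVec_mulVec, Matrix.dotProduct_mulVec,
        ← Matrix.mulVec_transpose]
    rw [← this]
    conv_rhs => rw [lagCov_zero_eq hW hw1]
    rw [Matrix.add_mulVec, Matrix.one_mulVec, dotProduct_add]
    ring
  have h2 : lagComb W v b ⬝ᵥ lagCov W 0 *ᵥ lagComb W v b
      = v 0 * v 0 * (b ⬝ᵥ lagCov W 0 *ᵥ b) + 2 * v 0 * (b ⬝ᵥ lagCov W 0 *ᵥ q)
        + (p ⬝ᵥ lagCov W 0 *ᵥ p - p ⬝ᵥ p) := by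
    rw [lagComb_succ, ← hp, ← hq, ← h1]
    simp only [Matrix.mulVec_add, Matrix.mulVec_smul, dotProduct_add, add_dotProduct,
      dotProduct_smul, smul_dotProduct, smul_eq_mul, dotProduct_mulVec_symm h0 q b]
    ring
  rw [h2]
  ring

lemma dotProduct_self_nonneg (x : Fin n → ℝ) : 0 ≤ x ⬝ᵥ x := by
  simpa using dotProduct_star_self_nonneg x

lemma transpose_mulVec_sq_le (hW : ‖W‖ ≤ w) (p : Fin n → ℝ) :
    (Wᵀ *ᵥ p) ⬝ᵥ (Wᵀ *ᵥ p) ≤ w ^ 2 * (p ⬝ᵥ p) := by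
  have h := mulVec_dotProduct_self_le Wᵀ p
  rw [norm_transpose_eq] at h
  refine h.trans ?_
  have := dotProduct_self_nonneg p
  gcongr

/-- The input `v_j b = z_j - Wᵀ z_{j+1}` is controlled by the states, since `‖W‖ ≤ 1`. Half of
`‖z_0‖²` is carried as a reserve; the induction step is then the square of `v_0 b + 2 q` with `q =
Wᵀ p`. -/
lemma le_lagFormFinite (hW : ‖W‖ ≤ w) (hw1 : w < 1) {T : ℕ} (v : Fin T → ℝ) (b : Fin n → ℝ) :
    1 / 4 * ((v ⬝ᵥ v) * (b ⬝ᵥ b)) + 1 / 2 * (lagComb W v b ⬝ᵥ lagComb W v b)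
      ≤ lagFormFinite W v b := by
  have hw : 0 ≤ w := (norm_nonneg _).trans hW
  induction T with
  | zero => simp [lagComb, lagFormFinite, lagForm]
  | succ T ih =>
    rw [lagFormFinite_succ hW hw1]
    have h1 := ih (fun i => v i.succ)
    have hv : v ⬝ᵥ v = v 0 * v 0 + (fun i : Fin T => v i.succ) ⬝ᵥ (fun i => v i.succ) := by
      simp [dotProduct, Fin.sum_univ_succ]
    rw [lagComb_succ]
    set p := lagComb W (fun i => v i.succ) b with hp
    set q := Wᵀ *ᵥ p with hq
    have h2 : q ⬝ᵥ q ≤ w ^ 2 * (p ⬝ᵥ p) := transpose_mulVec_sq_le hW p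
    have h3 : w ^ 2 * (p ⬝ᵥ p) ≤ 1 * (p ⬝ᵥ p) :=
      mul_le_mul_of_nonneg_right (by nlinarith) (dotProduct_self_nonneg p)
    have h4 := dotProduct_self_nonneg (v 0 • b + (2 : ℝ) • q)
    simp only [dotProduct_add, add_dotProduct, dotProduct_smul, smul_dotProduct, smul_eq_mul,
      dotProduct_comm q b] at h4 ⊢
    rw [hv]
    linarith

/-- Stability of the recursion, with convexity in the form `‖x + q‖² ≤ ‖x‖²/(1 - w) + ‖q‖²/w`. The
reserve `w/(1 - w) = 1/(1 - w) - 1` is what `lagForm_le` needs to absorb the infinite past. -/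
lemma lagFormFinite_le (hW : ‖W‖ ≤ w) (hw0 : 0 < w) (hw1 : w < 1) {T : ℕ} (v : Fin T → ℝ)
    (b : Fin n → ℝ) :
    lagFormFinite W v b ≤ (1 / (1 - w)) ^ 2 * ((v ⬝ᵥ v) * (b ⬝ᵥ b))
      - w / (1 - w) * (lagComb W v b ⬝ᵥ lagComb W v b) := by
  have h1w : 0 < 1 - w := by linarith
  induction T with
  | zero => simp [lagComb, lagFormFinite, lagForm]
  | succ T ih =>
    rw [lagFormFinite_succ hW hw1]
    have h1 := ih (fun i => v i.succ)
    have hv : v ⬝ᵥ v = v 0 * v 0 + (fun i : Fin T => v i.succ) ⬝ᵥ (fun i => v i.succ) := by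
      simp [dotProduct, Fin.sum_univ_succ]
    rw [lagComb_succ]
    set p := lagComb W (fun i => v i.succ) b with hp
    set q := Wᵀ *ᵥ p with hq
    have h2 : q ⬝ᵥ q ≤ w ^ 2 * (p ⬝ᵥ p) := transpose_mulVec_sq_le hW p
    set N := (v 0 • b + q) ⬝ᵥ (v 0 • b + q) with hN
    have h4 := dotProduct_self_nonneg (w • (v 0 • b) - (1 - w) • q)
    have h5 : (1 - w) * w * N ≤ w * (v 0 * v 0 * (b ⬝ᵥ b)) + (1 - w) * (q ⬝ᵥ q) := by
      rw [hN]
      simp only [dotProduct_add, add_dotProduct, dotProduct_sub, sub_dotProduct, dotProduct_smul,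
        smul_dotProduct, smul_eq_mul, dotProduct_comm q b] at h4 ⊢
      linarith
    have h6 : (1 - w) * N ≤ v 0 * v 0 * (b ⬝ᵥ b) + (1 - w) * w * (p ⬝ᵥ p) := by
      have : w * ((1 - w) * N) ≤ w * (v 0 * v 0 * (b ⬝ᵥ b) + (1 - w) * w * (p ⬝ᵥ p)) := by
        nlinarith
      exact le_of_mul_le_mul_left this hw0
    have h7 : 1 / (1 - w) * N ≤ (1 / (1 - w)) ^ 2 * (v 0 * v 0 * (b ⬝ᵥ b))
        + w / (1 - w) * (p ⬝ᵥ p) := by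
      have := mul_le_mul_of_nonneg_left h6 (by positivity : 0 ≤ (1 / (1 - w)) ^ 2)
      calc 1 / (1 - w) * N = (1 / (1 - w)) ^ 2 * ((1 - w) * N) := by field_simp
        _ ≤ _ := this
        _ = _ := by field_simp
    have h8 : 1 / (1 - w) * N = N + w / (1 - w) * N := by field_simp; ring
    rw [hv]
    linarith

lemma le_lagForm (hW : ‖W‖ ≤ w) (hw1 : w < 1) {T : ℕ} (v : Fin T → ℝ) (b : Fin n → ℝ) :
    1 / 4 * ((v ⬝ᵥ v) * (b ⬝ᵥ b)) ≤ lagForm W v b := by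
  have h1 := le_lagFormFinite hW hw1 v b
  have h2 := quad_le_of_le (show 1 ≤ lagCov W 0 by
    rw [lagCov_zero_eq hW hw1]
    exact le_add_of_nonneg_right (conj_nonneg (lagCov_zero_nonneg hW hw1) W)) (lagComb W v b)
  have h3 := dotProduct_self_nonneg (lagComb W v b)
  rw [Matrix.one_mulVec] at h2
  rw [lagFormFinite] at h1
  linarith

lemma lagForm_le (hW : ‖W‖ ≤ w) (hw0 : 0 < w) (hw1 : w < 1) {T : ℕ} (v : Fin T → ℝ)
    (b : Fin n → ℝ) : lagForm W v b ≤ (1 / (1 - w)) ^ 2 * ((v ⬝ᵥ v) * (b ⬝ᵥ b)) := by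
  have h1w : 0 < 1 - w := by linarith
  have h1 := lagFormFinite_le hW hw0 hw1 v b
  have h2 := dotProduct_mulVec_le_norm (lagCov W 0) (lagComb W v b)
  have h3 := dotProduct_self_nonneg (lagComb W v b)
  have h4 := mul_le_mul_of_nonneg_right (norm_lagCov_zero_le hW hw1) h3
  have h5 : 1 / (1 - w) = 1 + w / (1 - w) := by field_simp; ring
  rw [lagFormFinite] at h1
  rw [h5] at h4
  linarith

end LagCov

/-! ### The covariance maps as a transfer pair. -/

section Transfer

variable {n : ℕ} {W : Matrix (Fin n) (Fin n) ℝ} {w : ℝ}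

/-- `traceToeplitz` as a linear map. -/
noncomputable def toeplitzLin (T : ℕ) (W : Matrix (Fin n) (Fin n) ℝ) :
    Matrix (Fin n) (Fin n) ℝ →ₗ[ℝ] Matrix (Fin T) (Fin T) ℝ where
  toFun := traceToeplitz T W
  map_add' B C := by ext i j; simp [traceToeplitz, Matrix.mul_add]
  map_smul' c B := by ext i j; simp [traceToeplitz]

/-- The linear map `C ↦ ∑ i j, C i j S_{i-j}`. -/
noncomputable def lagSumLin (T : ℕ) (W : Matrix (Fin n) (Fin n) ℝ) :
    Matrix (Fin T) (Fin T) ℝ →ₗ[ℝ] Matrix (Fin n) (Fin n) ℝ where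
  toFun C := ∑ i, ∑ j, C i j • lagCov W ((i : ℤ) - (j : ℤ))
  map_add' B C := by simp [add_smul, Finset.sum_add_distrib]
  map_smul' c B := by simp [Finset.smul_sum, smul_smul]

/-- Grouping the entries of `C` by diagonals: each pair of indices contributes to exactly one `q`,
so the sum over `ℤ` is finite. -/
lemma shiftTraceSum_eq {T : ℕ} (W : Matrix (Fin n) (Fin n) ℝ) (C : Matrix (Fin T) (Fin T) ℝ) :
    shiftTraceSum W C = (1 / (T : ℝ)) • lagSumLin T W C := by
  have h : ∀ q : ℤ, ((1 / (T : ℝ)) * (shift T q * C).trace) • lagCov W q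
      = ∑ i : Fin T, ∑ j : Fin T, if q = (i : ℤ) - (j : ℤ) then
        ((1 / (T : ℝ)) * C i j) • lagCov W ((i : ℤ) - (j : ℤ)) else 0 := fun q => by
    rw [Matrix.trace, Finset.sum_comm]
    simp only [Matrix.diag_apply, Matrix.mul_apply, shift, Matrix.of_apply, Finset.mul_sum,
      Finset.sum_smul]
    refine Finset.sum_congr rfl fun i _ => Finset.sum_congr rfl fun j _ => ?_
    by_cases hq : q = (j : ℤ) - (i : ℤ)
    · rw [if_pos hq, if_pos (by omega), one_mul, ← hq]
    · rw [if_neg hq, if_neg (by omega), zero_mul, mul_zero, zero_smul]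
  rw [shiftTraceSum, tsum_congr h]
  have hs := hasSum_sum (s := Finset.univ) fun (i : Fin T) _ =>
    hasSum_sum (s := Finset.univ) fun (j : Fin T) _ =>
      hasSum_ite_eq ((i : ℤ) - (j : ℤ))
        (((1 / (T : ℝ)) * C i j) • lagCov W ((i : ℤ) - (j : ℤ)))
  rw [hs.tsum_eq]
  simp [lagSumLin, Finset.smul_sum, smul_smul]

lemma trace_transpose_mul_self {k : Type*} [Fintype k] (G : Matrix k k ℝ) :
    (Gᵀ * G).trace = ∑ l, G l ⬝ᵥ G l := by
  rw [Matrix.trace_mul_comm]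
  rfl

lemma dotProduct_mulVec_eq_sum {k : Type*} [Fintype k] (M : Matrix k k ℝ) (v : k → ℝ) :
    v ⬝ᵥ M *ᵥ v = ∑ i, ∑ j, v i * v j * M i j := by
  simp only [dotProduct, Matrix.mulVec, Finset.mul_sum]
  exact Finset.sum_congr rfl fun i _ => Finset.sum_congr rfl fun j _ => by ring

lemma toeplitzLin_quad {T : ℕ} (G : Matrix (Fin n) (Fin n) ℝ) (v : Fin T → ℝ) :
    v ⬝ᵥ toeplitzLin T W (Gᵀ * G) *ᵥ v = ∑ l, lagForm W v (G l) := by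
  have h : ∀ i j : Fin T, toeplitzLin T W (Gᵀ * G) i j
      = ∑ l, G l ⬝ᵥ lagCov W ((i : ℤ) - (j : ℤ)) *ᵥ G l := fun i j => by
    change (lagCov W ((i : ℤ) - (j : ℤ)) * (Gᵀ * G)).trace = _
    rw [← Matrix.mul_assoc, Matrix.trace_mul_comm]
    refine Finset.sum_congr rfl fun l _ => ?_
    rw [Matrix.diag_apply, Matrix.mul_apply, dotProduct]
    refine Finset.sum_congr rfl fun x _ => ?_
    rw [Matrix.mul_apply, Matrix.mulVec, dotProduct]
    simp only [Matrix.transpose_apply]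
  simp_rw [dotProduct_mulVec_eq_sum, h, lagForm, Finset.mul_sum]
  simp_rw [fun i : Fin T => Finset.sum_comm (s := (Finset.univ : Finset (Fin T)))
    (t := (Finset.univ : Finset (Fin n)))
    (f := fun j l => v i * v j * (G l ⬝ᵥ lagCov W ((i : ℤ) - (j : ℤ)) *ᵥ G l))]
  exact Finset.sum_comm

lemma lagSumLin_quad {T : ℕ} (G : Matrix (Fin T) (Fin T) ℝ) (b : Fin n → ℝ) :
    b ⬝ᵥ lagSumLin T W (Gᵀ * G) *ᵥ b = ∑ l, lagForm W (G l) b := by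
  have h : b ⬝ᵥ lagSumLin T W (Gᵀ * G) *ᵥ b
      = ∑ i, ∑ j, (Gᵀ * G) i j * (b ⬝ᵥ lagCov W ((i : ℤ) - (j : ℤ)) *ᵥ b) := by
    simp [lagSumLin, Matrix.sum_mulVec, dotProduct_sum, Matrix.smul_mulVec]
  simp_rw [h, lagForm, Matrix.mul_apply, Finset.sum_mul, Matrix.transpose_apply]
  simp_rw [fun i : Fin T => Finset.sum_comm (s := (Finset.univ : Finset (Fin T)))
    (t := (Finset.univ : Finset (Fin T)))
    (f := fun j l => G l i * G l j * (b ⬝ᵥ lagCov W ((i : ℤ) - (j : ℤ)) *ᵥ b))]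
  exact Finset.sum_comm

lemma toeplitzLin_isHermitian (hW : ‖W‖ ≤ w) (hw1 : w < 1) {T : ℕ}
    {B : Matrix (Fin n) (Fin n) ℝ} (hB : Bᵀ = B) : (toeplitzLin T W B).IsHermitian := by
  ext i j
  change (lagCov W ((j : ℤ) - (i : ℤ)) * B).trace = (lagCov W ((i : ℤ) - (j : ℤ)) * B).trace
  rw [← Matrix.trace_transpose, Matrix.transpose_mul, hB, lagCov_transpose hW hw1, neg_sub,
    Matrix.trace_mul_comm]

lemma lagSumLin_isHermitian (hW : ‖W‖ ≤ w) (hw1 : w < 1) {T : ℕ}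
    {C : Matrix (Fin T) (Fin T) ℝ} (hC : Cᵀ = C) : (lagSumLin T W C).IsHermitian := by
  rw [Matrix.IsHermitian, Matrix.conjTranspose_eq_transpose_of_trivial]
  simp only [lagSumLin, LinearMap.coe_mk, AddHom.coe_mk, Matrix.transpose_sum,
    Matrix.transpose_smul, lagCov_transpose hW hw1, neg_sub]
  rw [Finset.sum_comm]
  refine Finset.sum_congr rfl fun i _ => Finset.sum_congr rfl fun j _ => ?_
  rw [show C j i = C i j from congrFun (congrFun hC i) j]

/-- The trace pairs entry `(i, j)` with `C j i`, while `lagSumLin` weights `S_{i-j}` by `C i j`;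
symmetry of `C` reconciles the two. -/
lemma toeplitzLin_adjoint {T : ℕ} (B : Matrix (Fin n) (Fin n) ℝ) {C : Matrix (Fin T) (Fin T) ℝ}
    (hC : Cᵀ = C) : (toeplitzLin T W B * C).trace = (lagSumLin T W C * B).trace := by
  have h1 : (lagSumLin T W C * B).trace
      = ∑ i, ∑ j, C i j * (lagCov W ((i : ℤ) - (j : ℤ)) * B).trace := by
    simp [lagSumLin, Matrix.sum_mul, Matrix.trace_sum]
  rw [h1, Matrix.trace]
  refine Finset.sum_congr rfl fun i _ => ?_
  rw [Matrix.diag_apply, Matrix.mul_apply]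
  refine Finset.sum_congr rfl fun j _ => ?_
  rw [mul_comm, show C j i = C i j from congrFun (congrFun hC i) j]
  rfl

/-- The two covariance maps form a transfer pair. -/
theorem transferPair (hW : ‖W‖ ≤ w) (hw0 : 0 < w) (hw1 : w < 1) (T : ℕ) :
    TransferPair (toeplitzLin T W) (lagSumLin T W) (1 / 4) ((1 / (1 - w)) ^ 2) := by
  have h1w : 0 < 1 - w := by linarith
  have hh : ∀ {k : ℕ} (c : ℝ), (c • (1 : Matrix (Fin k) (Fin k) ℝ)).IsHermitian := fun c => by
    simp [Matrix.IsHermitian]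
  -- Writing the argument as `Gᵀ G` turns both maps into sums of `lagForm` over the rows of `G`, so
  -- the scalar bounds apply row by row.
  have hsq : ∀ {k : ℕ} {B : Matrix (Fin k) (Fin k) ℝ}, 0 ≤ B → ∃ G, B = Gᵀ * G := fun hB => by
    obtain ⟨G, rfl⟩ := CStarAlgebra.nonneg_iff_eq_star_mul_self.1 hB
    exact ⟨G, by rw [Matrix.star_eq_conjTranspose, Matrix.conjTranspose_eq_transpose_of_trivial]⟩
  refine ⟨by norm_num, by positivity, fun B hB => ?_, fun B hB => ?_, fun C hC => ?_,
    fun C hC => ?_, fun B C _ hC => toeplitzLin_adjoint B (transpose_eq_of_nonneg hC)⟩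
  · have hs := toeplitzLin_isHermitian hW hw1 (T := T) (transpose_eq_of_nonneg hB)
    obtain ⟨G, rfl⟩ := hsq hB
    refine le_of_quad_le (hh _) hs fun v => ?_
    rw [toeplitzLin_quad, trace_transpose_mul_self, Matrix.smul_mulVec, Matrix.one_mulVec,
      dotProduct_smul, smul_eq_mul, mul_assoc, Finset.sum_mul, Finset.mul_sum]
    exact Finset.sum_le_sum fun l _ => by
      rw [mul_comm (G l ⬝ᵥ G l)]; exact le_lagForm hW hw1 v (G l)
  · have hs := toeplitzLin_isHermitian hW hw1 (T := T) (transpose_eq_of_nonneg hB)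
    obtain ⟨G, rfl⟩ := hsq hB
    refine le_of_quad_le hs (hh _) fun v => ?_
    rw [toeplitzLin_quad, trace_transpose_mul_self, Matrix.smul_mulVec, Matrix.one_mulVec,
      dotProduct_smul, smul_eq_mul, mul_assoc, Finset.sum_mul, Finset.mul_sum]
    exact Finset.sum_le_sum fun l _ => by
      rw [mul_comm (G l ⬝ᵥ G l)]; exact lagForm_le hW hw0 hw1 v (G l)
  · have hs := lagSumLin_isHermitian hW hw1 (transpose_eq_of_nonneg hC)
    obtain ⟨G, rfl⟩ := hsq hC
    refine le_of_quad_le (hh _) hs fun b => ?_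
    rw [lagSumLin_quad, trace_transpose_mul_self, Matrix.smul_mulVec, Matrix.one_mulVec,
      dotProduct_smul, smul_eq_mul, mul_assoc, Finset.sum_mul, Finset.mul_sum]
    exact Finset.sum_le_sum fun l _ => le_lagForm hW hw1 (G l) b
  · have hs := lagSumLin_isHermitian hW hw1 (transpose_eq_of_nonneg hC)
    obtain ⟨G, rfl⟩ := hsq hC
    refine le_of_quad_le hs (hh _) fun b => ?_
    rw [lagSumLin_quad, trace_transpose_mul_self, Matrix.smul_mulVec, Matrix.one_mulVec,
      dotProduct_smul, smul_eq_mul, mul_assoc, Finset.sum_mul, Finset.mul_sum]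
    exact Finset.sum_le_sum fun l _ => lagForm_le hW hw0 hw1 (G l) b

end Transfer

/-! ### Calculus of small `γ` limits. -/

section SmallGamma

variable {d : ℕ → ℕ} {F G : (n : ℕ) → ℝ → Matrix (Fin (d n)) (Fin (d n)) ℝ}
  {L L' : (n : ℕ) → Matrix (Fin (d n)) (Fin (d n)) ℝ}

lemma SmallGammaLimit.congr (h : SmallGammaLimit F L) (hF : ∀ n, ∀ γ > 0, F n γ = G n γ)
    (hL : ∀ᶠ n in atTop, L n = L' n) : SmallGammaLimit G L' := by
  refine ⟨h.1.mono fun n ⟨l, hl⟩ => ⟨l, hl.congr' ?_⟩, fun ε hε => ?_⟩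
  · filter_upwards [self_mem_nhdsWithin] with γ hγ using hF n γ hγ
  · obtain ⟨N, γ₀, hγ₀, hN⟩ := h.2 ε hε
    obtain ⟨N', hN'⟩ := eventually_atTop.1 hL
    refine ⟨max N N', γ₀, hγ₀, fun n hn γ h0 h1 => ?_⟩
    rw [← hF n γ h0, ← hN' n (le_of_max_le_right hn)]
    exact hN n (le_of_max_le_left hn) γ h0 h1

lemma SmallGammaLimit.sub (hF : SmallGammaLimit F L) (hG : SmallGammaLimit G L') :
    SmallGammaLimit (fun n γ => F n γ - G n γ) (fun n => L n - L' n) := by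
  refine ⟨?_, fun ε hε => ?_⟩
  · filter_upwards [hF.1, hG.1] with n ⟨l, hl⟩ ⟨l', hl'⟩ using ⟨l - l', hl.sub hl'⟩
  · obtain ⟨N, γ₀, hγ₀, hN⟩ := hF.2 (ε / 2) (by positivity)
    obtain ⟨N', γ₁, hγ₁, hN'⟩ := hG.2 (ε / 2) (by positivity)
    refine ⟨max N N', min γ₀ γ₁, lt_min hγ₀ hγ₁, fun n hn γ h0 h1 => ?_⟩
    have e1 := hN n (le_of_max_le_left hn) γ h0 (h1.trans_le (min_le_left _ _))
    have e2 := hN' n (le_of_max_le_right hn) γ h0 (h1.trans_le (min_le_right _ _))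
    rw [sub_sub_sub_comm]
    exact (norm_sub_le _ _).trans_lt (by linarith)

lemma smallGammaLimit_const (L : (n : ℕ) → Matrix (Fin (d n)) (Fin (d n)) ℝ) :
    SmallGammaLimit (fun n _ => L n) L :=
  ⟨Eventually.of_forall fun n => ⟨L n, tendsto_const_nhds⟩,
    fun ε hε => ⟨0, 1, one_pos, fun n _ γ _ _ => by simpa using hε⟩⟩

lemma smallGammaLimit_div_smul_one {h : ℝ} (hh : 0 < h) :
    SmallGammaLimit (fun n γ => (γ / h) • (1 : Matrix (Fin (d n)) (Fin (d n)) ℝ)) (fun _ => 0) := by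
  refine ⟨Eventually.of_forall fun n => ⟨0, ?_⟩, fun ε hε => ⟨0, ε * h, by positivity, ?_⟩⟩
  · have hc : Continuous fun γ : ℝ => (γ / h) • (1 : Matrix (Fin (d n)) (Fin (d n)) ℝ) := by
      fun_prop
    have := (hc.tendsto 0).mono_left (nhdsWithin_le_nhds (s := Set.Ioi 0))
    simpa using this
  · intro n _ γ h0 h1
    rw [sub_zero, norm_smul, Real.norm_of_nonneg (by positivity)]
    calc γ / h * ‖(1 : Matrix (Fin (d n)) (Fin (d n)) ℝ)‖ ≤ γ / h * 1 := by
          gcongr; exact norm_one_le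
      _ < ε := by rw [mul_one, div_lt_iff₀ hh]; exact h1

lemma exists_tendsto_of_norm_sub_le {k : ℕ} {f : ℝ → Matrix (Fin k) (Fin k) ℝ} {C g : ℝ}
    (hg : 0 < g) (h : ∀ γ₁ γ₂, 0 < γ₁ → γ₁ ≤ g → 0 < γ₂ → γ₂ ≤ g →
      ‖f γ₁ - f γ₂‖ ≤ C * max γ₁ γ₂) : ∃ l, Tendsto f (𝓝[>] 0) (𝓝 l) := by
  refine cauchy_map_iff_exists_tendsto.1 ?_
  rw [Metric.cauchy_iff]
  refine ⟨inferInstance, fun ε hε => ?_⟩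
  have hr : 0 < min g (ε / (|C| + 1)) := lt_min hg (by positivity)
  refine ⟨f '' Set.Ioo 0 (min g (ε / (|C| + 1))), image_mem_map (Ioo_mem_nhdsGT hr), ?_⟩
  rintro _ ⟨x, ⟨hx0, hx1⟩, rfl⟩ _ ⟨y, ⟨hy0, hy1⟩, rfl⟩
  rw [lt_min_iff] at hx1 hy1
  rw [dist_eq_norm]
  have h1 := h x y hx0 hx1.1.le hy0 hy1.1.le
  have h2 : max x y < ε / (|C| + 1) := max_lt hx1.2 hy1.2
  have h3 : 0 < max x y := lt_max_of_lt_left hx0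
  rw [lt_div_iff₀ (by positivity)] at h2
  have h4 : C * max x y ≤ |C| * max x y := mul_le_mul_of_nonneg_right (le_abs_self C) h3.le
  linarith

/-- A criterion for the small `γ` limit in terms of the order. -/
lemma smallGammaLimit_of_mutualLE {B C g : ℝ} (hB : 0 ≤ B) (hg : 0 < g)
    (hF : ∀ᶠ n in atTop, ∀ γ, 0 < γ → γ ≤ g → F n γ ≤ B • (1 : Matrix (Fin (d n)) (Fin (d n)) ℝ))
    (hL : ∀ᶠ n in atTop, L n ≤ B • (1 : Matrix (Fin (d n)) (Fin (d n)) ℝ))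
    (hFF : ∀ᶠ n in atTop, ∀ γ₁ γ₂, 0 < γ₁ → γ₁ ≤ g → 0 < γ₂ → γ₂ ≤ g →
      ∃ c, 1 ≤ c ∧ c - 1 ≤ C * max γ₁ γ₂ ∧ MutualLE c (F n γ₁) (F n γ₂))
    (hFL : ∀ ε > 0, ∃ γ₀ > 0, ∀ᶠ n in atTop, ∀ γ, 0 < γ → γ < γ₀ →
      ∃ c, 1 ≤ c ∧ c - 1 ≤ ε ∧ MutualLE c (F n γ) (L n)) : SmallGammaLimit F L := by
  refine ⟨?_, fun ε hε => ?_⟩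
  · filter_upwards [hF, hFF] with n h1 h2
    refine exists_tendsto_of_norm_sub_le (C := C * B) hg fun γ₁ γ₂ a1 b1 a2 b2 => ?_
    obtain ⟨c, hc1, hc, hcF⟩ := h2 γ₁ γ₂ a1 b1 a2 b2
    refine (hcF.norm_sub_le hc1 hB (h1 _ a1 b1) (h1 _ a2 b2)).trans ?_
    rw [mul_right_comm]
    gcongr
  · obtain ⟨γ₀, hγ₀, h⟩ := hFL (ε / (2 * (B + 1))) (by positivity)
    obtain ⟨N, hN⟩ := eventually_atTop.1 (hF.and (hL.and h))
    refine ⟨N, min γ₀ g, lt_min hγ₀ hg, fun n hn γ h0 h1 => ?_⟩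
    rw [lt_min_iff] at h1
    obtain ⟨e1, e2, e3⟩ := hN n hn
    obtain ⟨c, hc1, hc, hcF⟩ := e3 γ h0 h1.1
    refine (hcF.norm_sub_le hc1 hB (e1 γ h0 h1.2.le) e2).trans_lt ?_
    calc (c - 1) * B ≤ ε / (2 * (B + 1)) * (B + 1) := by gcongr; linarith
      _ = ε / 2 := by field_simp
      _ < ε := by linarith

end SmallGamma

/-- The asymptotic regime: uniformly nondegenerate systems indexed by `n`, with normalization
`s n`, together with normalizations `s₁ n`, `s₂ n` asymptotically equivalent to it, and with a
data matrix that is asymptotically negligible in normalized trace. -/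
structure Regime {d e : ℕ → ℕ}
    (Φ : (n : ℕ) → Matrix (Fin (e n)) (Fin (e n)) ℝ →ₗ[ℝ] Matrix (Fin (d n)) (Fin (d n)) ℝ)
    (Φ' : (n : ℕ) → Matrix (Fin (d n)) (Fin (d n)) ℝ →ₗ[ℝ] Matrix (Fin (e n)) (Fin (e n)) ℝ)
    (A : (n : ℕ) → Matrix (Fin (e n)) (Fin (d n)) ℝ) (s s₁ s₂ : ℕ → ℝ) (κ₁ κ₂ σ S K : ℝ) :
    Prop where
  pair : ∀ n, TransferPair (Φ n) (Φ' n) κ₁ κ₂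
  s_nonneg : ∀ n, 0 ≤ s n
  s₁_nonneg : ∀ n, 0 ≤ s₁ n
  s₂_nonneg : ∀ n, 0 ≤ s₂ n
  σ_pos : 0 < σ
  norm_le : ∀ n, ‖A n‖ ^ 2 ≤ K
  size : ∀ᶠ n in atTop, σ ≤ s n * ((d n : ℝ) - e n) ∧ s n * e n ≤ S ∧ s n * d n ≤ S
  size_free : ∀ᶠ n in atTop, ∃ ρ : ℝ, 1 ≤ ρ ∧ s₁ n ≤ ρ * s₂ n ∧
    σ ≤ s₂ n * ((d n : ℝ) - ρ * e n) ∧ s₁ n * e n ≤ S ∧ s₂ n * d n ≤ S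
  discrepancy : Tendsto (fun n => |s n - s₁ n| * e n + |s n - s₂ n| * d n) atTop (𝓝 0)
  trace : ∀ ε > 0, ∀ᶠ n in atTop, ∃ t, 0 ≤ t ∧ TraceBound (A n) t ∧ s n * t ≤ ε

/-! ### Existence and convergence in the asymptotic regime. -/

namespace Regime

variable {d e : ℕ → ℕ}
  {Φ : (n : ℕ) → Matrix (Fin (e n)) (Fin (e n)) ℝ →ₗ[ℝ] Matrix (Fin (d n)) (Fin (d n)) ℝ}
  {Φ' : (n : ℕ) → Matrix (Fin (d n)) (Fin (d n)) ℝ →ₗ[ℝ] Matrix (Fin (e n)) (Fin (e n)) ℝ}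
  {A : (n : ℕ) → Matrix (Fin (e n)) (Fin (d n)) ℝ} {s s₁ s₂ : ℕ → ℝ} {κ₁ κ₂ σ S K : ℝ}

lemma exists_free (h : Regime Φ Φ' A s s₁ s₂ κ₁ κ₂ σ S K) :
    ∀ᶠ n in atTop, ∃ X Y, ExactSol (Φ n) (Φ' n) (s₁ n) (s₂ n) 0 0 X Y := by
  filter_upwards [h.size_free] with n ⟨ρ, hρ, hsρ, hσs, hS₁, hS₂⟩
  exact exists_exactSol_zero (h.pair n) hρ hsρ (h.s₁_nonneg n) (h.s₂_nonneg n) h.σ_pos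
    (by simpa using hσs) (by simpa using hS₁) (by simpa using hS₂)

variable {η : ℝ} {Xγ : (n : ℕ) → ℝ → Matrix (Fin (d n)) (Fin (d n)) ℝ}
  {Yγ : (n : ℕ) → ℝ → Matrix (Fin (e n)) (Fin (e n)) ℝ}
  {X : (n : ℕ) → Matrix (Fin (d n)) (Fin (d n)) ℝ}
  {Y : (n : ℕ) → Matrix (Fin (e n)) (Fin (e n)) ℝ}

/-- The small `γ` limits of the solutions and of the associated resolvents. -/
theorem smallGammaLimit (h : Regime Φ Φ' A s s₁ s₂ κ₁ κ₂ σ S K) (hη : 0 < η)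
    (hγ : ∀ n, ∀ γ > 0,
      ExactSol (Φ n) (Φ' n) (s n) (s n) (A n) (γ / η ^ 2) (Xγ n γ) (Yγ n γ))
    (hfree : ∀ᶠ n in atTop, ExactSol (Φ n) (Φ' n) (s₁ n) (s₂ n) 0 0 (X n) (Y n)) :
    SmallGammaLimit Xγ X ∧ SmallGammaLimit Yγ Y ∧
    SmallGammaLimit (fun n γ => schurInv (A n) (Yγ n γ) (Xγ n γ))
      (fun n => schurInv (A n) (Y n) (X n)) ∧
    SmallGammaLimit (fun n γ => schurInv (A n)ᵀ (Xγ n γ) (Yγ n γ))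
      (fun n => schurInv (A n)ᵀ (X n) (Y n)) := by
  have hκ₁ := (h.pair 0).pos₁
  have hκ₂ := (h.pair 0).pos₂
  have hσ := h.σ_pos
  have hK : 0 ≤ K := (sq_nonneg _).trans (h.norm_le 0)
  have hη2 : 0 < η ^ 2 := by positivity
  have hS0 : 0 ≤ S := by
    obtain ⟨n, hn⟩ := h.size.exists
    exact le_trans (mul_nonneg (h.s_nonneg n) (Nat.cast_nonneg _)) hn.2.1
  set y := min 1 (κ₁ * σ) with hy
  have hy0 : 0 < y := lt_min one_pos (by positivity)
  have hy1 : y ≤ 1 := min_le_left _ _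
  set M := 1 + κ₂ * S / y with hM
  have hM1 : 1 ≤ M := by
    have : 0 ≤ κ₂ * S / y := by positivity
    linarith
  have hM0 : 0 ≤ M := by linarith
  have hBγ : ∀ᶠ n in atTop, ∀ γ, 0 < γ → γ ≤ η ^ 2 → Bounds y M (Xγ n γ) (Yγ n γ) := by
    filter_upwards [h.size] with n ⟨hσs, hS₁, hS₂⟩ γ h0 h1
    exact (hγ n γ h0).bounds (h.pair n) le_rfl (by simp) (h.s_nonneg n) (h.s_nonneg n)
      (by positivity) (by rwa [div_le_one hη2]) hσ (by simpa using hσs) (by simpa using hS₁)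
      (by simpa using hS₂)
  have hBfree : ∀ᶠ n in atTop, Bounds y M (X n) (Y n) := by
    filter_upwards [h.size_free, hfree] with n ⟨ρ, hρ, hsρ, hσs, hS₁, hS₂⟩ hn
    exact hn.bounds (h.pair n) hρ hsρ (h.s₁_nonneg n) (h.s₂_nonneg n) le_rfl zero_le_one hσ
      (by simpa using hσs) (by simpa using hS₁) (by simpa using hS₂)
  -- Two values of `γ` at the same `n`: stability of the system that still contains the data matrix,
  -- linear in `γ`. This gives the limit for fixed `n`.
  have hFF : ∀ᶠ n in atTop, ∀ γ₁ γ₂, 0 < γ₁ → γ₁ ≤ η ^ 2 → 0 < γ₂ → γ₂ ≤ η ^ 2 →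
      ∃ c, 1 ≤ c ∧ c - 1 ≤ stabConst y M K / η ^ 2 * max γ₁ γ₂ ∧
        MutualLE c (Xγ n γ₁) (Xγ n γ₂) ∧ MutualLE c (Yγ n γ₁) (Yγ n γ₂) := by
    filter_upwards [hBγ] with n hB γ₁ γ₂ a1 b1 a2 b2
    obtain ⟨c, hc1, hc, hcX, hcY⟩ := (hγ n γ₁ a1).exists_mutualLE (δ := max γ₁ γ₂ / η ^ 2)
      (h.pair n) (h.s_nonneg n) (h.s_nonneg n) hy0 hy1 hM1 (h.norm_le n)
      (by positivity) (by positivity) (div_pos (lt_max_of_lt_left a1) hη2)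
      (by gcongr; exact le_max_left _ _) (by gcongr; exact le_max_right _ _)
      (hB γ₁ a1 b1) (hB γ₂ a2 b2) (hγ n γ₂ a2)
    exact ⟨c, hc1, hc.trans_eq (by ring), hcX, hcY⟩
  -- Comparison with the `γ`-free solution: stability of the system with `A = 0`, hence the constant
  -- `stabConst y M 0`.
  have hFL : ∀ ε > 0, ∃ γ₀ > 0, ∀ᶠ n in atTop, ∀ γ, 0 < γ → γ < γ₀ →
      ∃ c, 1 ≤ c ∧ c - 1 ≤ ε ∧ MutualLE c (Xγ n γ) (X n) ∧ MutualLE c (Yγ n γ) (Y n) := by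
    intro ε hε
    have hC := stabConst_pos hy0 hM1 (le_refl (0 : ℝ))
    set δ := ε / stabConst y M 0 with hδ
    have hδ0 : 0 < δ := by positivity
    -- The error `δ` is shared equally between `b = γ/η²`, the change of normalization and the
    -- removal of `A`. The bound `γ ≤ η²` ensures `b ≤ 1`, as the a priori bounds require.
    refine ⟨min (η ^ 2) (η ^ 2 * (δ / 3)), by positivity, ?_⟩
    have hdisc := h.discrepancy.eventually_le_const
      (show (0 : ℝ) < δ * y / (3 * κ₂) by positivity)
    filter_upwards [hBγ, hBfree, hfree, hdisc,
      h.trace (δ * y ^ 2 / (3 * κ₂ * (K + 1))) (by positivity)]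
      with n hB hB' hn hd ⟨t, ht0, htA, hts⟩ γ h0 h1
    rw [lt_min_iff] at h1
    have hA1 : ‖A n‖ ≤ K + 1 := by nlinarith [h.norm_le n, sq_nonneg (‖A n‖ - 1)]
    have hBn := hB γ h0 h1.1.le
    have hs := h.s_nonneg n
    have happ : ApproxSol (Φ n) (Φ' n) (s₁ n) (s₂ n) 0 δ (Xγ n γ) (Yγ n γ) := by
      refine (hγ n γ h0).approxSol_zero (h.pair n) hs (by positivity) hy0 hy1 ht0 htA hBn ?_
      have q1 : γ / η ^ 2 ≤ δ / 3 := by rw [div_le_iff₀ hη2]; linarith [h1.2]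
      have q2 : κ₂ * ((|s n - s₁ n| * e n + |s n - s₂ n| * d n) / y) ≤ δ / 3 := by
        calc κ₂ * ((|s n - s₁ n| * e n + |s n - s₂ n| * d n) / y)
            ≤ κ₂ * (δ * y / (3 * κ₂) / y) := by gcongr
          _ = δ / 3 := by field_simp
      have q3 : κ₂ * (s n * (t * ‖A n‖ / y ^ 2)) ≤ δ / 3 := by
        calc κ₂ * (s n * (t * ‖A n‖ / y ^ 2)) = κ₂ * (s n * t * ‖A n‖ / y ^ 2) := by ring
          _ ≤ κ₂ * (δ * y ^ 2 / (3 * κ₂ * (K + 1)) * (K + 1) / y ^ 2) := by gcongr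
          _ = δ / 3 := by field_simp
      simp only [Fintype.card_fin]
      have q4 : κ₂ * (|s n - s₁ n| * e n / y + |s n - s₂ n| * d n / y + s n * (t * ‖A n‖ / y ^ 2))
          = κ₂ * ((|s n - s₁ n| * e n + |s n - s₂ n| * d n) / y)
            + κ₂ * (s n * (t * ‖A n‖ / y ^ 2)) := by ring
      rw [q4]
      linarith
    obtain ⟨c, hc1, hc, hcX, hcY⟩ := exists_mutualLE (K := 0) (h.pair n) (h.s₁_nonneg n)
      (h.s₂_nonneg n) hy0 hy1 hM1 hδ0 (by simp) hBn hB' happ (hn.approxSol le_rfl hδ0.le)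
    exact ⟨c, hc1, hc.trans_eq (by rw [hδ]; field_simp), hcX, hcY⟩
  have hQle : ∀ {m k : ℕ} (B : Matrix (Fin m) (Fin k) ℝ) {Y : Matrix (Fin m) (Fin m) ℝ}
      {X : Matrix (Fin k) (Fin k) ℝ} {z : ℝ}, 0 < z → z • (1 : Matrix (Fin m) (Fin m) ℝ) ≤ Y →
      X.PosDef → schurInv B Y X ≤ z⁻¹ • (1 : Matrix (Fin m) (Fin m) ℝ) := fun B _ _ _ hz hY hX =>
    (schurInv_le_inv B (posDef_of_smul_one_le hz hY) hX).trans (inv_le_smul_one hz hY)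
  have hone : ∀ {n : ℕ} {Z : Matrix (Fin (d n)) (Fin (d n)) ℝ}, 1 ≤ Z →
      (1 : ℝ) • (1 : Matrix (Fin (d n)) (Fin (d n)) ℝ) ≤ Z := fun hZ => by simpa using hZ
  refine ⟨?_, ?_, ?_, ?_⟩
  · refine smallGammaLimit_of_mutualLE (C := stabConst y M K / η ^ 2) hM0 hη2
      (hBγ.mono fun n hn γ h0 h1 => (hn γ h0 h1).le_left) (hBfree.mono fun n hn => hn.le_left)
      (hFF.mono fun n hn γ₁ γ₂ a1 b1 a2 b2 => ?_) fun ε hε => ?_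
    · obtain ⟨c, hc1, hc, hcX, -⟩ := hn γ₁ γ₂ a1 b1 a2 b2
      exact ⟨c, hc1, hc, hcX⟩
    · obtain ⟨γ₀, hγ₀, hn⟩ := hFL ε hε
      refine ⟨γ₀, hγ₀, hn.mono fun n hn γ h0 h1 => ?_⟩
      obtain ⟨c, hc1, hc, hcX, -⟩ := hn γ h0 h1
      exact ⟨c, hc1, hc, hcX⟩
  · refine smallGammaLimit_of_mutualLE (C := stabConst y M K / η ^ 2) hM0 hη2
      (hBγ.mono fun n hn γ h0 h1 => (hn γ h0 h1).le_right) (hBfree.mono fun n hn => hn.le_right)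
      (hFF.mono fun n hn γ₁ γ₂ a1 b1 a2 b2 => ?_) fun ε hε => ?_
    · obtain ⟨c, hc1, hc, -, hcY⟩ := hn γ₁ γ₂ a1 b1 a2 b2
      exact ⟨c, hc1, hc, hcY⟩
    · obtain ⟨γ₀, hγ₀, hn⟩ := hFL ε hε
      refine ⟨γ₀, hγ₀, hn.mono fun n hn γ h0 h1 => ?_⟩
      obtain ⟨c, hc1, hc, -, hcY⟩ := hn γ h0 h1
      exact ⟨c, hc1, hc, hcY⟩
  · refine smallGammaLimit_of_mutualLE (C := stabConst y M K / η ^ 2) (inv_nonneg.2 hy0.le) hη2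
      (hBγ.mono fun n hn γ h0 h1 => hQle _ hy0 (hn γ h0 h1).smul_le (hn γ h0 h1).posDef_left)
      (hBfree.mono fun n hn => hQle _ hy0 hn.smul_le hn.posDef_left)
      ((hFF.and hBγ).mono fun n hn γ₁ γ₂ a1 b1 a2 b2 => ?_) fun ε hε => ?_
    · obtain ⟨c, hc1, hc, hcX, hcY⟩ := hn.1 γ₁ γ₂ a1 b1 a2 b2
      have hB₁ := hn.2 γ₁ a1 b1
      have hB₂ := hn.2 γ₂ a2 b2
      exact ⟨c, hc1, hc, MutualLE.schurInv (A n) (by linarith) (hB₁.posDef_right hy0)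
        (hB₂.posDef_right hy0) hB₁.posDef_left hB₂.posDef_left hcY hcX⟩
    · obtain ⟨γ₀, hγ₀, hn⟩ := hFL ε hε
      refine ⟨γ₀, hγ₀, (hn.and hfree).mono fun n hn γ h0 h1 => ?_⟩
      obtain ⟨c, hc1, hc, hcX, hcY⟩ := hn.1 γ h0 h1
      have hs := hγ n γ h0
      exact ⟨c, hc1, hc, MutualLE.schurInv (A n) (by linarith) hs.posDef_right
        hn.2.posDef_right hs.posDef_left hn.2.posDef_left hcY hcX⟩
  · refine smallGammaLimit_of_mutualLE (C := stabConst y M K / η ^ 2)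
      (inv_nonneg.2 (zero_le_one (α := ℝ))) hη2
      (hBγ.mono fun n hn γ h0 h1 => hQle _ one_pos (hone (hn γ h0 h1).one_le)
        ((hn γ h0 h1).posDef_right hy0))
      (hBfree.mono fun n hn => hQle _ one_pos (hone hn.one_le) (hn.posDef_right hy0))
      ((hFF.and hBγ).mono fun n hn γ₁ γ₂ a1 b1 a2 b2 => ?_) fun ε hε => ?_
    · obtain ⟨c, hc1, hc, hcX, hcY⟩ := hn.1 γ₁ γ₂ a1 b1 a2 b2
      have hB₁ := hn.2 γ₁ a1 b1
      have hB₂ := hn.2 γ₂ a2 b2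
      exact ⟨c, hc1, hc, MutualLE.schurInv (A n)ᵀ (by linarith) hB₁.posDef_left hB₂.posDef_left
        (hB₁.posDef_right hy0) (hB₂.posDef_right hy0) hcX hcY⟩
    · obtain ⟨γ₀, hγ₀, hn⟩ := hFL ε hε
      refine ⟨γ₀, hγ₀, (hn.and hfree).mono fun n hn γ h0 h1 => ?_⟩
      obtain ⟨c, hc1, hc, hcX, hcY⟩ := hn.1 γ h0 h1
      have hs := hγ n γ h0
      exact ⟨c, hc1, hc, MutualLE.schurInv (A n)ᵀ (by linarith) hs.posDef_left
        hn.2.posDef_left hs.posDef_right hn.2.posDef_right hcX hcY⟩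

end Regime

/-! ### Change of variables from the original systems. -/

section Bridge

variable {n T : ℕ} {W : Matrix (Fin n) (Fin n) ℝ} {A : Matrix (Fin n) (Fin T) ℝ} {η γ : ℝ}

lemma Qbar'_eq_Qbar_transpose (A : Matrix (Fin n) (Fin T) ℝ) (η γ : ℝ)
    (R : Matrix (Fin T) (Fin T) ℝ) (R' : Matrix (Fin n) (Fin n) ℝ) :
    Qbar' A η γ R R' = Qbar Aᵀ η γ R' R := by
  simp [Qbar, Qbar']

/-- The factor `γ/η²` is taken out of the inverse, which moves the singular `1/γ` from the data term
into the variable `Y = γ/η² + γ R̃` and leaves a data term free of `γ`. -/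
lemma smul_Qbar (hη : 0 < η) (hγ : 0 < γ) (A : Matrix (Fin n) (Fin T) ℝ)
    (R : Matrix (Fin T) (Fin T) ℝ) (R' : Matrix (Fin n) (Fin n) ℝ) :
    η ^ 2 • Qbar A η γ R R' =
      schurInv (η⁻¹ • A) ((γ / η ^ 2) • (1 : Matrix (Fin n) (Fin n) ℝ) + γ • R')
        (1 + η ^ 2 • R) := by
  have h1 : ((γ / η ^ 2) • (1 : Matrix (Fin n) (Fin n) ℝ) + γ • R')
      + (η⁻¹ • A) * (1 + η ^ 2 • R)⁻¹ * (η⁻¹ • A)ᵀ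
      = (γ / η ^ 2) • (1 + η ^ 2 • R' + (1 / γ) • (A * (1 + η ^ 2 • R)⁻¹ * Aᵀ)) := by
    have a1 : γ / η ^ 2 * η ^ 2 = γ := by field_simp
    have a2 : γ / η ^ 2 * (1 / γ) = η⁻¹ * η⁻¹ := by field_simp
    simp only [Matrix.transpose_smul, Matrix.smul_mul, Matrix.mul_smul, smul_add, smul_smul, a1, a2]
  rw [schurInv, h1, inv_smul_eq (by positivity), Qbar, smul_smul]
  congr 1
  field_simp

lemma smul_Qbar' (hη : 0 < η) (hγ : 0 < γ) (A : Matrix (Fin n) (Fin T) ℝ)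
    (R : Matrix (Fin T) (Fin T) ℝ) (R' : Matrix (Fin n) (Fin n) ℝ) :
    γ • Qbar' A η γ R R' =
      schurInv (η⁻¹ • A)ᵀ (1 + η ^ 2 • R)
        ((γ / η ^ 2) • (1 : Matrix (Fin n) (Fin n) ℝ) + γ • R') := by
  have h0 : (γ / η ^ 2) • (1 : Matrix (Fin n) (Fin n) ℝ) + γ • R'
      = (γ / η ^ 2) • (1 + η ^ 2 • R') := by
    rw [smul_add, smul_smul]
    congr 2
    field_simp
  have h1 : (1 + η ^ 2 • R) + (η⁻¹ • A)ᵀ * ((γ / η ^ 2) • (1 + η ^ 2 • R'))⁻¹ * (η⁻¹ • A)ᵀᵀ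
      = 1 + η ^ 2 • R + (1 / γ) • (Aᵀ * (1 + η ^ 2 • R')⁻¹ * A) := by
    rw [inv_smul_eq (by positivity)]
    simp only [Matrix.transpose_smul, Matrix.smul_mul, Matrix.mul_smul, smul_smul,
      Matrix.transpose_transpose]
    congr 2
    field_simp
  rw [h0, schurInv, h1, Qbar', smul_smul, mul_one_div_cancel hγ.ne', one_smul]

lemma posDef_one_add_smul {k : ℕ} {R : Matrix (Fin k) (Fin k) ℝ} (hR : R.PosSemidef) {a b : ℝ}
    (ha : 0 < a) (hb : 0 ≤ b) : (a • (1 : Matrix (Fin k) (Fin k) ℝ) + b • R).PosDef :=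
  (Matrix.PosDef.one.smul ha).add_posSemidef (hR.smul hb)

lemma IsDetEquiv.exactSol (hη : 0 < η) (hγ : 0 < γ) {R : Matrix (Fin T) (Fin T) ℝ}
    {R' : Matrix (Fin n) (Fin n) ℝ} (h : IsDetEquiv W A η γ R R') :
    ExactSol (toeplitzLin T W) (lagSumLin T W) (1 / (T : ℝ)) (1 / (T : ℝ)) (η⁻¹ • A) (γ / η ^ 2)
      (1 + η ^ 2 • R) ((γ / η ^ 2) • (1 : Matrix (Fin n) (Fin n) ℝ) + γ • R') := by
  refine ⟨by simpa using posDef_one_add_smul h.posSemidef one_pos (sq_nonneg η),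
    posDef_one_add_smul h.posSemidef' (by positivity) hγ.le, ?_, ?_⟩
  · rw [← smul_Qbar hη hγ, map_smul, smul_comm]
    conv_lhs => rw [h.eq]
    rfl
  · rw [← smul_Qbar' hη hγ, map_smul, smul_comm]
    conv_lhs => rw [h.eq', shiftTraceSum_eq]

/-- The form used for `c > 1`: with the two sides exchanged, the unit term sits on the `n × n` side,
which is now the larger one. -/
lemma IsDetEquiv.exactSol_swap (hη : 0 < η) (hγ : 0 < γ) {R : Matrix (Fin T) (Fin T) ℝ}
    {R' : Matrix (Fin n) (Fin n) ℝ} (h : IsDetEquiv W A η γ R R') :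
    ExactSol (lagSumLin T W) (toeplitzLin T W) (1 / (T : ℝ)) (1 / (T : ℝ)) (η⁻¹ • Aᵀ) (γ / η ^ 2)
      (1 + η ^ 2 • R') ((γ / η ^ 2) • (1 : Matrix (Fin T) (Fin T) ℝ) + γ • R) := by
  refine ⟨by simpa using posDef_one_add_smul h.posSemidef' one_pos (sq_nonneg η),
    posDef_one_add_smul h.posSemidef (by positivity) hγ.le, ?_, ?_⟩
  · rw [← smul_Qbar hη hγ, map_smul, smul_comm, ← Qbar'_eq_Qbar_transpose]
    conv_lhs => rw [h.eq', shiftTraceSum_eq]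
  · rw [← smul_Qbar' hη hγ, map_smul, smul_comm, Qbar'_eq_Qbar_transpose,
      Matrix.transpose_transpose]
    conv_lhs => rw [h.eq]
    rfl

lemma exists_isDetEquiv {w : ℝ} (hW : ‖W‖ ≤ w) (hw0 : 0 < w) (hw1 : w < 1)
    (A : Matrix (Fin n) (Fin T) ℝ) (hη : 0 < η) (hγ : 0 < γ) :
    ∃ R R', IsDetEquiv W A η γ R R' := by
  have hΦ := transferPair hW hw0 hw1 T
  have hT : (0 : ℝ) ≤ 1 / T := by positivity
  have hη2 : (0 : ℝ) < η ^ 2 := by positivity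
  obtain ⟨X, Y, h⟩ := exists_exactSol hΦ hT hT (η⁻¹ • A) (b := γ / η ^ 2) (by positivity)
  set R := (η ^ 2)⁻¹ • (X - 1) with hR
  set R' := γ⁻¹ • (Y - (γ / η ^ 2) • (1 : Matrix (Fin n) (Fin n) ℝ)) with hR'
  have hX : 1 + η ^ 2 • R = X := by
    rw [hR, smul_smul, mul_inv_cancel₀ hη2.ne', one_smul, add_sub_cancel]
  have hY : (γ / η ^ 2) • (1 : Matrix (Fin n) (Fin n) ℝ) + γ • R' = Y := by
    rw [hR', smul_smul, mul_inv_cancel₀ hγ.ne', one_smul, add_sub_cancel]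
  have e1 : R = (1 / (T : ℝ)) • toeplitzLin T W (Qbar A η γ R R') := by
    have h1 := h.eq_left
    rw [← hX, ← hY, ← smul_Qbar hη hγ, map_smul, smul_comm (1 / (T : ℝ))] at h1
    exact smul_right_injective _ hη2.ne' (add_left_cancel h1)
  have e2 : R' = (1 / (T : ℝ)) • lagSumLin T W (Qbar' A η γ R R') := by
    have h1 := h.eq_right
    rw [← hX, ← hY, ← smul_Qbar' hη hγ, map_smul, smul_comm (1 / (T : ℝ))] at h1
    exact smul_right_injective _ hγ.ne' (add_left_cancel h1)
  have p1 : 0 ≤ X - 1 := sub_nonneg.2 (h.one_le hΦ hT)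
  have p2 : 0 ≤ Y - (γ / η ^ 2) • (1 : Matrix (Fin n) (Fin n) ℝ) := by
    rw [sub_nonneg]
    conv_rhs => rw [h.eq_right]
    refine le_add_of_nonneg_right ?_
    simpa using smul_le_smul_of_nonneg hT
      (hΦ.symm.nonneg (schurInv_nonneg (η⁻¹ • A)ᵀ h.posDef_left h.posDef_right))
  refine ⟨R, R', ?_, ?_, e1, by rw [shiftTraceSum_eq]; exact e2⟩
  · exact (Matrix.nonneg_iff_posSemidef.1 p1).smul (inv_nonneg.2 hη2.le)
  · exact (Matrix.nonneg_iff_posSemidef.1 p2).smul (inv_nonneg.2 hγ.le)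

variable {c : ℝ}

/-- Both directions are used: one transfers existence to the `γ`-free system, the other applies the
stability theory to an arbitrary given solution. -/
lemma isLimitEquiv_iff_exactSol {w : ℝ} (hW : ‖W‖ ≤ w) (hw0 : 0 < w) (hw1 : w < 1) (hc0 : 0 ≤ c)
    (hc : c < 1) (R : Matrix (Fin T) (Fin T) ℝ) (R' : Matrix (Fin n) (Fin n) ℝ) :
    IsLimitEquiv c W R R' ↔
      ExactSol (toeplitzLin T W) (lagSumLin T W) (c * (1 / (n : ℝ))) (1 / (T : ℝ)) 0 0
        (1 + R) R' := by
  have hlt : δlt c = 1 := if_pos hc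
  have hgt : δgt c = 0 := if_neg hc.le.not_gt
  have hΦ := transferPair hW hw0 hw1 T
  constructor
  · intro h
    have h1 := h.posDef
    have h2 := h.posDef'
    have h3 := h.eq
    have h4 := h.eq'
    rw [hlt, one_smul] at h1 h4
    rw [hgt, zero_smul, zero_add] at h2 h3
    refine ⟨h1, h2, ?_, ?_⟩
    · rw [schurInv_zero, mul_smul]
      conv_lhs => rw [h3]
      rfl
    · rw [Matrix.transpose_zero, schurInv_zero, zero_smul, zero_add]
      conv_lhs => rw [h4, shiftTraceSum_eq]
  · intro h
    have h1 := h.eq_left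
    have h2 := h.eq_right
    rw [schurInv_zero, mul_smul] at h1
    rw [Matrix.transpose_zero, schurInv_zero, zero_smul, zero_add] at h2
    refine ⟨?_, h.posDef_right.posSemidef, ?_, ?_, ?_, ?_⟩
    · have := h.one_le hΦ (by positivity)
      rw [← Matrix.nonneg_iff_posSemidef]
      simpa using this
    · rw [hlt, one_smul]; exact h.posDef_left
    · rw [hgt, zero_smul, zero_add]; exact h.posDef_right
    · rw [hgt, zero_smul, zero_add]; exact add_left_cancel h1
    · rw [hlt, one_smul, shiftTraceSum_eq]; exact h2

lemma isLimitEquiv_iff_exactSol_swap {w : ℝ} (hW : ‖W‖ ≤ w) (hw0 : 0 < w) (hw1 : w < 1)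
    (hc : 1 < c) (R : Matrix (Fin T) (Fin T) ℝ) (R' : Matrix (Fin n) (Fin n) ℝ) :
    IsLimitEquiv c W R R' ↔
      ExactSol (lagSumLin T W) (toeplitzLin T W) (1 / (T : ℝ)) (c * (1 / (n : ℝ))) 0 0
        (1 + R') R := by
  have hlt : δlt c = 0 := if_neg hc.le.not_gt
  have hgt : δgt c = 1 := if_pos hc
  have hΦ := (transferPair hW hw0 hw1 T).symm
  constructor
  · intro h
    have h1 := h.posDef
    have h2 := h.posDef'
    have h3 := h.eq
    have h4 := h.eq'
    rw [hlt, zero_smul, zero_add] at h1 h4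
    rw [hgt, one_smul] at h2 h3
    refine ⟨h2, h1, ?_, ?_⟩
    · rw [schurInv_zero]
      conv_lhs => rw [h4, shiftTraceSum_eq]
    · rw [Matrix.transpose_zero, schurInv_zero, zero_smul, zero_add, mul_smul]
      conv_lhs => rw [h3]
      rfl
  · intro h
    have h1 := h.eq_left
    have h2 := h.eq_right
    rw [schurInv_zero] at h1
    rw [Matrix.transpose_zero, schurInv_zero, zero_smul, zero_add, mul_smul] at h2
    refine ⟨h.posDef_right.posSemidef, ?_, ?_, ?_, ?_, ?_⟩
    · have := h.one_le hΦ (by positivity)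
      rw [← Matrix.nonneg_iff_posSemidef]
      simpa using this
    · rw [hlt, zero_smul, zero_add]; exact h.posDef_right
    · rw [hgt, one_smul]; exact h.posDef_left
    · rw [hgt, one_smul]; exact h2
    · rw [hlt, zero_smul, zero_add, shiftTraceSum_eq]; exact add_left_cancel h1

lemma Qlim_eq (hc : c < 1) (A : Matrix (Fin n) (Fin T) ℝ) (η : ℝ) (R : Matrix (Fin T) (Fin T) ℝ)
    (R' : Matrix (Fin n) (Fin n) ℝ) :
    Qlim c A η R R' = schurInv (η⁻¹ • A) R' (1 + R) := by
  rw [Qlim, schurInv, show δlt c = 1 from if_pos hc, show δgt c = 0 from if_neg hc.le.not_gt]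
  congr 1
  simp [smul_smul, pow_two]

lemma Qlim'_eq (hc : c < 1) (A : Matrix (Fin n) (Fin T) ℝ) (η : ℝ) (R : Matrix (Fin T) (Fin T) ℝ)
    (R' : Matrix (Fin n) (Fin n) ℝ) :
    Qlim' c A η R R' = schurInv (η⁻¹ • A)ᵀ (1 + R) R' := by
  rw [Qlim', schurInv, show δlt c = 1 from if_pos hc, show δgt c = 0 from if_neg hc.le.not_gt]
  congr 1
  simp [smul_smul, pow_two]

lemma Qlim_eq_swap (hc : 1 < c) (A : Matrix (Fin n) (Fin T) ℝ) (η : ℝ)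
    (R : Matrix (Fin T) (Fin T) ℝ) (R' : Matrix (Fin n) (Fin n) ℝ) :
    Qlim c A η R R' = schurInv (η⁻¹ • Aᵀ)ᵀ (1 + R') R := by
  rw [Qlim, schurInv, show δlt c = 0 from if_neg hc.le.not_gt, show δgt c = 1 from if_pos hc]
  congr 1
  simp [smul_smul, pow_two]

lemma Qlim'_eq_swap (hc : 1 < c) (A : Matrix (Fin n) (Fin T) ℝ) (η : ℝ)
    (R : Matrix (Fin T) (Fin T) ℝ) (R' : Matrix (Fin n) (Fin n) ℝ) :
    Qlim' c A η R R' = schurInv (η⁻¹ • Aᵀ) R (1 + R') := by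
  rw [Qlim', schurInv, show δlt c = 0 from if_neg hc.le.not_gt, show δgt c = 1 from if_pos hc]
  congr 1
  simp [smul_smul, pow_two]

lemma norm_sq_le_of_norm_mul_transpose_le {K : ℝ} (h : ‖A * Aᵀ‖ ≤ K) : ‖A‖ ^ 2 ≤ K := by
  have := Matrix.l2_opNorm_conjTranspose_mul_self Aᵀ
  rw [Matrix.conjTranspose_eq_transpose_of_trivial, Matrix.transpose_transpose,
    norm_transpose_eq] at this
  rw [pow_two, ← this]
  exact h

lemma TraceBound.smul {t a : ℝ} (ha : 0 ≤ a) (h : TraceBound A t) : TraceBound (a • A) (a * t) :=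
  fun Z => by
    rw [Matrix.smul_mul, Matrix.trace_smul, smul_eq_mul, abs_mul, abs_of_nonneg ha, mul_assoc]
    exact mul_le_mul_of_nonneg_left (h Z) ha

end Bridge

/-! ### Verification of the regime for `c < 1` and `c > 1`. -/

section Asymptotics

variable {T : ℕ → ℕ} {c : ℝ}

lemma tendsto_one_div_size (hc : Tendsto (fun n : ℕ => (n : ℝ) / (T n : ℝ)) atTop (𝓝 c)) :
    Tendsto (fun n : ℕ => 1 / (T n : ℝ)) atTop (𝓝 0) := by
  have h1 := hc.mul (tendsto_one_div_atTop_nhds_zero_nat (𝕜 := ℝ))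
  rw [mul_zero] at h1
  refine h1.congr' ?_
  filter_upwards [eventually_gt_atTop 0] with n hn
  have : (n : ℝ) ≠ 0 := by positivity
  field_simp

lemma tendsto_abs_sub_mul (hT : ∀ n, 0 < T n)
    (hc : Tendsto (fun n : ℕ => (n : ℝ) / (T n : ℝ)) atTop (𝓝 c)) :
    Tendsto (fun n : ℕ => |1 / (T n : ℝ) - c * (1 / (n : ℝ))| * n) atTop (𝓝 0) := by
  have h1 := (hc.sub_const c).abs
  rw [sub_self, abs_zero] at h1
  refine h1.congr' ?_
  filter_upwards [eventually_gt_atTop 0] with n hn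
  have hn' : (0 : ℝ) < n := by positivity
  have hT' : (0 : ℝ) < T n := by exact_mod_cast hT n
  conv_rhs => rw [← abs_of_pos hn', ← abs_mul, abs_of_pos hn']
  congr 1
  field_simp

variable {W : (n : ℕ) → Matrix (Fin n) (Fin n) ℝ} {m : (n : ℕ) → Fin n → ℝ} {u : ℕ → ℤ → ℝ}
  {A : (n : ℕ) → Matrix (Fin n) (Fin (T n)) ℝ} {w K η : ℝ}

/-- The data matrices are asymptotically negligible in normalized trace. -/
lemma eventually_traceBound (hc : Tendsto (fun n : ℕ => (n : ℝ) / (T n : ℝ)) atTop (𝓝 c))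
    (hη : 0 < η) (hw1 : w < 1) (hW : ∀ n, ‖W n‖ ≤ w)
    (hA : ∀ n, A n = dataMatrix (T n) (W n) (m n) (u n)) (hK : ∀ n, ‖A n‖ ^ 2 ≤ K)
    {ε : ℝ} (hε : 0 < ε) :
    ∀ᶠ n in atTop, ∃ t, 0 ≤ t ∧ TraceBound (η⁻¹ • A n) t ∧ 1 / (T n : ℝ) * t ≤ ε := by
  have hw0 : 0 ≤ w := (norm_nonneg _).trans (hW 0)
  have hK0 : 0 ≤ K := (sq_nonneg _).trans (hK 0)
  have hL : Tendsto (fun L : ℕ => η⁻¹ * ((6 * L * 0 + c * w ^ L) * (K + 1))) atTop (𝓝 0) := by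
    have h := (((tendsto_pow_atTop_nhds_zero_of_lt_one hw0 hw1).const_mul c).mul_const
      (K + 1)).const_mul η⁻¹
    simpa using h
  -- `L` is fixed first, making the norm part `c w ^ L` small; the rank part `6 L / T` then vanishes
  -- as `n` grows.
  obtain ⟨L, hLε⟩ := (hL.eventually_lt_const hε).exists
  have hlim : Tendsto (fun n : ℕ => η⁻¹ * ((6 * L * (1 / (T n : ℝ)) + (n / T n : ℝ) * w ^ L)
      * (K + 1))) atTop (𝓝 (η⁻¹ * ((6 * L * 0 + c * w ^ L) * (K + 1)))) :=
    ((((tendsto_one_div_size hc).const_mul (6 * (L : ℝ))).add (hc.mul_const _)).mul_const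
      _).const_mul _
  filter_upwards [hlim.eventually_lt_const hLε] with n hn
  refine ⟨η⁻¹ * ((6 * L + n * w ^ L) * ‖A n‖), by positivity, TraceBound.smul (by positivity) ?_, ?_⟩
  · rw [hA]
    exact traceBound_dataMatrix (hW n) hw1.le (m n) (u n) L
  · have hA1 : ‖A n‖ ≤ K + 1 := by nlinarith [hK n, sq_nonneg (‖A n‖ - 1)]
    calc 1 / (T n : ℝ) * (η⁻¹ * ((6 * L + n * w ^ L) * ‖A n‖))
        ≤ 1 / (T n : ℝ) * (η⁻¹ * ((6 * L + n * w ^ L) * (K + 1))) := by gcongr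
      _ = η⁻¹ * ((6 * L * (1 / (T n : ℝ)) + (n / T n : ℝ) * w ^ L) * (K + 1)) := by ring
      _ ≤ ε := hn.le

lemma norm_inv_smul_sq_le (hη : 0 < η) {n k : ℕ} {B : Matrix (Fin n) (Fin k) ℝ}
    (hB : ‖B‖ ^ 2 ≤ K) : ‖η⁻¹ • B‖ ^ 2 ≤ K / η ^ 2 := by
  rw [norm_smul, mul_pow, Real.norm_of_nonneg (by positivity), inv_pow, div_eq_inv_mul]
  gcongr

theorem regime_of_lt_one (hT : ∀ n, 0 < T n)
    (hc : Tendsto (fun n : ℕ => (n : ℝ) / (T n : ℝ)) atTop (𝓝 c)) (hc0 : 0 ≤ c) (hc1 : c < 1)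
    (hη : 0 < η) (hw0 : 0 < w) (hw1 : w < 1) (hW : ∀ n, ‖W n‖ ≤ w)
    (hA : ∀ n, A n = dataMatrix (T n) (W n) (m n) (u n)) (hK : ∀ n, ‖A n‖ ^ 2 ≤ K) :
    Regime (d := T) (e := fun n => n) (fun n => toeplitzLin (T n) (W n))
      (fun n => lagSumLin (T n) (W n)) (fun n => η⁻¹ • A n) (fun n => 1 / (T n : ℝ))
      (fun n => c * (1 / (n : ℝ))) (fun n => 1 / (T n : ℝ)) (1 / 4) ((1 / (1 - w)) ^ 2)
      ((1 - c) / 2) 1 (K / η ^ 2) := by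
  have hTr : ∀ n, (0 : ℝ) < T n := fun n => by exact_mod_cast hT n
  have hev : ∀ᶠ n : ℕ in atTop, (n : ℝ) / T n ≤ (1 + c) / 2 :=
    hc.eventually_le_const (by linarith)
  refine ⟨fun n => transferPair (hW n) hw0 hw1 (T n), fun n => by positivity,
    fun n => by positivity, fun n => by positivity, by linarith,
    fun n => norm_inv_smul_sq_le hη (hK n), ?_, ?_, ?_,
    fun ε hε => eventually_traceBound hc hη hw1 hW hA hK hε⟩
  · filter_upwards [hev] with n hn
    have h0 := hTr n
    have e1 : 1 / (T n : ℝ) * T n = 1 := by field_simp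
    have e2 : 1 / (T n : ℝ) * n = n / T n := by ring
    rw [mul_sub, e1, e2]
    exact ⟨by linarith, by linarith, le_rfl⟩
  · filter_upwards [hev, eventually_gt_atTop 0] with n hn hn0
    have h0 := hTr n
    have hn' : (0 : ℝ) < n := by positivity
    have e1 : 1 / (T n : ℝ) * T n = 1 := by field_simp
    have e3 : c * (1 / (n : ℝ)) * n = c := by field_simp
    -- The least `ρ ≥ 1` with `c/n ≤ ρ/T`. Then `ρ n/T = max (n/T) c`, which stays below `(1 +
    -- c)/2`.
    refine ⟨max 1 (c * (T n / n)), le_max_left _ _, ?_, ?_, by rw [e3]; exact hc1.le, e1.le⟩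
    · calc c * (1 / (n : ℝ)) = c * (T n / n) * (1 / (T n : ℝ)) := by field_simp
        _ ≤ _ := by gcongr; exact le_max_right _ _
    · have e4 : 1 / (T n : ℝ) * (max 1 (c * (T n / n)) * n) = max (n / T n : ℝ) c := by
        rw [max_mul_of_nonneg _ _ hn'.le, mul_max_of_nonneg _ _ (by positivity)]
        congr 1 <;> field_simp
      rw [mul_sub, e1, e4]
      have : max (n / T n : ℝ) c ≤ (1 + c) / 2 := max_le hn (by linarith)
      linarith
  · simpa using tendsto_abs_sub_mul hT hc

theorem regime_of_one_lt (hT : ∀ n, 0 < T n)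
    (hc : Tendsto (fun n : ℕ => (n : ℝ) / (T n : ℝ)) atTop (𝓝 c)) (hc1 : 1 < c)
    (hη : 0 < η) (hw0 : 0 < w) (hw1 : w < 1) (hW : ∀ n, ‖W n‖ ≤ w)
    (hA : ∀ n, A n = dataMatrix (T n) (W n) (m n) (u n)) (hK : ∀ n, ‖A n‖ ^ 2 ≤ K) :
    Regime (d := fun n => n) (e := T) (fun n => lagSumLin (T n) (W n))
      (fun n => toeplitzLin (T n) (W n)) (fun n => η⁻¹ • (A n)ᵀ) (fun n => 1 / (T n : ℝ))
      (fun n => 1 / (T n : ℝ)) (fun n => c * (1 / (n : ℝ))) (1 / 4) ((1 / (1 - w)) ^ 2)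
      ((c - 1) / 2) (c + 1) (K / η ^ 2) := by
  have hTr : ∀ n, (0 : ℝ) < T n := fun n => by exact_mod_cast hT n
  have hc0 : 0 < c := by linarith
  -- Two lower bounds for `n/T`: the first gives `n/T - 1 ≥ (c - 1)/2`, the second gives `c T/n ≤ (1
  -- + c)/2`.
  have hlow : max ((1 + c) / 2) (2 * c / (1 + c)) < c := by
    refine max_lt (by linarith) ?_
    rw [div_lt_iff₀ (by linarith)]
    nlinarith
  have hev := hc.eventually_const_le hlow
  have hev' : ∀ᶠ n : ℕ in atTop, (n : ℝ) / T n ≤ c + 1 := hc.eventually_le_const (by linarith)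
  refine ⟨fun n => (transferPair (hW n) hw0 hw1 (T n)).symm, fun n => by positivity,
    fun n => by positivity, fun n => by positivity, by linarith,
    fun n => norm_inv_smul_sq_le hη (by rw [norm_transpose_eq]; exact hK n), ?_, ?_, ?_, ?_⟩
  · filter_upwards [hev, hev'] with n hn hn'
    have h0 := hTr n
    have e1 : 1 / (T n : ℝ) * T n = 1 := by field_simp
    have e2 : 1 / (T n : ℝ) * n = n / T n := by ring
    have h1 := (le_max_left _ _).trans hn
    rw [mul_sub, e1, e2]
    exact ⟨by linarith, by linarith, hn'⟩
  · filter_upwards [hev, eventually_gt_atTop 0] with n hn hn0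
    have h0 := hTr n
    have hn' : (0 : ℝ) < n := by positivity
    have e1 : 1 / (T n : ℝ) * T n = 1 := by field_simp
    have e3 : c * (1 / (n : ℝ)) * n = c := by field_simp
    -- The least `ρ ≥ 1` with `1/T ≤ ρ c/n`.
    refine ⟨max 1 (n / T n / c), le_max_left _ _, ?_, ?_, by rw [e1]; linarith,
      by rw [e3]; linarith⟩
    · calc 1 / (T n : ℝ) = n / T n / c * (c * (1 / (n : ℝ))) := by field_simp
        _ ≤ _ := by gcongr; exact le_max_right _ _
    · have e4 : c * (1 / (n : ℝ)) * (max 1 (n / T n / c) * T n) = max (c * (T n / n) : ℝ) 1 := by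
        rw [max_mul_of_nonneg _ _ h0.le, mul_max_of_nonneg _ _ (by positivity)]
        congr 1 <;> field_simp
      rw [mul_sub, e3, e4]
      have h1 := (le_max_right _ _).trans hn
      have h2 : c * (T n / n) ≤ (1 + c) / 2 := by
        rw [div_le_div_iff₀ (by linarith) h0] at h1
        rw [← mul_div_assoc, div_le_div_iff₀ hn' two_pos]
        linarith
      have : max (c * (T n / n) : ℝ) 1 ≤ (1 + c) / 2 := max_le h2 (by linarith)
      linarith
  · simpa using tendsto_abs_sub_mul hT hc
  · intro ε hε
    filter_upwards [eventually_traceBound hc hη hw1 hW hA hK hε] with n ⟨t, ht, hAt, hs⟩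
    exact ⟨t, ht, by simpa using hAt.transpose, hs⟩

end Asymptotics

end ESN

/-! ### Assembly of the two cases. -/

theorem proposition1
    (T : ℕ → ℕ) (hT : ∀ n, 0 < T n)
    (c : ℝ) (hc0 : 0 ≤ c) (hc1 : c ≠ 1)
    (hc : Tendsto (fun n : ℕ => (n : ℝ) / (T n : ℝ)) atTop (𝓝 c))
    (η : ℝ) (hη : 0 < η)
    (W : (n : ℕ) → Matrix (Fin n) (Fin n) ℝ)
    (hW : ∃ w < (1 : ℝ), ∀ n, ‖W n‖ ≤ w)
    (m : (n : ℕ) → Fin n → ℝ) (u : ℕ → ℤ → ℝ)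
    (A : (n : ℕ) → Matrix (Fin n) (Fin (T n)) ℝ)
    (hA : ∀ n, A n = ESN.dataMatrix (T n) (W n) (m n) (u n))
    (hAbdd : ∃ K : ℝ, ∀ n, ‖A n * (A n)ᵀ‖ ≤ K) :
    -- both systems are solvable
    (∀ n : ℕ, ∀ γ > 0, ∃ R R', ESN.IsDetEquiv (W n) (A n) η γ R R') ∧
    (∀ᶠ n : ℕ in atTop, ∃ (R : Matrix (Fin (T n)) (Fin (T n)) ℝ) (R' : Matrix (Fin n) (Fin n) ℝ),
      ESN.IsLimitEquiv c (W n) R R') ∧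
    -- and, whichever solutions are chosen, the small `γ` limits hold
    ∀ (Rγ : (n : ℕ) → ℝ → Matrix (Fin (T n)) (Fin (T n)) ℝ)
      (Rγ' : (n : ℕ) → ℝ → Matrix (Fin n) (Fin n) ℝ)
      (R : (n : ℕ) → Matrix (Fin (T n)) (Fin (T n)) ℝ)
      (R' : (n : ℕ) → Matrix (Fin n) (Fin n) ℝ),
      (∀ n, ∀ γ > 0, ESN.IsDetEquiv (W n) (A n) η γ (Rγ n γ) (Rγ' n γ)) →
      (∀ᶠ n : ℕ in atTop, ESN.IsLimitEquiv c (W n) (R n) (R' n)) →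
      (c < 1 →
        ESN.SmallGammaLimit (fun n γ => η ^ 2 • Rγ n γ) R ∧
        ESN.SmallGammaLimit (d := fun n => n) (fun n γ => γ • Rγ' n γ) R' ∧
        ESN.SmallGammaLimit (d := fun n => n)
          (fun n γ => η ^ 2 • ESN.Qbar (A n) η γ (Rγ n γ) (Rγ' n γ))
          (fun n => ESN.Qlim c (A n) η (R n) (R' n)) ∧
        ESN.SmallGammaLimit
          (fun n γ => γ • ESN.Qbar' (A n) η γ (Rγ n γ) (Rγ' n γ))
          (fun n => ESN.Qlim' c (A n) η (R n) (R' n))) ∧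
      (1 < c →
        ESN.SmallGammaLimit (fun n γ => γ • Rγ n γ) R ∧
        ESN.SmallGammaLimit (d := fun n => n) (fun n γ => η ^ 2 • Rγ' n γ) R' ∧
        ESN.SmallGammaLimit (d := fun n => n)
          (fun n γ => γ • ESN.Qbar (A n) η γ (Rγ n γ) (Rγ' n γ))
          (fun n => ESN.Qlim c (A n) η (R n) (R' n)) ∧
        ESN.SmallGammaLimit
          (fun n γ => η ^ 2 • ESN.Qbar' (A n) η γ (Rγ n γ) (Rγ' n γ))
          (fun n => ESN.Qlim' c (A n) η (R n) (R' n))) := by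
  obtain ⟨w₀, hw₀, hW₀⟩ := hW
  obtain ⟨K, hK⟩ := hAbdd
  -- The bound is enlarged to be positive, because the upper estimate of the lag form divides by
  -- `w`.
  obtain ⟨w, hw0, hw1, hW⟩ : ∃ w : ℝ, 0 < w ∧ w < 1 ∧ ∀ n, ‖W n‖ ≤ w :=
    ⟨max w₀ (1 / 2), lt_max_of_lt_right (by norm_num), max_lt hw₀ (by norm_num),
      fun n => (hW₀ n).trans (le_max_left _ _)⟩
  have hK' := fun n => ESN.norm_sq_le_of_norm_mul_transpose_le (hK n)
  refine ⟨fun n γ hγ => ESN.exists_isDetEquiv (hW n) hw0 hw1 (A n) hη hγ, ?_,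
    fun Rγ Rγ' R R' hγ hfree => ⟨fun hlt => ?_, fun hgt => ?_⟩⟩
  · rcases lt_or_gt_of_ne hc1 with hlt | hgt
    · have hreg := ESN.regime_of_lt_one hT hc hc0 hlt hη hw0 hw1 hW hA hK'
      filter_upwards [hreg.exists_free] with n ⟨X, Y, h⟩
      refine ⟨X - 1, Y, (ESN.isLimitEquiv_iff_exactSol (hW n) hw0 hw1 hc0 hlt _ _).2 ?_⟩
      rwa [add_sub_cancel]
    · have hreg := ESN.regime_of_one_lt hT hc hgt hη hw0 hw1 hW hA hK'
      filter_upwards [hreg.exists_free] with n ⟨X, Y, h⟩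
      refine ⟨Y, X - 1, (ESN.isLimitEquiv_iff_exactSol_swap (hW n) hw0 hw1 hgt _ _).2 ?_⟩
      rwa [add_sub_cancel]
  · have hreg := ESN.regime_of_lt_one hT hc hc0 hlt hη hw0 hw1 hW hA hK'
    obtain ⟨hX, hY, hQ, hQ'⟩ := hreg.smallGammaLimit hη
      (fun n γ h0 => (hγ n γ h0).exactSol hη h0)
      (hfree.mono fun n hn => (ESN.isLimitEquiv_iff_exactSol (hW n) hw0 hw1 hc0 hlt _ _).1 hn)
    refine ⟨?_, ?_, ?_, ?_⟩
    · exact (hX.sub (ESN.smallGammaLimit_const fun _ => 1)).congr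
        (fun n γ _ => add_sub_cancel_left _ _)
        (Eventually.of_forall fun n => add_sub_cancel_left _ _)
    · exact (hY.sub (ESN.smallGammaLimit_div_smul_one (d := fun n => n) (pow_pos hη 2))).congr
        (fun n γ _ => add_sub_cancel_left _ _) (Eventually.of_forall fun n => sub_zero _)
    · exact hQ.congr (fun n γ h0 => (ESN.smul_Qbar hη h0 _ _ _).symm)
        (Eventually.of_forall fun n => (ESN.Qlim_eq hlt _ _ _ _).symm)
    · exact hQ'.congr (fun n γ h0 => (ESN.smul_Qbar' hη h0 _ _ _).symm)
        (Eventually.of_forall fun n => (ESN.Qlim'_eq hlt _ _ _ _).symm)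
  · have hreg := ESN.regime_of_one_lt hT hc hgt hη hw0 hw1 hW hA hK'
    obtain ⟨hX, hY, hQ, hQ'⟩ := hreg.smallGammaLimit hη
      (fun n γ h0 => (hγ n γ h0).exactSol_swap hη h0)
      (hfree.mono fun n hn => (ESN.isLimitEquiv_iff_exactSol_swap (hW n) hw0 hw1 hgt _ _).1 hn)
    refine ⟨?_, ?_, ?_, ?_⟩
    · exact (hY.sub (ESN.smallGammaLimit_div_smul_one (pow_pos hη 2))).congr
        (fun n γ _ => add_sub_cancel_left _ _) (Eventually.of_forall fun n => sub_zero _)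
    · exact (hX.sub (ESN.smallGammaLimit_const (d := fun n => n) fun _ => 1)).congr
        (fun n γ _ => add_sub_cancel_left _ _)
        (Eventually.of_forall fun n => add_sub_cancel_left _ _)
    · refine hQ'.congr (fun n γ h0 => ?_)
        (Eventually.of_forall fun n => (ESN.Qlim_eq_swap hgt _ _ _ _).symm)
      rw [← ESN.smul_Qbar' hη h0, ESN.Qbar'_eq_Qbar_transpose, Matrix.transpose_transpose]
    · refine hQ.congr (fun n γ h0 => ?_)
        (Eventually.of_forall fun n => (ESN.Qlim'_eq_swap hgt _ _ _ _).symm)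
      rw [← ESN.smul_Qbar hη h0, ESN.Qbar'_eq_Qbar_transpose]
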